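/- **Setting.** Let $m\ge 0$, let $W$ be a compact $m$-manifold, and let $S^1$ be the circle with its standard orientation. *Spacetime* is a $(5+m)$-dimensional semi-Riemannian manifold $(M,g)$ of signature $(-,+,+,+,-,+,\dots,+)$, with a smooth locally trivial fibration $\pi:M\to B$ with fiber $S^1\times W$ over a $4$-manifold $B$, and a smooth map $\Phi=(h,f):M\to S^1\times W$ whose restriction to every fiber of $\pi$ is a diffeomorphism onto $S^1\times W$. Through $x\in M$ pass the fibers $S^1_x=\{y:\pi(y)=\pi(x),\,f(y)=f(x)\}$ and $W_x=\{y:\pi(y)=\pi(x),\,h(y)=h(x)\}$; it is assumed that $g$ is negative definite on each $T_xS^1_x$ and positive definite on each $T_xW_x$. The horizontal space is $H_x=(\ker d\pi_x)^{\perp}$, a Lorentzian $4$-space, and the spaces $H_x$ are time-oriented by a smooth timelike horizontal vector field. Let $Y$ be the smooth vector field tangent to the circles $S^1_x$, positively oriented, with $g(Y,Y)=-1$; it is assumed that $Y$ is a Killing field. Put $F=d(Y^\flat)$. **Conventions.** $\nabla$ is the Levi-Civita connection; $\langle U,V\rangle=g(U,V)$; $G=2\,\mathrm{Ric}-S\,g$,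 where $S$ is the scalar curvature. For a $(0,2)$-tensor $T$, the endomorphism ${}^eT$ is given by $g(u,{}^eT(v))=T(u,v)$, $\nabla\cdot T$ is the vector field $(\nabla\cdot T)^k=g^{kl}g^{ij}\nabla_iT_{jl}$, and $|T|_g=T_{ij}T^{ij}$. All orthogonal projections are with respect to $g$. **Fluids.** An open set $D\subset M$ is a *fluid domain* if at every $x\in D$ the endomorphism $pr_{H}\circ({}^eG|_{H})$ of $H_x$ has a timelike one-dimensional eigenspace $E_{-\mu}(x)$ of eigenvalue $-\mu(x)<0$. Let $X_0$ be the smooth vector field on $D$ such that $X_0(x)$ is the future-directed vector of $E_{-\mu}(x)$ with $\langle X_0,X_0\rangle=-1$. Put $e=G(X_0,Y)$ and $X=X_0+\frac e\mu Y$. Let $pr_T$ be the orthogonal projection onto the time-plane $T_x=\mathrm{span}(X_0(x),Y(x))$, and let the pressure $P$ be $P(u,v)=G(u,v)-G(pr_Tu,pr_Tv)$. The fluid is *perfect* if ${}^eP(Y)=0$ on $D$. **Theorem.** For a perfect fluid on $D$, the functions $\mu$ and $e$ are smooth on $D$, and on $D$: - (energy conservation) $\nabla\cdot(\mu X)=\nabla\cdot(\mu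 X_0)=\langle X_0,\nabla\cdot P\rangle$; - (charge conservation) $\nabla\cdot(eX)=\nabla\cdot(eX_0)=0$; - $\mu^2X\!\left(\frac e\mu\right)=\mu^2X_0\!\left(\frac e\mu\right)=-e\,\langle X_0,\nabla\cdot P\rangle$; - (motion of the fluid) $\mu\nabla_XX=-\nabla\cdot P-\langle X_0,\nabla\cdot P\rangle X$; - (motion of the apparent fluid) $\mu\nabla_{X_0}X_0=e\,{}^eF(X_0)-\nabla\cdot P-\langle X_0,\nabla\cdot P\rangle X_0$; - (Maxwell equations) $dF=0$ and $\nabla\cdot F=eX_0+\tfrac12|F|_g\,Y$; in particular $pr_{H}(\nabla\cdot F)=eX_0$. -/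

import Mathlib

open scoped Manifold ContDiff

set_option maxSynthPendingDepth 3

noncomputable section

namespace KaluzaKlein

/-! ## Multilinear algebra on a finite-dimensional real vector space

`E` is a finite-dimensional real vector space, `g` a nondegenerate symmetric bilinear form. -/

section Algebra

variable {E : Type*} [NormedAddCommGroup E] [NormedSpace ℝ E] [FiniteDimensional ℝ E]

/-- The trace of endomorphisms, as a continuous linear form. -/
def traceL (E : Type*) [NormedAddCommGroup E] [NormedSpace ℝ E] [FiniteDimensional ℝ E] :
    (E →L[ℝ] E) →L[ℝ] ℝ :=
  LinearMap.toContinuousLinearMap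
    ((LinearMap.trace ℝ E).comp (ContinuousLinearMap.coeLM ℝ))

/-- Exchange of the two arguments of a bilinear map, as a continuous linear map. -/
def flipL (E F G : Type*) [NormedAddCommGroup E] [NormedSpace ℝ E] [NormedAddCommGroup F]
    [NormedSpace ℝ F] [NormedAddCommGroup G] [NormedSpace ℝ G] :
    (E →L[ℝ] F →L[ℝ] G) →L[ℝ] (F →L[ℝ] E →L[ℝ] G) :=
  (ContinuousLinearMap.flipₗᵢ ℝ E F G).toContinuousLinearEquiv.toContinuousLinearMap

/-- The musical isomorphism `♯` of `g`: the inverse of `♭ : v ↦ g v`. -/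
def sharp (g : E →L[ℝ] E →L[ℝ] ℝ) : (E →L[ℝ] ℝ) →L[ℝ] E := g.inverse

/-- The endomorphism `ᵉT` associated to a bilinear form `T`: `g (u, ᵉT v) = T (u, v)`. -/
def endo (g T : E →L[ℝ] E →L[ℝ] ℝ) : E →L[ℝ] E := sharp g ∘L T.flip

/-- The full contraction `T_{ij} T^{ij} = g^{ik} g^{jl} T_{ij} T_{kl}`. -/
def normG (g T : E →L[ℝ] E →L[ℝ] ℝ) : ℝ :=
  traceL E ((sharp g ∘L T.flip) ∘L (sharp g ∘L T))

end Algebra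

/-! ## Semi-Riemannian geometry in a coordinate domain

`g : E → E →L[ℝ] E →L[ℝ] ℝ` is a metric on an open part of the vector space `E`. -/

section Local

variable {E : Type*} [NormedAddCommGroup E] [NormedSpace ℝ E]

/-- The Christoffel symbols of the first kind:
`[u, v; w] = (∂_u g (v, w) + ∂_v g (u, w) - ∂_w g (u, v)) / 2`. -/
def christoffelFirst (g : E → E →L[ℝ] E →L[ℝ] ℝ) (y : E) : E →L[ℝ] E →L[ℝ] E →L[ℝ] ℝ :=
  (1 / 2 : ℝ) • (fderiv ℝ g y + (fderiv ℝ g y).flip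
    - (flipL E E ℝ ∘L (fderiv ℝ g y).flip : E →L[ℝ] E →L[ℝ] E →L[ℝ] ℝ))

theorem christoffelFirst_apply (g : E → E →L[ℝ] E →L[ℝ] ℝ) (y u v w : E) :
    christoffelFirst g y u v w =
      1 / 2 * (fderiv ℝ g y u v w + fderiv ℝ g y v u w - fderiv ℝ g y w u v) := rfl

/-- The Christoffel symbols `Γ (u, v)` of the Levi-Civita connection:
`g (Γ (u, v), w) = [u, v; w]`. -/
def christoffel (g : E → E →L[ℝ] E →L[ℝ] ℝ) (y : E) : E →L[ℝ] E →L[ℝ] E :=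
  ContinuousLinearMap.compL ℝ E (E →L[ℝ] ℝ) E (sharp (g y)) ∘L christoffelFirst g y

theorem christoffel_apply (g : E → E →L[ℝ] E →L[ℝ] ℝ) (y u v : E) :
    christoffel g y u v = sharp (g y) (christoffelFirst g y u v) := rfl

/-- The Riemann curvature tensor, `R (u, v) w = ∇_u ∇_v w - ∇_v ∇_u w - ∇_{[u, v]} w`. -/
def curvature (g : E → E →L[ℝ] E →L[ℝ] ℝ) (y : E) : E →L[ℝ] E →L[ℝ] E →L[ℝ] E :=
  fderiv ℝ (christoffel g) y - (fderiv ℝ (christoffel g) y).flip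
    + (ContinuousLinearMap.compL ℝ E E E).bilinearComp (christoffel g y) (christoffel g y)
    - ((ContinuousLinearMap.compL ℝ E E E).bilinearComp (christoffel g y) (christoffel g y)).flip

theorem curvature_apply (g : E → E →L[ℝ] E →L[ℝ] ℝ) (y u v w : E) :
    curvature g y u v w =
      fderiv ℝ (christoffel g) y u v w - fderiv ℝ (christoffel g) y v u w
        + christoffel g y u (christoffel g y v w) - christoffel g y v (christoffel g y u w) := rfl

/-- The covariant derivative of a vector field, `u ↦ ∇_u V = ∂_u V + Γ (u, V)`. -/
def covDerivVec (g : E → E →L[ℝ] E →L[ℝ] ℝ) (V : E → E) (y : E) : E →L[ℝ] E :=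
  fderiv ℝ V y + (christoffel g y).flip (V y)

/-- The covariant derivative of a `(0,2)`-tensor field,
`(∇_u T) (v, w) = ∂_u T (v, w) - T (Γ (u, v), w) - T (v, Γ (u, w))`. -/
def covDerivBilin (g T : E → E →L[ℝ] E →L[ℝ] ℝ) (y : E) : E →L[ℝ] E →L[ℝ] E →L[ℝ] ℝ :=
  fderiv ℝ T y
    - (ContinuousLinearMap.compL ℝ E E (E →L[ℝ] ℝ) (T y) ∘L christoffel g y :
        E →L[ℝ] E →L[ℝ] E →L[ℝ] ℝ)
    - (flipL E E ℝ ∘L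
        ContinuousLinearMap.compL ℝ E E (E →L[ℝ] ℝ) (T y).flip ∘L christoffel g y :
        E →L[ℝ] E →L[ℝ] E →L[ℝ] ℝ)

theorem covDerivBilin_apply (g T : E → E →L[ℝ] E →L[ℝ] ℝ) (y u v w : E) :
    covDerivBilin g T y u v w =
      fderiv ℝ T y u v w - T y (christoffel g y u v) w - T y v (christoffel g y u w) := rfl

variable [FiniteDimensional ℝ E]

/-- The Ricci curvature, `Ric (v, w) = tr (u ↦ R (u, v) w)`. -/
def ricci (g : E → E →L[ℝ] E →L[ℝ] ℝ) (y : E) : E →L[ℝ] E →L[ℝ] ℝ :=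
  ContinuousLinearMap.compL ℝ E (E →L[ℝ] E) ℝ (traceL E) ∘L flipL E E E ∘L (curvature g y).flip

theorem ricci_apply (g : E → E →L[ℝ] E →L[ℝ] ℝ) (y v w : E) :
    ricci g y v w = traceL E (((curvature g y).flip v).flip w) := rfl

/-- The scalar curvature, the `g`-trace of the Ricci curvature. -/
def scalarCurvature (g : E → E →L[ℝ] E →L[ℝ] ℝ) (y : E) : ℝ := traceL E (endo (g y) (ricci g y))

/-- The tensor `G = 2 Ric - S g`, twice the Einstein tensor. -/
def einstein (g : E → E →L[ℝ] E →L[ℝ] ℝ) (y : E) : E →L[ℝ] E →L[ℝ] ℝ :=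
  (2 : ℝ) • ricci g y - scalarCurvature g y • g y

/-- The divergence of a `(0,2)`-tensor field as a 1-form, `(∇·T)_k = g^{ij} ∇_i T_{jk}`: its value
on `w` is the trace of `u ↦ ♯ ((∇_u T) (·, w))`. -/
def divForm (g T : E → E →L[ℝ] E →L[ℝ] ℝ) (y : E) : E →L[ℝ] ℝ :=
  traceL E ∘L ContinuousLinearMap.compL ℝ E (E →L[ℝ] ℝ) E (sharp (g y)) ∘L
    (flipL E E ℝ ∘L covDerivBilin g T y).flip

theorem divForm_apply (g T : E → E →L[ℝ] E →L[ℝ] ℝ) (y w : E) :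
    divForm g T y w =
      traceL E (sharp (g y) ∘L (flipL E E ℝ ∘L covDerivBilin g T y).flip w) := rfl

end Local

/-! ## Semi-Riemannian manifolds

In Mathlib the tangent space `TangentSpace 𝓘(ℝ, E) x` is the model space `E`, a tangent vector being
its own coordinate expression in the preferred chart at `x`. A tensor at `x` is therefore computed
from the expressions of the fields in the preferred chart at `x`, without further transport. -/

section Manifold

variable {E : Type*} [NormedAddCommGroup E] [NormedSpace ℝ E]
  {M : Type*} [TopologicalSpace M] [ChartedSpace E M]

variable (E M) in
/-- Vector fields on `M`. -/
abbrev VecField := (x : M) → TangentSpace 𝓘(ℝ, E) x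

variable (E M) in
/-- Fields of 1-forms on `M`. -/
abbrev FormField := (x : M) → (TangentSpace 𝓘(ℝ, E) x →L[ℝ] ℝ)

variable (E M) in
/-- Fields of bilinear forms, i.e. `(0,2)`-tensor fields, on `M`. -/
abbrev BilinField :=
  (x : M) → (TangentSpace 𝓘(ℝ, E) x →L[ℝ] TangentSpace 𝓘(ℝ, E) x →L[ℝ] ℝ)

/-- `V` is a smooth vector field on the set `D`. -/
def SmoothVecOn [IsManifold 𝓘(ℝ, E) ∞ M] (V : VecField E M) (D : Set M) : Prop :=
  haveI : IsManifold 𝓘(ℝ, E) 1 M := .of_le (n := ∞) (by simp)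
  ContMDiffOn 𝓘(ℝ, E) (𝓘(ℝ, E).prod 𝓘(ℝ, E)) ∞
    (fun x => (Bundle.TotalSpace.mk' E x (V x) : TangentBundle 𝓘(ℝ, E) M)) D

/-- The coordinates of the preferred chart at `x`. -/
def coord (x : M) : M → E := extChartAt 𝓘(ℝ, E) x

/-- The parametrization inverse to the preferred chart at `x`. -/
def param (x : M) : E → M := (extChartAt 𝓘(ℝ, E) x).symm

/-- The differential of the parametrization at `y`, a map from `E` to `T_{param x y} M`. -/
def dparam (x : M) (y : E) : E →L[ℝ] E := mfderiv 𝓘(ℝ, E) 𝓘(ℝ, E) (param (E := E) x) y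

/-- A vector field read in the preferred chart at `x`. -/
def localVec (V : VecField E M) (x : M) (y : E) : E :=
  (dparam x y).inverse (V (param x y) : E)

/-- A field of 1-forms read in the preferred chart at `x`. -/
def localForm (α : FormField E M) (x : M) (y : E) : E →L[ℝ] ℝ :=
  (α (param x y) : E →L[ℝ] ℝ) ∘L dparam x y

/-- A field of bilinear forms read in the preferred chart at `x`. -/
def localBilin (T : BilinField E M) (x : M) (y : E) : E →L[ℝ] E →L[ℝ] ℝ :=
  let A : E →L[ℝ] E →L[ℝ] ℝ := T (param x y)
  A.bilinearComp (dparam x y) (dparam x y)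

/-- The exterior derivative of a 1-form, `dα (u, v) = ∂_u α (v) - ∂_v α (u)`. -/
def extDerivOne (α : FormField E M) : BilinField E M := fun x =>
  let A : E →L[ℝ] E →L[ℝ] ℝ := fderiv ℝ (localForm α x) (coord x x)
  (A - A.flip : E →L[ℝ] E →L[ℝ] ℝ)

/-- The exterior derivative of a 2-form,
`dσ (u, v, w) = ∂_u σ (v, w) - ∂_v σ (u, w) + ∂_w σ (u, v)`. -/
def extDerivTwo (σ : BilinField E M) (x : M) (u v w : TangentSpace 𝓘(ℝ, E) x) : ℝ :=
  let A : E →L[ℝ] E →L[ℝ] E →L[ℝ] ℝ := fderiv ℝ (localBilin σ x) (coord x x)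
  A u v w - A v u w + A w u v

/-- The derivative `V(f)` of a function `f` along a vector field `V`. -/
def dirDeriv (V : VecField E M) (f : M → ℝ) (x : M) : ℝ := mvfderiv 𝓘(ℝ, E) f x (V x)

variable (E M) in
/-- A smooth semi-Riemannian metric on `M` (its signature is prescribed separately). -/
structure SemiRiemannianMetric [IsManifold 𝓘(ℝ, E) ∞ M] where
  /-- the scalar product on each tangent space -/
  val : BilinField E M
  symm : ∀ (x : M) (u v : TangentSpace 𝓘(ℝ, E) x), val x u v = val x v u
  nondegenerate : ∀ (x : M) (u : TangentSpace 𝓘(ℝ, E) x), (∀ v, val x u v = 0) → u = 0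
  smooth : ContMDiff 𝓘(ℝ, E) (𝓘(ℝ, E).prod 𝓘(ℝ, E →L[ℝ] E →L[ℝ] ℝ)) ∞
    (fun x => Bundle.TotalSpace.mk' (E →L[ℝ] E →L[ℝ] ℝ) x (val x))

namespace SemiRiemannianMetric

variable [FiniteDimensional ℝ E] [IsManifold 𝓘(ℝ, E) ∞ M] (g : SemiRiemannianMetric E M)

/-- The endomorphism field `ᵉT`, `g (u, ᵉT v) = T (u, v)`. -/
def endoField (T : BilinField E M) (x : M) : TangentSpace 𝓘(ℝ, E) x →L[ℝ] TangentSpace 𝓘(ℝ, E) x :=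
  endo (E := E) (g.val x) (T x)

/-- The contraction `|T|_g = T_{ij} T^{ij}`. -/
def norm (T : BilinField E M) (x : M) : ℝ := normG (E := E) (g.val x) (T x)

/-- The 1-form `V♭ = g (V, ·)`. -/
def flat (V : VecField E M) : FormField E M := fun x => g.val x (V x)

/-- The covariant derivative `∇ V` for the Levi-Civita connection, as the endomorphism
`u ↦ ∇_u V` of `T_x M`. -/
def nabla (V : VecField E M) (x : M) : TangentSpace 𝓘(ℝ, E) x →L[ℝ] TangentSpace 𝓘(ℝ, E) x :=
  (covDerivVec (localBilin g.val x) (localVec V x) (coord x x) : E →L[ℝ] E)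

/-- The vector field `∇_U V`. -/
def nablaAlong (U V : VecField E M) : VecField E M := fun x => g.nabla V x (U x)

/-- The divergence `∇·V` of a vector field, the trace of `∇ V`. -/
def div (V : VecField E M) (x : M) : ℝ := traceL E (g.nabla V x)

/-- The divergence `∇·T` of a `(0,2)`-tensor field, as a vector field:
`(∇·T)^k = g^{kl} g^{ij} ∇_i T_{jl}`. -/
def divBilin (T : BilinField E M) : VecField E M := fun x =>
  sharp (E := E) (g.val x) (divForm (localBilin g.val x) (localBilin T x) (coord x x))

/-- The curvature tensor `G = 2 Ric - S g`, twice the Einstein tensor. -/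
def einsteinField : BilinField E M := fun x =>
  (einstein (localBilin g.val x) (coord x x) : E →L[ℝ] E →L[ℝ] ℝ)

/-- `V` is a Killing vector field: `g (∇_u V, v) + g (∇_v V, u) = 0`. -/
def IsKilling (V : VecField E M) : Prop :=
  ∀ (x : M) (u v : TangentSpace 𝓘(ℝ, E) x),
    g.val x (g.nabla V x u) v + g.val x (g.nabla V x v) u = 0

/-- The `g`-orthogonal of a subspace of `T_x M`. -/
def perp (x : M) (V : Submodule ℝ (TangentSpace 𝓘(ℝ, E) x)) :
    Submodule ℝ (TangentSpace 𝓘(ℝ, E) x) where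
  carrier := {u | ∀ v ∈ V, g.val x u v = 0}
  zero_mem' := by
    intro v _
    simp
  add_mem' := by
    intro a b ha hb v hv
    simp [ha v hv, hb v hv]
  smul_mem' := by
    intro c a ha v hv
    simp [ha v hv]

open Classical in
/-- The `g`-orthogonal projection of `T_x M` onto a subspace `V` on which `g` is nondegenerate
(that is, `T_x M = V ⊕ V^⊥`). -/
def orthProj (x : M) (V : Submodule ℝ (TangentSpace 𝓘(ℝ, E) x)) : TangentSpace 𝓘(ℝ, E) x →ₗ[ℝ] V :=
  if h : IsCompl V (g.perp x V) then V.projectionOnto (g.perp x V) h else 0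

/-- `g` has signature `p` times `-`, `q` times `+` on the subspace `V` of `T_x M`. -/
def HasSignature (x : M) (V : Submodule ℝ (TangentSpace 𝓘(ℝ, E) x)) (p q : ℕ) : Prop :=
  ∃ N P : Submodule ℝ (TangentSpace 𝓘(ℝ, E) x),
    N ⊔ P = V ∧ Module.finrank ℝ N = p ∧ Module.finrank ℝ P = q ∧
    (∀ u ∈ N, u ≠ 0 → g.val x u u < 0) ∧ (∀ u ∈ P, u ≠ 0 → 0 < g.val x u u) ∧
    (∀ u ∈ N, ∀ v ∈ P, g.val x u v = 0)

end SemiRiemannianMetric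

end Manifold

/-! ## Spacetime -/

/-- The model space `ℝⁿ`. -/
abbrev R (n : ℕ) := EuclideanSpace ℝ (Fin n)

/-- Spacetime of dimension `5 + m`: a semi-Riemannian manifold `M` with a multi-fiber bundle
structure with fibers `(S¹, W)` over a 4-dimensional manifold `B`. -/
structure Spacetime (m : ℕ)
    (M : Type*) [TopologicalSpace M] [ChartedSpace (R (5 + m)) M] [IsManifold (𝓡 (5 + m)) ∞ M]
    (B : Type*) [TopologicalSpace B] [ChartedSpace (R 4) B] [IsManifold (𝓡 4) ∞ B]
    (W : Type*) [TopologicalSpace W] [ChartedSpace (R m) W] [IsManifold (𝓡 m) ∞ W] where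
  /-- the metric -/
  metric : SemiRiemannianMetric (R (5 + m)) M
  /-- the fibration `π` over classical spacetime -/
  proj : M → B
  /-- the component `h` of `Φ = (h, f) : M → S¹ × W` -/
  toCircle : M → Circle
  /-- the component `f` of `Φ = (h, f) : M → S¹ × W` -/
  toW : M → W
  proj_smooth : ContMDiff (𝓡 (5 + m)) (𝓡 4) ∞ proj
  toCircle_smooth : ContMDiff (𝓡 (5 + m)) (𝓡 1) ∞ toCircle
  toW_smooth : ContMDiff (𝓡 (5 + m)) (𝓡 m) ∞ toW
  /-- `π` is a smooth locally trivial fibration with fiber `S¹ × W` -/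
  locally_trivial : ∀ b : B, ∃ e : Bundle.Trivialization (Circle × W) proj, b ∈ e.baseSet ∧
    ContMDiffOn (𝓡 (5 + m)) ((𝓡 4).prod ((𝓡 1).prod (𝓡 m))) ∞ e e.source ∧
    ContMDiffOn ((𝓡 4).prod ((𝓡 1).prod (𝓡 m))) (𝓡 (5 + m)) ∞
      e.toOpenPartialHomeomorph.symm e.target
  /-- the restriction of `Φ` to each fiber of `π` is a diffeomorphism onto `S¹ × W`: it has a
  smooth inverse `s` -/
  fiber_diffeo : ∀ p : M, ∃ s : Circle × W → M,
    ContMDiff ((𝓡 1).prod (𝓡 m)) (𝓡 (5 + m)) ∞ s ∧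
    (∀ z, proj (s z) = proj p ∧ (toCircle (s z), toW (s z)) = z) ∧
    (∀ q, proj q = proj p → s (toCircle q, toW q) = q)
  /-- the total signature is `(-,+,+,+,-,+,...,+)` -/
  signature_total : ∀ x, metric.HasSignature x ⊤ 2 (3 + m)
  /-- the signature on the fibers `S¹_x` is `(-)` -/
  signature_circle : ∀ x, metric.HasSignature x
    (LinearMap.ker (mfderiv (𝓡 (5 + m)) (𝓡 4) proj x).toLinearMap ⊓
      LinearMap.ker (mfderiv (𝓡 (5 + m)) (𝓡 m) toW x).toLinearMap) 1 0
  /-- the signature on the fibers `W_x` is `(+,...,+)` -/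
  signature_W : ∀ x, metric.HasSignature x
    (LinearMap.ker (mfderiv (𝓡 (5 + m)) (𝓡 4) proj x).toLinearMap ⊓
      LinearMap.ker (mfderiv (𝓡 (5 + m)) (𝓡 1) toCircle x).toLinearMap) 0 m
  /-- a smooth timelike horizontal vector field, giving the time-orientation of the horizontal
  spaces -/
  timeField : VecField (R (5 + m)) M
  timeField_smooth : SmoothVecOn timeField Set.univ
  timeField_horizontal : ∀ x, timeField x ∈
    metric.perp x (LinearMap.ker (mfderiv (𝓡 (5 + m)) (𝓡 4) proj x).toLinearMap)
  timeField_timelike : ∀ x, metric.val x (timeField x) (timeField x) < 0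

namespace Spacetime

variable {m : ℕ}
  {M : Type*} [TopologicalSpace M] [ChartedSpace (R (5 + m)) M] [IsManifold (𝓡 (5 + m)) ∞ M]
  {B : Type*} [TopologicalSpace B] [ChartedSpace (R 4) B] [IsManifold (𝓡 4) ∞ B]
  {W : Type*} [TopologicalSpace W] [ChartedSpace (R m) W] [IsManifold (𝓡 m) ∞ W]
  (S : Spacetime m M B W)

/-- The tangent space to the fiber of `π` through `x`. -/
def vertical (x : M) : Submodule ℝ (TangentSpace (𝓡 (5 + m)) x) :=
  LinearMap.ker (mfderiv (𝓡 (5 + m)) (𝓡 4) S.proj x).toLinearMap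

/-- The tangent space to the fiber `S¹_x`, the fiber of `(π, f)` through `x`. -/
def circleTangent (x : M) : Submodule ℝ (TangentSpace (𝓡 (5 + m)) x) :=
  S.vertical x ⊓ LinearMap.ker (mfderiv (𝓡 (5 + m)) (𝓡 m) S.toW x).toLinearMap

/-- The horizontal space `H_x`, the orthogonal of the tangent space to the fiber of `π`. -/
def horizontal (x : M) : Submodule ℝ (TangentSpace (𝓡 (5 + m)) x) :=
  S.metric.perp x (S.vertical x)

/-- The curvature tensor `G = 2 Ric - S g`. -/
def G : BilinField (R (5 + m)) M := S.metric.einsteinField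

/-- `Y` is the electromagnetic potential: the smooth vector field tangent to the fibers `S¹_x` with
`g (Y, Y) = -1`, directed according to the standard (counterclockwise) orientation of `S¹`. -/
structure IsPotential (Y : VecField (R (5 + m)) M) : Prop where
  smooth : SmoothVecOn Y Set.univ
  tangent : ∀ x, Y x ∈ S.circleTangent x
  unit : ∀ x, S.metric.val x (Y x) (Y x) = -1
  oriented : ∀ x, ∃ t : ℝ, 0 < t ∧
    mvfderiv (𝓡 (5 + m)) (fun z => (S.toCircle z : ℂ)) x (Y x)
      = (t : ℂ) * (Complex.I * (S.toCircle x : ℂ))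

/-- The endomorphism `ᵉG_H = pr_H ∘ ᵉG|_H` of the horizontal space `H_x`. -/
def endoH (x : M) : Module.End ℝ (S.horizontal x) :=
  S.metric.orthProj x (S.horizontal x) ∘ₗ (S.metric.endoField S.G x).toLinearMap ∘ₗ
    (S.horizontal x).subtype

/-- `ᵉG_H` has at `x` a timelike one-dimensional eigenspace of eigenvalue `-μ < 0`. -/
def IsEnergyDensityAt (x : M) (μ : ℝ) : Prop :=
  0 < μ ∧ Module.finrank ℝ ((S.endoH x).eigenspace (-μ)) = 1 ∧
    ∀ u ∈ (S.endoH x).eigenspace (-μ), u ≠ 0 →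
      S.metric.val x (u : TangentSpace (𝓡 (5 + m)) x) (u : TangentSpace (𝓡 (5 + m)) x) < 0

/-- `D` is a fluid domain. -/
def IsFluidDomain (D : Set M) : Prop :=
  IsOpen D ∧ ∀ x ∈ D, ∃ μ : ℝ, S.IsEnergyDensityAt x μ

/-- `μ` is the energy density of the fluid on `D`. -/
def IsEnergyDensity (D : Set M) (μ : M → ℝ) : Prop := ∀ x ∈ D, S.IsEnergyDensityAt x (μ x)

/-- `X₀` is the apparent field of the fluid of energy density `μ` on `D`: the smooth vector field
on `D` such that `X₀ x` is the unit vector of the eigenspace `E_{-μ} (x)` in the chosen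
time-orientation. -/
structure IsApparentField (D : Set M) (μ : M → ℝ) (X₀ : VecField (R (5 + m)) M) : Prop where
  smooth : SmoothVecOn X₀ D
  eigenvector : ∀ x ∈ D, ∃ u ∈ (S.endoH x).eigenspace (-μ x),
    (u : TangentSpace (𝓡 (5 + m)) x) = X₀ x
  unit : ∀ x ∈ D, S.metric.val x (X₀ x) (X₀ x) = -1
  future : ∀ x ∈ D, S.metric.val x (X₀ x) (S.timeField x) < 0

/-- The electromagnetic field `F = d (Y♭)`. -/
def emField (Y : VecField (R (5 + m)) M) : BilinField (R (5 + m)) M :=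
  extDerivOne (S.metric.flat Y)

/-- The charge density `e = G (X₀, Y)`. -/
def charge (Y X₀ : VecField (R (5 + m)) M) (x : M) : ℝ := S.G x (X₀ x) (Y x)

/-- The vector field of the fluid `X = X₀ + (e / μ) Y`. -/
def fluidField (Y X₀ : VecField (R (5 + m)) M) (μ : M → ℝ) : VecField (R (5 + m)) M :=
  fun x => X₀ x + (S.charge Y X₀ x / μ x) • Y x

/-- The orthogonal projection of `T_x M` onto the time-plane generated by `X₀` and `Y`. -/
def timePlaneProj (Y X₀ : VecField (R (5 + m)) M) (x : M) :
    TangentSpace (𝓡 (5 + m)) x →ₗ[ℝ] TangentSpace (𝓡 (5 + m)) x :=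
  (Submodule.span ℝ {X₀ x, Y x}).subtype ∘ₗ
    S.metric.orthProj x (Submodule.span ℝ {X₀ x, Y x})

/-- The pressure `P = G - G|_T`, where `G|_T (u, v) = G (pr_T u, pr_T v)` is the restriction of `G`
to the time-plane `T`. -/
def pressure (Y X₀ : VecField (R (5 + m)) M) : BilinField (R (5 + m)) M := fun x =>
  let q : R (5 + m) →L[ℝ] R (5 + m) :=
    LinearMap.toContinuousLinearMap (S.timePlaneProj Y X₀ x : R (5 + m) →ₗ[ℝ] R (5 + m))
  let Gx : R (5 + m) →L[ℝ] R (5 + m) →L[ℝ] ℝ := S.G x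
  (Gx - Gx.bilinearComp q q : R (5 + m) →L[ℝ] R (5 + m) →L[ℝ] ℝ)

/-- The fluid domain `D` is a perfect fluid domain: `ᵉP (Y) = 0`. -/
def IsPerfect (D : Set M) (Y X₀ : VecField (R (5 + m)) M) : Prop :=
  ∀ x ∈ D, S.metric.endoField (S.pressure Y X₀) x (Y x) = 0

end Spacetime

end KaluzaKlein

end

/-! Three facts carry the proof. First, $G$ is divergence-free (`divForm_einstein`), by the
contracted second Bianchi identity. Second, the flow of the Killing field $Y$ preserves $g$, hence
the connection, the curvature and $G$ (`lie_christoffel`, `lie_curvature`, `lie_einstein`). Third,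
$[Y,X_0]=0$ (`lieBracketAt_eigenvector_eq_zero`), because $X_0$ is a unit eigenvector, with simple
eigenvalue, of an operator invariant under that flow: the bracket is horizontal, is again an
eigenvector for $-\mu$, hence a multiple of $X_0$, and is orthogonal to $X_0$. Consequently
$\nabla_YX_0=\nabla_{X_0}Y$ and $Y$ annihilates $\mu=G(X_0,X_0)$ and $e$; since $Y$ has constant
length, also $\nabla_YY=0$.

Perfectness gives $G(\cdot,Y)=-eX_0^\flat-G(Y,Y)Y^\flat$. The vector field ${}^eG(Y)$ has divergence
zero, since $G$ is symmetric and divergence-free and $\nabla Y$ is skew; its $Y$-component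
contributes nothing, so $\nabla\cdot(eX_0)=0$ (`trace_charge_smul_field`). Subtracting from $G$ its
four components on the time-plane and taking divergences yields the central identity
`divForm_pressure`: $-\nabla\cdot P=(\nabla\cdot(\mu X_0))X_0+\mu\nabla_{X_0}X_0+2e\nabla_{X_0}Y$.
Pairing with $X_0$ gives conservation of energy. As $F=2g(\nabla Y\,\cdot,\cdot)$, the last term is
$-e\,{}^eF(X_0)$, so the identity is the equation of motion of $X_0$. Comparing the conservation
laws of $eX_0$ and $\mu X_0$ gives the law for $e/\mu$. Replacing $X_0$ by $X$ adds exactly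
$2e\nabla_{X_0}Y$ and a multiple of $Y$ to the acceleration, which removes the electromagnetic
force.

For the Maxwell equations, $F$ is exact, and the second covariant derivative of a Killing field is a
curvature term (`second_covDeriv`), so $\nabla\cdot F$ is dual to $-2\,\mathrm{Ric}(Y,\cdot)$.
Comparison with $G(\cdot,Y)$ leaves $eX_0$ plus $Y$ with coefficient
$G(Y,Y)-S=2\,\mathrm{Ric}(Y,Y)=-2\,\mathrm{tr}(\nabla Y\circ\nabla Y)=\tfrac12|F|_g$.

All of this is computed in one chart, on an open subset of a vector space. The intrinsic fields are
defined at each point through the preferred chart of that point, so naturality under transition maps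
(`IsPullbackOn`) is what gives $G$, $F$ and the Killing equation their usual coordinate expressions
throughout a fixed chart. -/

namespace KaluzaKlein

/-! ### Linear algebra of a nondegenerate form. -/

section Algebra

variable {E : Type*} [NormedAddCommGroup E] [NormedSpace ℝ E]
theorem eq_of_flat_eq {B : E →L[ℝ] E →L[ℝ] ℝ} (hB : ∀ u, (∀ v, B u v = 0) → u = 0) {u v : E}
    (h : ∀ w, B u w = B v w) : u = v := by
  rw [← sub_eq_zero]
  exact hB _ fun w => by simp [h w]

variable [FiniteDimensional ℝ E]

theorem traceL_apply (A : E →L[ℝ] E) : traceL E A = LinearMap.trace ℝ E A.toLinearMap := rfl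

theorem traceL_comp_comm (A B : E →L[ℝ] E) : traceL E (A ∘L B) = traceL E (B ∘L A) := by
  simp only [traceL_apply, ContinuousLinearMap.toLinearMap_comp]
  exact LinearMap.trace_comp_comm' _ _

/-- A nondegenerate bilinear form as an isomorphism onto the dual space. -/
noncomputable def flatEquiv (B : E →L[ℝ] E →L[ℝ] ℝ) (hB : ∀ u, (∀ v, B u v = 0) → u = 0) :
    E ≃L[ℝ] (E →L[ℝ] ℝ) :=
  (LinearEquiv.ofInjectiveOfFinrankEq B.toLinearMap
    (by
      rw [← LinearMap.ker_eq_bot, LinearMap.ker_eq_bot']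
      intro u hu
      exact hB u fun v => by
        have := congrArg (fun f : E →L[ℝ] ℝ => f v) hu
        simpa using this)
    (by
      rw [← LinearEquiv.finrank_eq (LinearMap.toContinuousLinearMap (𝕜 := ℝ) (E := E) (F' := ℝ))]
      exact (Subspace.dual_finrank_eq).symm)).toContinuousLinearEquiv

theorem flatEquiv_coe (B : E →L[ℝ] E →L[ℝ] ℝ) (hB : ∀ u, (∀ v, B u v = 0) → u = 0) :
    (flatEquiv B hB : E →L[ℝ] (E →L[ℝ] ℝ)) = B := by
  ext u v
  rfl

theorem sharp_eq (B : E →L[ℝ] E →L[ℝ] ℝ) (hB : ∀ u, (∀ v, B u v = 0) → u = 0) :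
    sharp B = (flatEquiv B hB).symm := by
  conv_lhs => rw [← flatEquiv_coe B hB]
  exact ContinuousLinearMap.inverse_equiv _

theorem flat_sharp {B : E →L[ℝ] E →L[ℝ] ℝ} (hB : ∀ u, (∀ v, B u v = 0) → u = 0) (α : E →L[ℝ] ℝ) :
    B (sharp B α) = α := by
  rw [sharp_eq B hB]
  exact (flatEquiv B hB).apply_symm_apply α

theorem endo_left {B : E →L[ℝ] E →L[ℝ] ℝ} (hB : ∀ u, (∀ v, B u v = 0) → u = 0)
    (T : E →L[ℝ] E →L[ℝ] ℝ) (u v : E) : B (endo B T v) u = T u v := by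
  simp [endo, flat_sharp hB]

/-- An orthogonal basis with weights $c_i=1/B(b_i,b_i)$ replaces an orthonormal one, without square
roots or a case distinction on signs. Contractions with $g^{ij}$ become sums weighted by $c_i$;
orthogonality is only needed at the point where a tensor identity is checked. -/
theorem exists_weighted_basis {B : E →L[ℝ] E →L[ℝ] ℝ} (hB : ∀ u, (∀ v, B u v = 0) → u = 0)
    (hs : ∀ u v, B u v = B v u) :
    ∃ (n : ℕ) (b : Fin n → E) (c : Fin n → ℝ),
      (∀ u, u = ∑ i, (c i * B u (b i)) • b i) ∧
      (∀ A : E →L[ℝ] E, traceL E A = ∑ i, c i * B (A (b i)) (b i)) := by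
  let B' : LinearMap.BilinForm ℝ E := (ContinuousLinearMap.coeLM ℝ) ∘ₗ B.toLinearMap
  have hB' : ∀ u v, B' u v = B u v := fun u v => rfl
  obtain ⟨b, hb⟩ := LinearMap.BilinForm.exists_orthogonal_basis (B := B')
    ⟨fun u v => by simpa [hB'] using hs u v⟩
  have hort : ∀ i j, i ≠ j → B (b i) (b j) = 0 := fun i j hij => hb hij
  have key : ∀ u i, B u (b i) = b.repr u i * B (b i) (b i) := by
    intro u i
    conv_lhs => rw [← b.sum_repr u]
    rw [map_sum, sum_apply, Finset.sum_eq_single i]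
    · simp
    · intro j _ hj
      simp [hort j i hj]
    · simp
  -- An isotropic basis vector would be orthogonal to the whole basis, hence in the radical.
  have hne : ∀ i, B (b i) (b i) ≠ 0 := by
    intro i hi
    refine b.ne_zero i (hB _ fun v => ?_)
    rw [hs, key, hi, mul_zero]
  have hrep : ∀ u i, b.repr u i = (B (b i) (b i))⁻¹ * B u (b i) := by
    intro u i
    rw [key u i, mul_comm, mul_assoc, mul_inv_cancel₀ (hne i), mul_one]
  refine ⟨_, b, fun i => (B (b i) (b i))⁻¹, fun u => ?_, fun A => ?_⟩
  · conv_lhs => rw [← b.sum_repr u]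
    exact Finset.sum_congr rfl fun i _ => by rw [hrep]
  · rw [traceL_apply, LinearMap.trace_eq_matrix_trace ℝ b, Matrix.trace]
    refine Finset.sum_congr rfl fun i _ => ?_
    rw [Matrix.diag_apply, LinearMap.toMatrix_apply, hrep]
    rfl

/-- Meant for $T=F$ and $K=\nabla Y$. Skewness makes the two ways of raising an index $2K$ and
$-2K$, which accounts for the factor $-4$. -/
theorem normG_eq_of_antisymm {B T : E →L[ℝ] E →L[ℝ] ℝ} (hB : ∀ u, (∀ v, B u v = 0) → u = 0)
    {K : E →L[ℝ] E} (hT : ∀ u v, T u v = 2 * B (K u) v) (hK : ∀ u v, T u v = -T v u) :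
    normG B T = -4 * traceL E (K ∘L K) := by
  have h1 : sharp B ∘L T = (2 : ℝ) • K := by
    ext1 u
    refine eq_of_flat_eq hB fun w => ?_
    simp [flat_sharp hB, hT]
  have h2 : sharp B ∘L T.flip = (-2 : ℝ) • K := by
    ext1 u
    refine eq_of_flat_eq hB fun w => ?_
    simp [flat_sharp hB, hK w u, hT]
  rw [normG, h1, h2, ContinuousLinearMap.smul_comp, ContinuousLinearMap.comp_smul, map_smul,
    map_smul]
  simp only [smul_eq_mul]
  ring

end Algebra

/-! ### Product rules, the Levi-Civita connection in coordinates, smoothness of its invariants. -/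

section Metric

variable {E : Type*} [NormedAddCommGroup E] [NormedSpace ℝ E]

/-- `g` is a smooth semi-Riemannian metric on the open set `U`. -/
structure IsMetricOn (g : E → E →L[ℝ] E →L[ℝ] ℝ) (U : Set E) : Prop where
  isOpen : IsOpen U
  contDiffAt : ∀ y ∈ U, ContDiffAt ℝ ∞ g y
  symm : ∀ y ∈ U, ∀ u v, g y u v = g y v u
  nondeg : ∀ y ∈ U, ∀ u, (∀ v, g y u v = 0) → u = 0

theorem fderiv_apply_const {F G : Type*} [NormedAddCommGroup F] [NormedSpace ℝ F]
    [NormedAddCommGroup G] [NormedSpace ℝ G] {T : E → F →L[ℝ] G} {y : E}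
    (hT : DifferentiableAt ℝ T y) (u : E) (v : F) :
    fderiv ℝ (fun z => T z v) y u = fderiv ℝ T y u v := by
  rw [fderiv_clm_apply hT (differentiableAt_const v)]
  simp

theorem fderiv_apply₂_const {F G H : Type*} [NormedAddCommGroup F] [NormedSpace ℝ F]
    [NormedAddCommGroup G] [NormedSpace ℝ G] [NormedAddCommGroup H] [NormedSpace ℝ H]
    {T : E → F →L[ℝ] G →L[ℝ] H} {y : E}
    (hT : DifferentiableAt ℝ T y) (u : E) (v : F) (w : G) :
    fderiv ℝ (fun z => T z v w) y u = fderiv ℝ T y u v w := by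
  rw [fderiv_apply_const (T := fun z => T z v) (hT.clm_apply (differentiableAt_const v)),
    fderiv_apply_const hT]

theorem fderiv_clm_apply_apply {F G : Type*} [NormedAddCommGroup F] [NormedSpace ℝ F]
    [NormedAddCommGroup G] [NormedSpace ℝ G] {T : E → F →L[ℝ] G} {V : E → F} {y : E}
    (hT : DifferentiableAt ℝ T y) (hV : DifferentiableAt ℝ V y) (u : E) :
    fderiv ℝ (fun z => T z (V z)) y u = fderiv ℝ T y u (V y) + T y (fderiv ℝ V y u) := by
  rw [fderiv_clm_apply hT hV]
  simp [add_comm]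

theorem fderiv_clm_apply₂ {F G H : Type*} [NormedAddCommGroup F] [NormedSpace ℝ F]
    [NormedAddCommGroup G] [NormedSpace ℝ G] [NormedAddCommGroup H] [NormedSpace ℝ H]
    {T : E → F →L[ℝ] G →L[ℝ] H} {V : E → F} {W : E → G} {y : E}
    (hT : DifferentiableAt ℝ T y) (hV : DifferentiableAt ℝ V y) (hW : DifferentiableAt ℝ W y)
    (u : E) :
    fderiv ℝ (fun z => T z (V z) (W z)) y u =
      fderiv ℝ T y u (V y) (W y) + T y (fderiv ℝ V y u) (W y) + T y (V y) (fderiv ℝ W y u) := by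
  rw [fderiv_clm_apply_apply (T := fun z => T z (V z)) (hT.clm_apply hV) hW,
    fderiv_clm_apply_apply hT hV, add_apply]

theorem _root_.ContDiffAt.fderiv_infty {F : Type*} [NormedAddCommGroup F] [NormedSpace ℝ F]
    {f : E → F} {y : E} (hf : ContDiffAt ℝ ∞ f y) : ContDiffAt ℝ ∞ (fderiv ℝ f) y :=
  hf.fderiv_right (by simp)

theorem _root_.ContDiffAt.differentiableAt_infty {F : Type*} [NormedAddCommGroup F]
    [NormedSpace ℝ F] {f : E → F} {y : E} (hf : ContDiffAt ℝ ∞ f y) : DifferentiableAt ℝ f y :=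
  hf.differentiableAt (by simp)

theorem _root_.ContDiffAt.second_symm {F : Type*} [NormedAddCommGroup F]
    [NormedSpace ℝ F] {f : E → F} {y : E} (hf : ContDiffAt ℝ ∞ f y) (u v : E) :
    fderiv ℝ (fderiv ℝ f) y u v = fderiv ℝ (fderiv ℝ f) y v u :=
  (hf.isSymmSndFDerivAt (by simp; norm_cast)).eq u v

namespace IsMetricOn

variable {g : E → E →L[ℝ] E →L[ℝ] ℝ} {U : Set E} {y : E}

theorem mem_nhds (hg : IsMetricOn g U) (hy : y ∈ U) : U ∈ nhds y := hg.isOpen.mem_nhds hy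

theorem fderiv_symm (hg : IsMetricOn g U) (hy : y ∈ U) (u v w : E) :
    fderiv ℝ g y u v w = fderiv ℝ g y u w v := by
  have hd := (hg.contDiffAt y hy).differentiableAt_infty
  rw [← fderiv_apply₂_const hd, ← fderiv_apply₂_const hd]
  refine congrArg (fun f : E →L[ℝ] ℝ => f u) (Filter.EventuallyEq.fderiv_eq ?_)
  filter_upwards [hg.mem_nhds hy] with z hz using hg.symm z hz v w

theorem christoffel_symm (hg : IsMetricOn g U) (hy : y ∈ U) (u v : E) :
    christoffel g y u v = christoffel g y v u := by
  rw [christoffel_apply, christoffel_apply]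
  congr 1
  ext w
  simp only [christoffelFirst_apply, hg.fderiv_symm hy w u v]
  ring

variable [FiniteDimensional ℝ E]

theorem inner_christoffel (hg : IsMetricOn g U) (hy : y ∈ U) (u v w : E) :
    g y (christoffel g y u v) w =
      1 / 2 * (fderiv ℝ g y u v w + fderiv ℝ g y v u w - fderiv ℝ g y w u v) := by
  rw [christoffel_apply, flat_sharp (hg.nondeg y hy), christoffelFirst_apply]

/-- The Levi-Civita connection is compatible with the metric. -/
theorem fderiv_metric (hg : IsMetricOn g U) (hy : y ∈ U) (u v w : E) :
    fderiv ℝ g y u v w = g y (christoffel g y u v) w + g y v (christoffel g y u w) := by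
  rw [hg.symm y hy v, hg.inner_christoffel hy, hg.inner_christoffel hy, hg.fderiv_symm hy v u w,
    hg.fderiv_symm hy w u v, hg.fderiv_symm hy u w v]
  ring

/-- Inversion of linear maps is smooth at every invertible one, and nondegeneracy makes $g_y$
invertible. -/
theorem contDiffAt_sharp (hg : IsMetricOn g U) (hy : y ∈ U) :
    ContDiffAt ℝ ∞ (fun z => sharp (g z)) y := by
  have h : ContDiffAt ℝ ∞ (ContinuousLinearMap.inverse (R := ℝ) (M := E) (M₂ := E →L[ℝ] ℝ))
      (flatEquiv (g y) (hg.nondeg y hy) : E →L[ℝ] E →L[ℝ] ℝ) := contDiffAt_map_inverse _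
  rw [flatEquiv_coe] at h
  exact h.comp y (hg.contDiffAt y hy)

theorem contDiffAt_christoffel (hg : IsMetricOn g U) (hy : y ∈ U) :
    ContDiffAt ℝ ∞ (christoffel g) y := by
  have h0 := (hg.contDiffAt y hy).fderiv_infty
  have h1 : ContDiffAt ℝ ∞ (fun z => (fderiv ℝ g z).flip) y :=
    (ContinuousLinearMap.flipₗᵢ ℝ E E (E →L[ℝ] ℝ)).contDiff.contDiffAt.comp y h0
  have h2 : ContDiffAt ℝ ∞ (christoffelFirst g) y := by
    unfold christoffelFirst
    exact ((h0.add h1).sub (contDiffAt_const.clm_comp h1)).const_smul _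
  unfold christoffel
  exact ((ContinuousLinearMap.contDiff _).contDiffAt.comp y (hg.contDiffAt_sharp hy)).clm_comp h2

theorem contDiffAt_curvature (hg : IsMetricOn g U) (hy : y ∈ U) :
    ContDiffAt ℝ ∞ (curvature g) y := by
  have h := hg.contDiffAt_christoffel hy
  have h0 := h.fderiv_infty
  have hf : ∀ {T : E → E →L[ℝ] E →L[ℝ] E →L[ℝ] E}, ContDiffAt ℝ ∞ T y →
      ContDiffAt ℝ ∞ (fun z => (T z).flip) y := fun hT =>
    (ContinuousLinearMap.flipₗᵢ ℝ E E (E →L[ℝ] E)).contDiff.contDiffAt.comp y hT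
  have hb : ContDiffAt ℝ ∞ (fun z => (ContinuousLinearMap.compL ℝ E E E).bilinearComp
      (christoffel g z) (christoffel g z)) y := by
    unfold ContinuousLinearMap.bilinearComp
    have h3 : ContDiffAt ℝ ∞ (fun z => (ContinuousLinearMap.compL ℝ E E E ∘L christoffel g z).flip)
        y := (ContinuousLinearMap.flipₗᵢ ℝ E (E →L[ℝ] E) (E →L[ℝ] E)).contDiff.contDiffAt.comp y
          (contDiffAt_const.clm_comp h)
    exact hf (h3.clm_comp h)
  unfold curvature
  exact ((h0.sub (hf h0)).add hb).sub (hf hb)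

theorem contDiffAt_ricci (hg : IsMetricOn g U) (hy : y ∈ U) :
    ContDiffAt ℝ ∞ (ricci g) y := by
  unfold ricci
  exact contDiffAt_const.clm_comp (contDiffAt_const.clm_comp
    ((ContinuousLinearMap.flipₗᵢ ℝ E E (E →L[ℝ] E)).contDiff.contDiffAt.comp y
      (hg.contDiffAt_curvature hy)))

theorem contDiffAt_scalarCurvature (hg : IsMetricOn g U) (hy : y ∈ U) :
    ContDiffAt ℝ ∞ (scalarCurvature g) y := by
  unfold scalarCurvature endo
  exact (traceL E).contDiff.contDiffAt.comp y ((hg.contDiffAt_sharp hy).clm_comp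
    ((ContinuousLinearMap.flipₗᵢ ℝ E E ℝ).contDiff.contDiffAt.comp y (hg.contDiffAt_ricci hy)))

theorem contDiffAt_einstein (hg : IsMetricOn g U) (hy : y ∈ U) :
    ContDiffAt ℝ ∞ (einstein g) y := by
  unfold einstein
  exact ((hg.contDiffAt_ricci hy).const_smul _).sub
    ((hg.contDiffAt_scalarCurvature hy).smul (hg.contDiffAt y hy))

end IsMetricOn

end Metric

/-! ### Symmetries of the curvature and the vanishing divergence of the Einstein tensor. -/

section Bianchi

variable {E : Type*} [NormedAddCommGroup E] [NormedSpace ℝ E]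

theorem fderiv_apply₃_const {F G H I : Type*} [NormedAddCommGroup F] [NormedSpace ℝ F]
    [NormedAddCommGroup G] [NormedSpace ℝ G] [NormedAddCommGroup H] [NormedSpace ℝ H]
    [NormedAddCommGroup I] [NormedSpace ℝ I]
    {T : E → F →L[ℝ] G →L[ℝ] H →L[ℝ] I} {y : E}
    (hT : DifferentiableAt ℝ T y) (u : E) (v : F) (w : G) (x : H) :
    fderiv ℝ (fun z => T z v w x) y u = fderiv ℝ T y u v w x := by
  rw [fderiv_apply₂_const (T := fun z => T z v) (hT.clm_apply (differentiableAt_const v)),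
    fderiv_apply_const hT]

theorem curvature_antisymm (g : E → E →L[ℝ] E →L[ℝ] ℝ) (y u v w : E) :
    curvature g y u v w = -curvature g y v u w := by
  simp only [curvature_apply]
  abel

/-- The covariant derivative `(∇_u R) (a, b) c` of the curvature tensor. -/
noncomputable def covDerivCurvature (g : E → E →L[ℝ] E →L[ℝ] ℝ) (y u a b c : E) : E :=
  fderiv ℝ (curvature g) y u a b c + christoffel g y u (curvature g y a b c)
    - curvature g y (christoffel g y u a) b c - curvature g y a (christoffel g y u b) c
    - curvature g y a b (christoffel g y u c)

theorem ricci_eq_sum [FiniteDimensional ℝ E] {g : E → E →L[ℝ] E →L[ℝ] ℝ} {y : E} {n : ℕ} {b : Fin n → E} {c : Fin n → ℝ}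
    (htr : ∀ A : E →L[ℝ] E, traceL E A = ∑ i, c i * g y (A (b i)) (b i)) (v w : E) :
    ricci g y v w = ∑ i, c i * g y (curvature g y (b i) v w) (b i) := by
  rw [ricci_apply, htr]
  rfl

namespace IsMetricOn

variable {g : E → E →L[ℝ] E →L[ℝ] ℝ} {U : Set E} {y : E}

theorem covDerivBilin_symm (hg : IsMetricOn g U) (hy : y ∈ U) {T : E → E →L[ℝ] E →L[ℝ] ℝ}
    (hT : DifferentiableAt ℝ T y) (hs : ∀ z ∈ U, ∀ u v, T z u v = T z v u) (u v w : E) :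
    covDerivBilin g T y u v w = covDerivBilin g T y u w v := by
  have h : fderiv ℝ T y u v w = fderiv ℝ T y u w v := by
    rw [← fderiv_apply₂_const hT, ← fderiv_apply₂_const hT]
    refine congrArg (fun f : E →L[ℝ] ℝ => f u) (Filter.EventuallyEq.fderiv_eq ?_)
    filter_upwards [hg.mem_nhds hy] with z hz using hs z hz v w
  rw [covDerivBilin_apply, covDerivBilin_apply, h, hs y hy _ w, hs y hy v]
  ring

variable [FiniteDimensional ℝ E]

/-- The product rule applied to the coordinate formula. It isolates the second derivatives of
$\Gamma$, which cancel in the cyclic sum of the second Bianchi identity. -/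
theorem fderiv_curvature (hg : IsMetricOn g U) (hy : y ∈ U) (u a b c : E) :
    fderiv ℝ (curvature g) y u a b c =
      fderiv ℝ (fderiv ℝ (christoffel g)) y u a b c
        - fderiv ℝ (fderiv ℝ (christoffel g)) y u b a c
        + (fderiv ℝ (christoffel g) y u a (christoffel g y b c)
          + christoffel g y a (fderiv ℝ (christoffel g) y u b c))
        - (fderiv ℝ (christoffel g) y u b (christoffel g y a c)
          + christoffel g y b (fderiv ℝ (christoffel g) y u a c)) := by
  have hΓ := hg.contDiffAt_christoffel hy
  have h1 := hΓ.differentiableAt_infty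
  have h2 := hΓ.fderiv_infty.differentiableAt_infty
  have hR := (hg.contDiffAt_curvature hy).differentiableAt_infty
  have e1 : ∀ v, DifferentiableAt ℝ (fun z => christoffel g z v) y := fun v =>
    h1.clm_apply (differentiableAt_const v)
  have e2 : ∀ v w, DifferentiableAt ℝ (fun z => christoffel g z v w) y := fun v w =>
    (e1 v).clm_apply (differentiableAt_const w)
  have e3 : ∀ v w, DifferentiableAt ℝ (fun z => fderiv ℝ (christoffel g) z v w c) y := fun v w =>
    ((h2.clm_apply (differentiableAt_const v)).clm_apply
      (differentiableAt_const w)).clm_apply (differentiableAt_const c)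
  have e4 : ∀ v w, DifferentiableAt ℝ (fun z => christoffel g z v (christoffel g z w c)) y :=
    fun v w => (e1 v).clm_apply (e2 w c)
  have e5 : ∀ v w, fderiv ℝ (fun z => christoffel g z v (christoffel g z w c)) y u =
      fderiv ℝ (christoffel g) y u v (christoffel g y w c)
        + christoffel g y v (fderiv ℝ (christoffel g) y u w c) := fun v w => by
    rw [fderiv_clm_apply_apply (T := fun z => christoffel g z v) (e1 v) (e2 w c),
      fderiv_apply_const h1, fderiv_apply₂_const h1]
  rw [← fderiv_apply₃_const hR]
  simp only [curvature_apply]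
  rw [fderiv_fun_sub (((e3 a b).fun_sub (e3 b a)).fun_add (e4 a b)) (e4 b a),
    fderiv_fun_add ((e3 a b).fun_sub (e3 b a)) (e4 a b), fderiv_fun_sub (e3 a b) (e3 b a)]
  simp only [add_apply, sub_apply, e5, fderiv_apply₃_const h2]

/-- The second Bianchi identity. -/
theorem covDerivCurvature_cyclic (hg : IsMetricOn g U) (hy : y ∈ U) (u a b c : E) :
    covDerivCurvature g y u a b c + covDerivCurvature g y a b u c
      + covDerivCurvature g y b u a c = 0 := by
  have hΓ := hg.contDiffAt_christoffel hy
  have hs := hΓ.second_symm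
  simp only [covDerivCurvature, hg.fderiv_curvature hy]
  -- Torsion-freeness and the symmetry of the second derivative of $\Gamma$ put matching terms in
  -- the same form; the rest is algebraic cancellation.
  rw [curvature_antisymm g y (christoffel g y a b) u, curvature_antisymm g y (christoffel g y b u) a,
    curvature_antisymm g y (christoffel g y u a) b, hg.christoffel_symm hy a u,
    hg.christoffel_symm hy b a, hg.christoffel_symm hy u b, hs a u, hs b a, hs b u]
  simp only [curvature_apply, map_add, map_sub]
  abel

theorem fderiv_inner_const_right (hg : IsMetricOn g U) (hy : y ∈ U) {V : E → E}
    (hV : DifferentiableAt ℝ V y) (u w : E) :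
    fderiv ℝ (fun z => g z (V z) w) y u =
      g y (fderiv ℝ V y u + christoffel g y u (V y)) w + g y (V y) (christoffel g y u w) := by
  rw [fderiv_clm_apply₂ (hg.contDiffAt y hy).differentiableAt_infty hV
    (differentiableAt_const w), hg.fderiv_metric hy]
  simp only [fderiv_fun_const, Pi.zero_apply, zero_apply, map_zero, map_add, add_apply]
  ring

/-- The endomorphism `R (u, v)` is skew-adjoint. -/
theorem inner_curvature_antisymm (hg : IsMetricOn g U) (hy : y ∈ U) (u v a b : E) :
    g y (curvature g y u v a) b = -g y (curvature g y u v b) a := by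
  have hΓ := (hg.contDiffAt_christoffel hy).differentiableAt_infty
  have hgd := (hg.contDiffAt y hy).fderiv_infty
  -- Metric compatibility along $t$, differentiated along $s$. The two terms quadratic in $\Gamma$
  -- with one factor in each slot of $g$ are exchanged by $s\leftrightarrow t$, so the symmetry of
  -- $D^2g$ leaves only curvature.
  have key : ∀ s t, fderiv ℝ (fderiv ℝ g) y s t a b =
      g y (fderiv ℝ (christoffel g) y s t a + christoffel g y s (christoffel g y t a)) b
        + g y (christoffel g y t a) (christoffel g y s b)
        + (g y (fderiv ℝ (christoffel g) y s t b + christoffel g y s (christoffel g y t b)) a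
        + g y (christoffel g y t b) (christoffel g y s a)) := by
    intro s t
    have hd : ∀ w, DifferentiableAt ℝ (fun z => christoffel g z t w) y := fun w =>
      (hΓ.clm_apply (differentiableAt_const t)).clm_apply (differentiableAt_const w)
    have hd' : ∀ w w', DifferentiableAt ℝ (fun z => g z (christoffel g z t w) w') y := fun w w' =>
      ((hg.contDiffAt y hy).differentiableAt_infty.clm_apply (hd w)).clm_apply
        (differentiableAt_const w')
    have h : (fun z => fderiv ℝ g z t a b) =ᶠ[nhds y] fun z =>
        g z (christoffel g z t a) b + g z (christoffel g z t b) a := by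
      filter_upwards [hg.mem_nhds hy] with z hz
      rw [hg.fderiv_metric hz, hg.symm z hz a]
    rw [← fderiv_apply₃_const hgd.differentiableAt_infty, h.fderiv_eq,
      fderiv_fun_add (hd' a b) (hd' b a), add_apply, hg.fderiv_inner_const_right hy (hd a),
      hg.fderiv_inner_const_right hy (hd b), fderiv_apply₂_const hΓ, fderiv_apply₂_const hΓ]
  have h1 := key u v
  rw [(hg.contDiffAt y hy).second_symm u v, key v u] at h1
  simp only [curvature_apply, map_add, map_sub, add_apply, sub_apply] at h1 ⊢
  rw [hg.symm y hy (christoffel g y v a), hg.symm y hy (christoffel g y v b)] at h1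
  linarith

/-- The first Bianchi identity. -/
theorem curvature_cyclic (hg : IsMetricOn g U) (hy : y ∈ U) (u v w : E) :
    curvature g y u v w + curvature g y v w u + curvature g y w u v = 0 := by
  have hΓ := (hg.contDiffAt_christoffel hy).differentiableAt_infty
  have hs : ∀ a b c, fderiv ℝ (christoffel g) y a b c = fderiv ℝ (christoffel g) y a c b := by
    intro a b c
    rw [← fderiv_apply₂_const hΓ, ← fderiv_apply₂_const hΓ]
    refine congrArg (fun f : E →L[ℝ] E => f a) (Filter.EventuallyEq.fderiv_eq ?_)
    filter_upwards [hg.mem_nhds hy] with z hz using hg.christoffel_symm hz b c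
  simp only [curvature_apply]
  rw [hs u w v, hs v u w, hs w v u, hg.christoffel_symm hy u w, hg.christoffel_symm hy v w,
    hg.christoffel_symm hy v u]
  abel

/-- The pair symmetry of the curvature tensor. -/
theorem inner_curvature_pair_symm (hg : IsMetricOn g U) (hy : y ∈ U) (a b c d : E) :
    g y (curvature g y a b c) d = g y (curvature g y c d a) b := by
  have A1 : ∀ a b c d, g y (curvature g y a b c) d = -g y (curvature g y b a c) d := fun a b c d =>
    by rw [curvature_antisymm, map_neg, neg_apply]
  have A2 := hg.inner_curvature_antisymm hy
  have B : ∀ a b c d, g y (curvature g y a b c) d + g y (curvature g y b c a) d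
      + g y (curvature g y c a b) d = 0 := fun a b c d => by
    rw [← add_apply, ← add_apply, ← map_add, ← map_add, hg.curvature_cyclic hy, map_zero, zero_apply]
  -- The octahedron argument: the four first Bianchi identities combine, through skewness in each
  -- pair of arguments, to the exchange of the pairs.
  linarith [B a b c d, B b c d a, B c d a b, B d a b c, A1 a b c d, A1 b c a d, A1 c a b d,
    A2 a b c d, A2 b c a d, A2 c a b d, A2 b c d a, A2 c d b a, A2 d b c a, A1 b c d a, A1 c d b a,
    A1 d b c a, A1 c d a b, A1 d a c b, A1 a c d b, A2 c d a b, A2 d a c b, A2 a c d b,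
    A1 d a b c, A1 a b d c, A1 b d a c, A2 d a b c, A2 a b d c, A2 b d a c]

theorem ricci_symm (hg : IsMetricOn g U) (hy : y ∈ U) (v w : E) :
    ricci g y v w = ricci g y w v := by
  obtain ⟨n, b, c, -, htr⟩ := exists_weighted_basis (hg.nondeg y hy) (hg.symm y hy)
  rw [ricci_eq_sum htr, ricci_eq_sum htr]
  refine Finset.sum_congr rfl fun i _ => ?_
  rw [hg.inner_curvature_pair_symm hy, curvature_antisymm, map_neg, neg_apply,
    ← hg.inner_curvature_antisymm hy]

theorem einstein_symm (hg : IsMetricOn g U) (hy : y ∈ U) (v w : E) :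
    einstein g y v w = einstein g y w v := by
  simp only [einstein, sub_apply, smul_apply, hg.ricci_symm hy v w, hg.symm y hy v w]

theorem divForm_eq_sum (hg : IsMetricOn g U) (hy : y ∈ U) {n : ℕ} {b : Fin n → E} {c : Fin n → ℝ}
    (htr : ∀ A : E →L[ℝ] E, traceL E A = ∑ i, c i * g y (A (b i)) (b i))
    (T : E → E →L[ℝ] E →L[ℝ] ℝ) (w : E) :
    divForm g T y w = ∑ i, c i * covDerivBilin g T y (b i) (b i) w := by
  rw [divForm_apply, htr]
  refine Finset.sum_congr rfl fun i _ => ?_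
  rw [ContinuousLinearMap.comp_apply, flat_sharp (hg.nondeg y hy)]
  rfl

/-- The derivative of the metric trace of a bilinear form. -/
theorem fderiv_trace_endo (hg : IsMetricOn g U) (hy : y ∈ U) {n : ℕ} {b : Fin n → E}
    {c : Fin n → ℝ} (htr : ∀ A : E →L[ℝ] E, traceL E A = ∑ i, c i * g y (A (b i)) (b i))
    {T : E → E →L[ℝ] E →L[ℝ] ℝ} (hT : DifferentiableAt ℝ T y) (v : E) :
    fderiv ℝ (fun z => traceL E (endo (g z) (T z))) y v =
      ∑ i, c i * covDerivBilin g T y v (b i) (b i) := by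
  have hf : DifferentiableAt ℝ (fun z => (T z).flip) y :=
    (ContinuousLinearMap.flipₗᵢ ℝ E E ℝ).toContinuousLinearEquiv.differentiableAt.comp y hT
  have he : DifferentiableAt ℝ (fun z => endo (g z) (T z)) y := by
    unfold endo
    exact (hg.contDiffAt_sharp hy).differentiableAt_infty.clm_comp hf
  have h1 : fderiv ℝ (fun z => traceL E (endo (g z) (T z))) y v =
      traceL E (fderiv ℝ (fun z => endo (g z) (T z)) y v) := by
    have := ((traceL E).hasFDerivAt.comp y he.hasFDerivAt).fderiv
    exact congrArg (fun f : E →L[ℝ] ℝ => f v) this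
  have h2 : ∀ x w, g y (fderiv ℝ (fun z => endo (g z) (T z)) y v x) w =
      covDerivBilin g T y v w x + g y ((endo (g y) (T y) ∘L christoffel g y v) x) w
        - g y ((christoffel g y v ∘L endo (g y) (T y)) x) w := by
    intro x w
    have h : (fun z => g z (endo (g z) (T z) x) w) =ᶠ[nhds y] fun z => T z w x := by
      filter_upwards [hg.mem_nhds hy] with z hz
      exact endo_left (hg.nondeg z hz) _ _ _
    have h3 := congrArg (fun f : E →L[ℝ] ℝ => f v) h.fderiv_eq
    rw [hg.fderiv_inner_const_right hy (he.clm_apply (differentiableAt_const x)),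
      fderiv_apply_const he, fderiv_apply₂_const hT, endo_left (hg.nondeg y hy), map_add,
      add_apply] at h3
    rw [covDerivBilin_apply, ← h3, ContinuousLinearMap.comp_apply,
      ContinuousLinearMap.comp_apply, endo_left (hg.nondeg y hy)]
    ring
  -- The coordinate and covariant derivatives of ${}^eT$ differ by its commutator with $\Gamma_v$,
  -- which has trace zero.
  have h4 := traceL_comp_comm (endo (g y) (T y)) (christoffel g y v)
  rw [htr, htr] at h4
  rw [h1, htr]
  simp only [h2, mul_add, mul_sub, Finset.sum_add_distrib, Finset.sum_sub_distrib]
  linarith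

/-- The trace commutes with $\nabla$: the connection terms acting on the traced slot and on the
value form a commutator with $\Gamma_u$, whose trace vanishes. -/
theorem covDerivBilin_ricci (hg : IsMetricOn g U) (hy : y ∈ U) {n : ℕ} {b : Fin n → E}
    {c : Fin n → ℝ} (htr : ∀ A : E →L[ℝ] E, traceL E A = ∑ i, c i * g y (A (b i)) (b i))
    (u v w : E) :
    covDerivBilin g (ricci g) y u v w =
      ∑ i, c i * g y (covDerivCurvature g y u (b i) v w) (b i) := by
  have hR := (hg.contDiffAt_curvature hy).differentiableAt_infty
  have hc : (fun z => ricci g z v w) = traceL E ∘ (fun z =>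
      (ContinuousLinearMap.apply ℝ E w ∘L (ContinuousLinearMap.apply ℝ (E →L[ℝ] E) v ∘L
        curvature g z))) := by
    funext z
    rfl
  have hd : DifferentiableAt ℝ (fun z => (ContinuousLinearMap.apply ℝ E w ∘L
      (ContinuousLinearMap.apply ℝ (E →L[ℝ] E) v ∘L curvature g z))) y :=
    (differentiableAt_const _).clm_comp ((differentiableAt_const _).clm_comp hR)
  have h1 : fderiv ℝ (ricci g) y u v w =
      ∑ i, c i * g y (fderiv ℝ (curvature g) y u (b i) v w) (b i) := by
    rw [← fderiv_apply₂_const (hg.contDiffAt_ricci hy).differentiableAt_infty, hc,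
      ((traceL E).hasFDerivAt.comp y hd.hasFDerivAt).fderiv, ContinuousLinearMap.comp_apply, htr]
    refine Finset.sum_congr rfl fun i _ => ?_
    rw [← fderiv_apply_const hd]
    simp only [ContinuousLinearMap.comp_apply, ContinuousLinearMap.apply_apply]
    rw [fderiv_apply₃_const hR]
  have h4 := traceL_comp_comm (((curvature g y).flip v).flip w) (christoffel g y u)
  rw [htr, htr] at h4
  simp only [ContinuousLinearMap.comp_apply, ContinuousLinearMap.flip_apply] at h4
  rw [covDerivBilin_apply, h1, ricci_eq_sum htr, ricci_eq_sum htr]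
  simp only [covDerivCurvature, map_add, map_sub, add_apply, sub_apply, mul_add, mul_sub,
    Finset.sum_add_distrib, Finset.sum_sub_distrib]
  linarith

theorem inner_covDerivCurvature_antisymm (hg : IsMetricOn g U) (hy : y ∈ U) (u a b c d : E) :
    g y (covDerivCurvature g y u a b c) d = -g y (covDerivCurvature g y u a b d) c := by
  have hR := (hg.contDiffAt_curvature hy).differentiableAt_infty
  have hd : ∀ c, DifferentiableAt ℝ (fun z => curvature g z a b c) y := fun c =>
    ((hR.clm_apply (differentiableAt_const a)).clm_apply (differentiableAt_const b)).clm_apply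
      (differentiableAt_const c)
  have h : (fun z => g z (curvature g z a b c) d) =ᶠ[nhds y]
      fun z => -g z (curvature g z a b d) c := by
    filter_upwards [hg.mem_nhds hy] with z hz
    exact hg.inner_curvature_antisymm hz a b c d
  have h3 := congrArg (fun f : E →L[ℝ] ℝ => f u) h.fderiv_eq
  rw [fderiv_fun_neg, neg_apply, hg.fderiv_inner_const_right hy (hd c),
    hg.fderiv_inner_const_right hy (hd d), fderiv_apply₃_const hR, fderiv_apply₃_const hR] at h3
  have A := hg.inner_curvature_antisymm hy
  simp only [covDerivCurvature, map_add, map_sub, add_apply, sub_apply] at h3 ⊢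
  linarith [A a b (christoffel g y u c) d, A a b c (christoffel g y u d),
    A (christoffel g y u a) b c d, A a (christoffel g y u b) c d]

theorem covDerivCurvature_antisymm (hg : IsMetricOn g U) (hy : y ∈ U) (u a b c : E) :
    covDerivCurvature g y u a b c = -covDerivCurvature g y u b a c := by
  have hR := (hg.contDiffAt_curvature hy).differentiableAt_infty
  have h : fderiv ℝ (curvature g) y u a b c = -fderiv ℝ (curvature g) y u b a c := by
    rw [← fderiv_apply₃_const hR, ← fderiv_apply₃_const hR]
    simp only [curvature_antisymm g _ a b, fderiv_fun_neg, neg_apply]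
  simp only [covDerivCurvature, h, curvature_antisymm g _ a b,
    curvature_antisymm g _ (christoffel g y u a) b, curvature_antisymm g _ a (christoffel g y u b),
    map_neg]
  abel

/-- The contracted Bianchi identity: `2 ∇·Ric = dS`. -/
theorem two_mul_divForm_ricci (hg : IsMetricOn g U) (hy : y ∈ U) (v : E) :
    2 * divForm g (ricci g) y v = fderiv ℝ (scalarCurvature g) y v := by
  obtain ⟨n, b, c, -, htr⟩ := exists_weighted_basis (hg.nondeg y hy) (hg.symm y hy)
  have hRic := (hg.contDiffAt_ricci hy).differentiableAt_infty
  have hS : fderiv ℝ (scalarCurvature g) y v = _ := hg.fderiv_trace_endo hy htr hRic v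
  have hdiv : divForm g (ricci g) y v =
      ∑ i, ∑ j, c i * (c j * g y (covDerivCurvature g y (b i) (b j) v (b i)) (b j)) := by
    rw [hg.divForm_eq_sum hy htr]
    refine Finset.sum_congr rfl fun i _ => ?_
    rw [hg.covDerivBilin_symm hy hRic (fun z hz => hg.ricci_symm hz),
      hg.covDerivBilin_ricci hy htr, Finset.mul_sum]
  -- The double contraction is unchanged when $i$ and $j$ are exchanged. One copy of each form
  -- matches the two last terms of the second Bianchi identity for $v,b_j,b_i$, paired with $b_i$
  -- and $b_j$; the first term gives $dS$.
  have hdiv' : divForm g (ricci g) y v =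
      ∑ i, ∑ j, c i * (c j * g y (covDerivCurvature g y (b j) (b i) v (b j)) (b i)) := by
    rw [hdiv, Finset.sum_comm]
    refine Finset.sum_congr rfl fun i _ => Finset.sum_congr rfl fun j _ => ?_
    ring
  rw [two_mul]
  nth_rewrite 1 [hdiv]
  rw [hdiv', hS, ← Finset.sum_add_distrib]
  refine Finset.sum_congr rfl fun i _ => ?_
  rw [← Finset.sum_add_distrib, hg.covDerivBilin_ricci hy htr, Finset.mul_sum]
  refine Finset.sum_congr rfl fun j _ => ?_
  have h := congrArg (fun x => g y x (b j)) (hg.covDerivCurvature_cyclic hy v (b j) (b i) (b i))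
  simp only [map_add, add_apply, map_zero, zero_apply] at h
  have h1 := hg.inner_covDerivCurvature_antisymm hy (b j) (b i) v (b i) (b j)
  have h2 := congrArg (fun x => g y x (b j)) (hg.covDerivCurvature_antisymm hy (b i) (b j) v (b i))
  simp only [map_neg, neg_apply] at h2
  rw [← mul_add, ← mul_add]
  congr 2
  linarith

theorem divForm_add (hg : IsMetricOn g U) (hy : y ∈ U) {T T' : E → E →L[ℝ] E →L[ℝ] ℝ}
    (hT : DifferentiableAt ℝ T y) (hT' : DifferentiableAt ℝ T' y) (w : E) :
    divForm g (fun z => T z + T' z) y w = divForm g T y w + divForm g T' y w := by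
  obtain ⟨n, b, c, -, htr⟩ := exists_weighted_basis (hg.nondeg y hy) (hg.symm y hy)
  simp only [hg.divForm_eq_sum hy htr, ← Finset.sum_add_distrib, covDerivBilin_apply,
    fderiv_fun_add hT hT', add_apply]
  exact Finset.sum_congr rfl fun i _ => by ring

theorem divForm_smul (hg : IsMetricOn g U) (hy : y ∈ U) {f : E → ℝ} {T : E → E →L[ℝ] E →L[ℝ] ℝ}
    (hf : DifferentiableAt ℝ f y) (hT : DifferentiableAt ℝ T y) (w : E) :
    divForm g (fun z => f z • T z) y w =
      f y * divForm g T y w + T y (sharp (g y) (fderiv ℝ f y)) w := by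
  obtain ⟨n, b, c, hb, htr⟩ := exists_weighted_basis (hg.nondeg y hy) (hg.symm y hy)
  rw [hb (sharp (g y) (fderiv ℝ f y))]
  simp only [hg.divForm_eq_sum hy htr, map_sum, Finset.mul_sum, sum_apply,
    ← Finset.sum_add_distrib, covDerivBilin_apply, fderiv_fun_smul hf hT, add_apply, smul_apply,
    map_smul, flat_sharp (hg.nondeg y hy), ContinuousLinearMap.smulRight_apply, smul_eq_mul]
  exact Finset.sum_congr rfl fun i _ => by ring

theorem divForm_metric (hg : IsMetricOn g U) (hy : y ∈ U) (w : E) : divForm g g y w = 0 := by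
  obtain ⟨n, b, c, -, htr⟩ := exists_weighted_basis (hg.nondeg y hy) (hg.symm y hy)
  rw [hg.divForm_eq_sum hy htr]
  refine Finset.sum_eq_zero fun i _ => ?_
  rw [covDerivBilin_apply, hg.fderiv_metric hy]
  ring

/-- The Einstein tensor is divergence free. -/
theorem divForm_einstein (hg : IsMetricOn g U) (hy : y ∈ U) (w : E) :
    divForm g (einstein g) y w = 0 := by
  have hRic := (hg.contDiffAt_ricci hy).differentiableAt_infty
  have hS := (hg.contDiffAt_scalarCurvature hy).differentiableAt_infty
  have hG := (hg.contDiffAt y hy).differentiableAt_infty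
  have h : einstein g = fun z => (2 : ℝ) • ricci g z + (-scalarCurvature g z) • g z := by
    funext z
    rw [einstein, neg_smul, sub_eq_add_neg]
  rw [h, hg.divForm_add hy (hRic.fun_const_smul _) (hS.fun_neg.fun_smul hG),
    hg.divForm_smul hy (differentiableAt_const _) hRic, hg.divForm_smul hy hS.fun_neg hG,
    hg.two_mul_divForm_ricci hy, hg.divForm_metric hy, flat_sharp (hg.nondeg y hy),
    fderiv_fun_neg, fderiv_fun_const]
  simp

end IsMetricOn

end Bianchi

/-! ### Killing fields: invariance of the curvature and second derivatives. -/

section Killing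

variable {E : Type*} [NormedAddCommGroup E] [NormedSpace ℝ E]

theorem covDerivVec_apply (g : E → E →L[ℝ] E →L[ℝ] ℝ) (V : E → E) (y u : E) :
    covDerivVec g V y u = fderiv ℝ V y u + christoffel g y u (V y) := rfl

/-- `Y` is a smooth Killing field of `g` on `U`. -/
structure IsKillingOn (g : E → E →L[ℝ] E →L[ℝ] ℝ) (Y : E → E) (U : Set E) : Prop where
  contDiffAt : ∀ y ∈ U, ContDiffAt ℝ ∞ Y y
  inner_add : ∀ y ∈ U, ∀ u v, g y (covDerivVec g Y y u) v + g y (covDerivVec g Y y v) u = 0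

namespace IsKillingOn

variable {g : E → E →L[ℝ] E →L[ℝ] ℝ} {Y : E → E} {U : Set E} {y : E}

theorem differentiableAt (hY : IsKillingOn g Y U) (hy : y ∈ U) : DifferentiableAt ℝ Y y :=
  (hY.contDiffAt y hy).differentiableAt_infty

variable [FiniteDimensional ℝ E]

/-- The Lie derivative of the metric along a Killing field vanishes. -/
theorem lie_metric (hY : IsKillingOn g Y U) (hg : IsMetricOn g U) (hy : y ∈ U) (v w : E) :
    fderiv ℝ g y (Y y) v w = -g y (fderiv ℝ Y y v) w - g y v (fderiv ℝ Y y w) := by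
  have h := hY.inner_add y hy v w
  simp only [covDerivVec_apply, map_add, add_apply] at h
  rw [hg.fderiv_metric hy, hg.symm y hy v, hg.symm y hy v, hg.christoffel_symm hy (Y y),
    hg.christoffel_symm hy (Y y)]
  linarith

/-- The Lie derivative of the connection along a Killing field vanishes. -/
theorem lie_christoffel (hY : IsKillingOn g Y U) (hg : IsMetricOn g U) (hy : y ∈ U) (u v : E) :
    fderiv ℝ (christoffel g) y (Y y) u v =
      fderiv ℝ Y y (christoffel g y u v) - christoffel g y (fderiv ℝ Y y u) v
        - christoffel g y u (fderiv ℝ Y y v) - fderiv ℝ (fderiv ℝ Y) y u v := by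
  have hYs := hY.contDiffAt y hy
  have hYd := hY.differentiableAt hy
  have hY2 := hYs.fderiv_infty.differentiableAt_infty
  have hgs := hg.contDiffAt y hy
  have hgd := hgs.differentiableAt_infty
  have hg2 := hgs.fderiv_infty.differentiableAt_infty
  have hΓ := (hg.contDiffAt_christoffel hy).differentiableAt_infty
  have hA : ∀ v, DifferentiableAt ℝ (fun z => fderiv ℝ Y z v) y := fun v =>
    hY2.clm_apply (differentiableAt_const v)
  -- The equation $\mathcal L_Yg=0$ holds on an open set, so it may be differentiated in any
  -- direction $s$.
  have key : ∀ s v w, fderiv ℝ (fderiv ℝ g) y s (Y y) v w + fderiv ℝ g y (fderiv ℝ Y y s) v w =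
      -(fderiv ℝ g y s (fderiv ℝ Y y v) w + g y (fderiv ℝ (fderiv ℝ Y) y s v) w)
      - (fderiv ℝ g y s v (fderiv ℝ Y y w) + g y v (fderiv ℝ (fderiv ℝ Y) y s w)) := by
    intro s v w
    have h : (fun z => fderiv ℝ g z (Y z) v w) =ᶠ[nhds y]
        fun z => -g z (fderiv ℝ Y z v) w - g z v (fderiv ℝ Y z w) := by
      filter_upwards [hg.mem_nhds hy] with z hz using hY.lie_metric hg hz v w
    have h3 := congrArg (fun f : E →L[ℝ] ℝ => f s) h.fderiv_eq
    have d1 : DifferentiableAt ℝ (fun z => g z (fderiv ℝ Y z v) w) y :=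
      (hgd.clm_apply (hA v)).clm_apply (differentiableAt_const w)
    have d2 : DifferentiableAt ℝ (fun z => g z v (fderiv ℝ Y z w)) y :=
      (hgd.clm_apply (differentiableAt_const v)).clm_apply (hA w)
    rw [fderiv_fun_sub d1.fun_neg d2, sub_apply, fderiv_fun_neg, neg_apply,
      fderiv_clm_apply₂ (T := fun z => fderiv ℝ g z (Y z)) (hg2.clm_apply hYd)
        (differentiableAt_const v) (differentiableAt_const w),
      fderiv_clm_apply₂ hgd (hA v) (differentiableAt_const w),
      fderiv_clm_apply₂ hgd (differentiableAt_const v) (hA w),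
      fderiv_clm_apply_apply hg2 hYd, fderiv_apply_const hY2, fderiv_apply_const hY2] at h3
    simpa using h3
  refine eq_of_flat_eq (hg.nondeg y hy) fun w => ?_
  -- The formula determining $\Gamma$ is differentiated along $Y$; three instances of `key` then
  -- eliminate the second derivatives of $g$.
  have h : (fun z => g z (christoffel g z u v) w) =ᶠ[nhds y] fun z =>
      1 / 2 * (fderiv ℝ g z u v w + fderiv ℝ g z v u w - fderiv ℝ g z w u v) := by
    filter_upwards [hg.mem_nhds hy] with z hz using hg.inner_christoffel hz u v w
  have h3 := congrArg (fun f : E →L[ℝ] ℝ => f (Y y)) h.fderiv_eq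
  have d : ∀ a b c, DifferentiableAt ℝ (fun z => fderiv ℝ g z a b c) y := fun a b c =>
    ((hg2.clm_apply (differentiableAt_const a)).clm_apply (differentiableAt_const b)).clm_apply
      (differentiableAt_const c)
  have dΓ : DifferentiableAt ℝ (fun z => christoffel g z u v) y :=
    (hΓ.clm_apply (differentiableAt_const u)).clm_apply (differentiableAt_const v)
  rw [fderiv_const_mul (((d u v w).fun_add (d v u w)).fun_sub (d w u v)),
    fderiv_fun_sub ((d u v w).fun_add (d v u w)) (d w u v), fderiv_fun_add (d u v w) (d v u w),
    fderiv_clm_apply₂ hgd dΓ (differentiableAt_const w), fderiv_apply₂_const hΓ,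
    hY.lie_metric hg hy] at h3
  simp only [fderiv_fun_const, Pi.zero_apply, zero_apply, map_zero, add_apply, sub_apply,
    smul_apply, fderiv_apply₃_const hg2, smul_eq_mul, add_zero] at h3
  have s2 := hgs.second_symm
  have k1 := key u v w
  have k2 := key v u w
  have k3 := key w u v
  rw [s2 u] at k1
  rw [s2 v] at k2
  rw [s2 w] at k3
  have c1 := hg.inner_christoffel hy (fderiv ℝ Y y u) v w
  have c2 := hg.inner_christoffel hy u (fderiv ℝ Y y v) w
  have c3 := hg.inner_christoffel hy u v (fderiv ℝ Y y w)
  have y1 := hYs.second_symm v u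
  have y2 := hYs.second_symm w u
  have y3 := hYs.second_symm w v
  have m1 := hg.symm y hy u (fderiv ℝ (fderiv ℝ Y) y v w)
  have m2 := hg.symm y hy v (fderiv ℝ (fderiv ℝ Y) y u w)
  have m3 := hg.symm y hy u (fderiv ℝ (fderiv ℝ Y) y w v)
  have m4 := hg.symm y hy v (fderiv ℝ (fderiv ℝ Y) y w u)
  have m5 := hg.fderiv_symm hy w u (fderiv ℝ Y y v)
  have m6 := hg.fderiv_symm hy v u (fderiv ℝ Y y w)
  simp only [map_sub, sub_apply]
  rw [y1] at k2
  rw [y2, y3] at k3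
  rw [y2] at m4
  rw [y3] at m3
  linarith

/-- Curvature involves $\Gamma$ and its first derivative only, so one further differentiation of
`lie_christoffel` suffices. The terms in $D^3Y$ drop out by symmetry in the two skew arguments. -/
theorem lie_curvature (hY : IsKillingOn g Y U) (hg : IsMetricOn g U) (hy : y ∈ U) (u v w : E) :
    fderiv ℝ (curvature g) y (Y y) u v w =
      fderiv ℝ Y y (curvature g y u v w) - curvature g y (fderiv ℝ Y y u) v w
        - curvature g y u (fderiv ℝ Y y v) w - curvature g y u v (fderiv ℝ Y y w) := by
  have hYs := hY.contDiffAt y hy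
  have hYd := hY.differentiableAt hy
  have hY2 := hYs.fderiv_infty.differentiableAt_infty
  have hY3 := hYs.fderiv_infty.fderiv_infty.differentiableAt_infty
  have hΓs := hg.contDiffAt_christoffel hy
  have hΓ := hΓs.differentiableAt_infty
  have hΓ2 := hΓs.fderiv_infty.differentiableAt_infty
  have hA : ∀ v, DifferentiableAt ℝ (fun z => fderiv ℝ Y z v) y := fun v =>
    hY2.clm_apply (differentiableAt_const v)
  have key : ∀ s v w, fderiv ℝ (fderiv ℝ (christoffel g)) y (Y y) s v w =
      fderiv ℝ (fderiv ℝ Y) y s (christoffel g y v w)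
      + fderiv ℝ Y y (fderiv ℝ (christoffel g) y s v w)
      - (fderiv ℝ (christoffel g) y s (fderiv ℝ Y y v) w
        + christoffel g y (fderiv ℝ (fderiv ℝ Y) y s v) w)
      - (fderiv ℝ (christoffel g) y s v (fderiv ℝ Y y w)
        + christoffel g y v (fderiv ℝ (fderiv ℝ Y) y s w))
      - fderiv ℝ (fderiv ℝ (fderiv ℝ Y)) y s v w
      - fderiv ℝ (christoffel g) y (fderiv ℝ Y y s) v w := by
    intro s v w
    have h : (fun z => fderiv ℝ (christoffel g) z (Y z) v w) =ᶠ[nhds y] fun z =>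
        fderiv ℝ Y z (christoffel g z v w) - christoffel g z (fderiv ℝ Y z v) w
        - christoffel g z v (fderiv ℝ Y z w) - fderiv ℝ (fderiv ℝ Y) z v w := by
      filter_upwards [hg.mem_nhds hy] with z hz using hY.lie_christoffel hg hz v w
    have h3 := congrArg (fun f : E →L[ℝ] E => f s) h.fderiv_eq
    have d0 : DifferentiableAt ℝ (fun z => christoffel g z v w) y :=
      (hΓ.clm_apply (differentiableAt_const v)).clm_apply (differentiableAt_const w)
    have d1 : DifferentiableAt ℝ (fun z => fderiv ℝ Y z (christoffel g z v w)) y :=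
      hY2.clm_apply d0
    have d2 : DifferentiableAt ℝ (fun z => christoffel g z (fderiv ℝ Y z v) w) y :=
      (hΓ.clm_apply (hA v)).clm_apply (differentiableAt_const w)
    have d3 : DifferentiableAt ℝ (fun z => christoffel g z v (fderiv ℝ Y z w)) y :=
      (hΓ.clm_apply (differentiableAt_const v)).clm_apply (hA w)
    have d4 : DifferentiableAt ℝ (fun z => fderiv ℝ (fderiv ℝ Y) z v w) y :=
      (hY3.clm_apply (differentiableAt_const v)).clm_apply (differentiableAt_const w)
    rw [fderiv_fun_sub ((d1.fun_sub d2).fun_sub d3) d4, fderiv_fun_sub (d1.fun_sub d2) d3,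
      fderiv_fun_sub d1 d2, sub_apply, sub_apply, sub_apply,
      fderiv_clm_apply₂ (T := fun z => fderiv ℝ (christoffel g) z (Y z)) (hΓ2.clm_apply hYd)
        (differentiableAt_const v) (differentiableAt_const w),
      fderiv_clm_apply_apply hY2 d0,
      fderiv_clm_apply₂ hΓ (hA v) (differentiableAt_const w),
      fderiv_clm_apply₂ hΓ (differentiableAt_const v) (hA w),
      fderiv_clm_apply_apply hΓ2 hYd, fderiv_apply₂_const hΓ, fderiv_apply₂_const hY3,
      fderiv_apply_const hY2, fderiv_apply_const hY2, hΓs.second_symm] at h3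
    simp only [fderiv_fun_const, Pi.zero_apply, zero_apply, map_zero, add_apply, add_zero] at h3
    rw [← eq_sub_iff_add_eq] at h3
    exact h3
  rw [hg.fderiv_curvature hy, key, key, hYs.fderiv_infty.second_symm u v]
  simp only [curvature_apply, hY.lie_christoffel hg hy, map_add, map_sub]
  rw [hYs.second_symm v u]
  abel

/-- On taking the trace of the invariance of $R$, the terms where $DY$ acts on the value and on the
traced argument cancel, being the trace of a commutator. -/
theorem lie_ricci (hY : IsKillingOn g Y U) (hg : IsMetricOn g U) (hy : y ∈ U) (v w : E) :
    fderiv ℝ (ricci g) y (Y y) v w =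
      -ricci g y (fderiv ℝ Y y v) w - ricci g y v (fderiv ℝ Y y w) := by
  obtain ⟨n, b, c, -, htr⟩ := exists_weighted_basis (hg.nondeg y hy) (hg.symm y hy)
  have h1 := hg.covDerivBilin_ricci hy htr (Y y) v w
  rw [covDerivBilin_apply] at h1
  have h4 := traceL_comp_comm (((curvature g y).flip v).flip w)
    (christoffel g y (Y y) + fderiv ℝ Y y)
  rw [htr, htr] at h4
  simp only [ContinuousLinearMap.comp_apply, ContinuousLinearMap.flip_apply] at h4
  simp only [covDerivCurvature, hY.lie_curvature hg hy, ricci_eq_sum htr, map_add, map_sub,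
    add_apply, sub_apply, mul_add, mul_sub, Finset.sum_add_distrib,
    Finset.sum_sub_distrib] at h1 h4 ⊢
  linarith

/-- The contraction of a symmetric tensor with the derivative of a Killing field vanishes. -/
theorem sum_symm_covDerivVec (hY : IsKillingOn g Y U) (hg : IsMetricOn g U) (hy : y ∈ U) {n : ℕ}
    {b : Fin n → E} {c : Fin n → ℝ}
    (htr : ∀ A : E →L[ℝ] E, traceL E A = ∑ i, c i * g y (A (b i)) (b i))
    {T : E →L[ℝ] E →L[ℝ] ℝ} (hT : ∀ u v, T u v = T v u) :
    ∑ i, c i * T (b i) (covDerivVec g Y y (b i)) = 0 := by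
  -- The sum is both $\mathrm{tr}({}^eT\circ\nabla Y)$ and, by skewness of $\nabla Y$,
  -- $-\mathrm{tr}(\nabla Y\circ{}^eT)$; hence it equals its own negative.
  have e1 : ∀ i, T (b i) (covDerivVec g Y y (b i)) =
      g y ((endo (g y) T ∘L covDerivVec g Y y) (b i)) (b i) := fun i => by
    rw [ContinuousLinearMap.comp_apply, endo_left (hg.nondeg y hy)]
  have e2 : ∀ i, T (b i) (covDerivVec g Y y (b i)) =
      -g y ((covDerivVec g Y y ∘L endo (g y) T) (b i)) (b i) := fun i => by
    have := hY.inner_add y hy (b i) (endo (g y) T (b i))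
    rw [ContinuousLinearMap.comp_apply, hT, ← endo_left (hg.nondeg y hy), hg.symm y hy]
    linarith
  have h5 := traceL_comp_comm (endo (g y) T) (covDerivVec g Y y)
  rw [htr, htr] at h5
  have h6 := Finset.sum_congr rfl fun i (_ : i ∈ Finset.univ) => congrArg (c i * ·) (e1 i)
  have h7 := Finset.sum_congr rfl fun i (_ : i ∈ Finset.univ) => congrArg (c i * ·) (e2 i)
  simp only [mul_neg, Finset.sum_neg_distrib] at h6 h7
  linarith

/-- By invariance of the Ricci tensor, the derivative of its trace reduces to a contraction of
$\mathrm{Ric}$ with $\nabla Y$, symmetric against skew. -/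
theorem lie_scalarCurvature (hY : IsKillingOn g Y U) (hg : IsMetricOn g U) (hy : y ∈ U) :
    fderiv ℝ (scalarCurvature g) y (Y y) = 0 := by
  obtain ⟨n, b, c, -, htr⟩ := exists_weighted_basis (hg.nondeg y hy) (hg.symm y hy)
  have hRic := (hg.contDiffAt_ricci hy).differentiableAt_infty
  have hS : fderiv ℝ (scalarCurvature g) y (Y y) = _ := hg.fderiv_trace_endo hy htr hRic (Y y)
  have h4 := hY.sum_symm_covDerivVec hg hy htr (hg.ricci_symm hy)
  rw [hS]
  have h8 : ∀ i, c i * covDerivBilin g (ricci g) y (Y y) (b i) (b i) =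
      -2 * (c i * ricci g y (b i) (covDerivVec g Y y (b i))) := fun i => by
    rw [covDerivBilin_apply, hY.lie_ricci hg hy, covDerivVec_apply, map_add,
      hg.ricci_symm hy (fderiv ℝ Y y (b i)), hg.ricci_symm hy (christoffel g y (Y y) (b i)),
      hg.christoffel_symm hy (Y y)]
    ring
  simp only [h8, ← Finset.mul_sum, h4, mul_zero]

/-- This invariance serves twice: to show that $X_0$ commutes with $Y$, and to show that $Y$
annihilates $G(X_0,X_0)$, $G(X_0,Y)$ and $G(Y,Y)$. -/
theorem lie_einstein (hY : IsKillingOn g Y U) (hg : IsMetricOn g U) (hy : y ∈ U) (v w : E) :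
    fderiv ℝ (einstein g) y (Y y) v w =
      -einstein g y (fderiv ℝ Y y v) w - einstein g y v (fderiv ℝ Y y w) := by
  have hRic := (hg.contDiffAt_ricci hy).differentiableAt_infty
  have hS := (hg.contDiffAt_scalarCurvature hy).differentiableAt_infty
  have hG := (hg.contDiffAt y hy).differentiableAt_infty
  have h : einstein g = fun z => (2 : ℝ) • ricci g z - scalarCurvature g z • g z := rfl
  rw [h, fderiv_fun_sub (hRic.fun_const_smul _) (hS.fun_smul hG), fderiv_fun_const_smul hRic,
    fderiv_fun_smul hS hG]
  simp only [add_apply, sub_apply, smul_apply, ContinuousLinearMap.smulRight_apply,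
    hY.lie_scalarCurvature hg hy, hY.lie_ricci hg hy, hY.lie_metric hg hy, smul_eq_mul, zero_mul]
  ring

theorem differentiableAt_covDerivVec (hY : IsKillingOn g Y U) (hg : IsMetricOn g U)
    (hy : y ∈ U) : DifferentiableAt ℝ (covDerivVec g Y) y := by
  have h1 : DifferentiableAt ℝ (fun z => (christoffel g z).flip) y :=
    (ContinuousLinearMap.flipₗᵢ ℝ E E E).toContinuousLinearEquiv.differentiableAt.comp y
      (hg.contDiffAt_christoffel hy).differentiableAt_infty
  exact (hY.contDiffAt y hy).fderiv_infty.differentiableAt_infty.add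
    (h1.clm_apply (hY.differentiableAt hy))

/-- The second covariant derivative of a Killing field is given by the curvature. -/
theorem second_covDeriv (hY : IsKillingOn g Y U) (hg : IsMetricOn g U) (hy : y ∈ U) (u v : E) :
    fderiv ℝ (covDerivVec g Y) y u v + christoffel g y u (covDerivVec g Y y v)
      - covDerivVec g Y y (christoffel g y u v) = curvature g y u (Y y) v := by
  have hYd := hY.differentiableAt hy
  have hY2 := (hY.contDiffAt y hy).fderiv_infty.differentiableAt_infty
  have hΓ := (hg.contDiffAt_christoffel hy).differentiableAt_infty
  have hΓs : ∀ a b c, fderiv ℝ (christoffel g) y a b c = fderiv ℝ (christoffel g) y a c b := by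
    intro a b c
    rw [← fderiv_apply₂_const hΓ, ← fderiv_apply₂_const hΓ]
    refine congrArg (fun f : E →L[ℝ] E => f a) (Filter.EventuallyEq.fderiv_eq ?_)
    filter_upwards [hg.mem_nhds hy] with z hz using hg.christoffel_symm hz b c
  have d1 : DifferentiableAt ℝ (fun z => fderiv ℝ Y z v) y :=
    hY2.clm_apply (differentiableAt_const v)
  have d2 : DifferentiableAt ℝ (fun z => christoffel g z v) y :=
    hΓ.clm_apply (differentiableAt_const v)
  have h1 : fderiv ℝ (covDerivVec g Y) y u v = fderiv ℝ (fderiv ℝ Y) y u v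
      + (fderiv ℝ (christoffel g) y u v (Y y) + christoffel g y v (fderiv ℝ Y y u)) := by
    rw [← fderiv_apply_const (hY.differentiableAt_covDerivVec hg hy)]
    simp only [covDerivVec_apply]
    rw [fderiv_fun_add d1 (d2.clm_apply hYd), add_apply, fderiv_apply_const hY2,
      fderiv_clm_apply_apply d2 hYd, fderiv_apply_const hΓ]
  -- In tensorial form, $\mathcal L_Y\nabla=0$ says that $\nabla^2_{u,v}Y=R(u,Y)v$. The formula for
  -- the derivative of $\Gamma$ along $Y$ is the coordinate version of this.
  have h2 := hY.lie_christoffel hg hy u v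
  rw [h1, curvature_apply, h2, covDerivVec_apply, covDerivVec_apply, hΓs u v,
    hg.christoffel_symm hy v (Y y), hg.christoffel_symm hy (christoffel g y u v) (Y y),
    hg.christoffel_symm hy v]
  simp only [map_add]
  abel

/-- The divergence of `F = d (Y♭)` for a Killing field `Y`. -/
theorem divForm_two_covDeriv (hY : IsKillingOn g Y U) (hg : IsMetricOn g U) (hy : y ∈ U)
    {F : E → E →L[ℝ] E →L[ℝ] ℝ} (hF : DifferentiableAt ℝ F y)
    (h : ∀ z ∈ U, ∀ u v, F z u v = 2 * g z (covDerivVec g Y z u) v) (w : E) :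
    divForm g F y w = -2 * ricci g y (Y y) w := by
  obtain ⟨n, b, c, -, htr⟩ := exists_weighted_basis (hg.nondeg y hy) (hg.symm y hy)
  have hK := hY.differentiableAt_covDerivVec hg hy
  have hKv : ∀ v, DifferentiableAt ℝ (fun z => covDerivVec g Y z v) y := fun v =>
    hK.clm_apply (differentiableAt_const v)
  have key : ∀ u v w, covDerivBilin g F y u v w = 2 * g y (curvature g y u (Y y) v) w := by
    intro u v w
    have h1 : (fun z => F z v w) =ᶠ[nhds y] fun z => 2 * g z (covDerivVec g Y z v) w := by
      filter_upwards [hg.mem_nhds hy] with z hz using h z hz v w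
    have h3 : fderiv ℝ F y u v w = 2 * (g y (fderiv ℝ (covDerivVec g Y) y u v
        + christoffel g y u (covDerivVec g Y y v)) w
        + g y (covDerivVec g Y y v) (christoffel g y u w)) := by
      rw [← fderiv_apply₂_const hF, h1.fderiv_eq, fderiv_const_mul
        (((hg.contDiffAt y hy).differentiableAt_infty.clm_apply (hKv v)).clm_apply
          (differentiableAt_const w)), smul_apply, hg.fderiv_inner_const_right hy (hKv v),
        fderiv_apply_const hK, smul_eq_mul]
    rw [covDerivBilin_apply, h3, h y hy, h y hy, ← hY.second_covDeriv hg hy]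
    simp only [map_sub, sub_apply]
    ring
  rw [hg.divForm_eq_sum hy htr, ricci_eq_sum htr, Finset.mul_sum]
  refine Finset.sum_congr rfl fun i _ => ?_
  rw [key, hg.inner_curvature_antisymm hy]
  ring

/-- For every $w$, $g(\nabla_YY,w)=-g(\nabla_wY,Y)$, which is $-\tfrac12$ of the derivative of the
constant $g(Y,Y)$: orbits of a Killing field of constant length are geodesics. -/
theorem covDerivVec_self (hY : IsKillingOn g Y U) (hg : IsMetricOn g U) {a : ℝ}
    (h : ∀ z ∈ U, g z (Y z) (Y z) = a) (hy : y ∈ U) : covDerivVec g Y y (Y y) = 0 := by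
  refine hg.nondeg y hy _ fun w => ?_
  have h1 : (fun z => g z (Y z) (Y z)) =ᶠ[nhds y] fun _ => a := by
    filter_upwards [hg.mem_nhds hy] with z hz using h z hz
  have h3 := congrArg (fun f : E →L[ℝ] ℝ => f w) h1.fderiv_eq
  have hYd := hY.differentiableAt hy
  rw [fderiv_clm_apply₂ (hg.contDiffAt y hy).differentiableAt_infty hYd hYd,
    hg.fderiv_metric hy, hg.symm y hy (Y y), hg.symm y hy (Y y)] at h3
  have h4 := hY.inner_add y hy w (Y y)
  simp only [fderiv_fun_const, Pi.zero_apply, zero_apply, covDerivVec_apply, map_add,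
    add_apply] at h3 h4 ⊢
  linarith

/-- `Ric (Y, Y) = - tr (∇Y ∘ ∇Y)` for a Killing field of constant length. -/
theorem ricci_self (hY : IsKillingOn g Y U) (hg : IsMetricOn g U) {a : ℝ}
    (h : ∀ z ∈ U, g z (Y z) (Y z) = a) (hy : y ∈ U) :
    ricci g y (Y y) (Y y) = -traceL E (covDerivVec g Y y ∘L covDerivVec g Y y) := by
  rw [ricci_apply, ← map_neg]
  congr 1
  ext1 u
  simp only [ContinuousLinearMap.flip_apply, neg_apply, ContinuousLinearMap.comp_apply]
  rw [← hY.second_covDeriv hg hy, hY.covDerivVec_self hg h hy, map_zero, add_zero]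
  -- Differentiating $\nabla_YY=0$ along $u$ gives $(\nabla_u\nabla Y)(Y)=-\nabla Y(\nabla_uY)$, so
  -- $R(u,Y)Y$ is $-(\nabla Y)^2u$.
  have h1 : (fun z => covDerivVec g Y z (Y z)) =ᶠ[nhds y] fun _ => 0 := by
    filter_upwards [hg.mem_nhds hy] with z hz using hY.covDerivVec_self hg h hz
  have h3 := congrArg (fun f : E →L[ℝ] E => f u) h1.fderiv_eq
  rw [fderiv_clm_apply_apply (hY.differentiableAt_covDerivVec hg hy) (hY.differentiableAt hy)] at h3
  simp only [fderiv_fun_const, Pi.zero_apply, zero_apply] at h3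
  rw [covDerivVec_apply g Y y u, map_add, eq_neg_of_add_eq_zero_left h3]
  abel

theorem trace_covDerivVec (hY : IsKillingOn g Y U) (hg : IsMetricOn g U) (hy : y ∈ U) :
    traceL E (covDerivVec g Y y) = 0 := by
  obtain ⟨n, b, c, -, htr⟩ := exists_weighted_basis (hg.nondeg y hy) (hg.symm y hy)
  rw [htr]
  refine Finset.sum_eq_zero fun i _ => ?_
  have := hY.inner_add y hy (b i) (b i)
  rw [show g y (covDerivVec g Y y (b i)) (b i) = 0 by linarith, mul_zero]

end IsKillingOn

end Killing

/-! ### Behaviour of connection and curvature under local diffeomorphisms. -/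

section Naturality

variable {E : Type*} [NormedAddCommGroup E] [NormedSpace ℝ E]

/-- `φ` is a smooth local diffeomorphism from the open set `V` to `U` and `g'` is the pullback of
the metric `g`. -/
structure IsPullbackOn (φ : E → E) (V U : Set E) (g g' : E → E →L[ℝ] E →L[ℝ] ℝ) : Prop where
  isOpen : IsOpen V
  mapsTo : ∀ y ∈ V, φ y ∈ U
  contDiffAt : ∀ y ∈ V, ContDiffAt ℝ ∞ φ y
  injective : ∀ y ∈ V, Function.Injective (fderiv ℝ φ y)
  eq : ∀ y ∈ V, ∀ u v, g' y u v = g (φ y) (fderiv ℝ φ y u) (fderiv ℝ φ y v)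

/-- An injective endomorphism is invertible in finite dimension, so `M` and `N` are conjugate. -/
theorem traceL_eq_of_intertwine [FiniteDimensional ℝ E] {A M N : E →L[ℝ] E}
    (hA : Function.Injective A) (h : ∀ u, A (M u) = N (A u)) : traceL E M = traceL E N := by
  let e : E ≃ₗ[ℝ] E := LinearEquiv.ofInjectiveEndo A.toLinearMap hA
  rw [traceL_apply, traceL_apply, ← LinearMap.trace_conj' M.toLinearMap e]
  congr 1
  ext u
  obtain ⟨v, rfl⟩ := e.surjective u
  rw [LinearEquiv.conj_apply_apply, e.symm_apply_apply]
  exact h v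

theorem fderiv_comp_apply {F : Type*} [NormedAddCommGroup F] [NormedSpace ℝ F] {f : E → F}
    {φ : E → E} {y : E} (hf : DifferentiableAt ℝ f (φ y)) (hφ : DifferentiableAt ℝ φ y) (u : E) :
    fderiv ℝ (fun z => f (φ z)) y u = fderiv ℝ f (φ y) (fderiv ℝ φ y u) := by
  have h := fderiv_comp y hf hφ
  exact congrArg (fun f : E →L[ℝ] F => f u) h

/-- Naturality of the exterior derivative of 1-forms. -/
theorem fderiv_pullback_form {φ : E → E} {α α' : E → E →L[ℝ] ℝ} {y : E}
    (hφ : ContDiffAt ℝ ∞ φ y) (hα : DifferentiableAt ℝ α (φ y))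
    (h : ∀ᶠ z in nhds y, ∀ v, α' z v = α (φ z) (fderiv ℝ φ z v)) (u v : E) :
    fderiv ℝ α' y u v - fderiv ℝ α' y v u =
      fderiv ℝ α (φ y) (fderiv ℝ φ y u) (fderiv ℝ φ y v)
        - fderiv ℝ α (φ y) (fderiv ℝ φ y v) (fderiv ℝ φ y u) := by
  have hφd := hφ.differentiableAt_infty
  have hφ2 := hφ.fderiv_infty.differentiableAt_infty
  have hc : DifferentiableAt ℝ (fun z => α (φ z)) y := hα.comp y hφd
  have h1 : α' =ᶠ[nhds y] fun z => α (φ z) ∘L fderiv ℝ φ z := by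
    filter_upwards [h] with z hz
    ext v
    exact hz v
  have hα' : DifferentiableAt ℝ α' y := (hc.clm_comp hφ2).congr_of_eventuallyEq h1
  have key : ∀ u v, fderiv ℝ α' y u v = fderiv ℝ α (φ y) (fderiv ℝ φ y u) (fderiv ℝ φ y v)
      + α (φ y) (fderiv ℝ (fderiv ℝ φ) y u v) := by
    intro u v
    have h2 : (fun z => α' z v) =ᶠ[nhds y] fun z => α (φ z) (fderiv ℝ φ z v) := by
      filter_upwards [h] with z hz using hz v
    rw [← fderiv_apply_const hα', h2.fderiv_eq, fderiv_clm_apply_apply hc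
      (hφ2.clm_apply (differentiableAt_const v)), fderiv_comp_apply hα hφd,
      fderiv_apply_const hφ2]
  rw [key, key, hφ.second_symm u v]
  ring

namespace IsPullbackOn

variable [FiniteDimensional ℝ E] {φ : E → E} {V U : Set E} {g g' : E → E →L[ℝ] E →L[ℝ] ℝ} {y : E}

theorem surjective (h : IsPullbackOn φ V U g g') (hy : y ∈ V) :
    Function.Surjective (fderiv ℝ φ y) :=
  LinearMap.injective_iff_surjective.1 (h.injective y hy)

theorem isMetricOn (h : IsPullbackOn φ V U g g') (hg : IsMetricOn g U) : IsMetricOn g' V where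
  isOpen := h.isOpen
  contDiffAt y hy := by
    have h1 : g' =ᶠ[nhds y] fun z => ((g (φ z)).bilinearComp (fderiv ℝ φ z) (fderiv ℝ φ z)) := by
      filter_upwards [h.isOpen.mem_nhds hy] with z hz
      ext u v
      exact h.eq z hz u v
    refine ContDiffAt.congr_of_eventuallyEq ?_ h1
    have hφ := h.contDiffAt y hy
    have hf : ∀ {T : E → E →L[ℝ] E →L[ℝ] ℝ}, ContDiffAt ℝ ∞ T y →
        ContDiffAt ℝ ∞ (fun z => (T z).flip) y := fun hT =>
      (ContinuousLinearMap.flipₗᵢ ℝ E E ℝ).contDiff.contDiffAt.comp y hT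
    unfold ContinuousLinearMap.bilinearComp
    exact hf ((hf (((hg.contDiffAt _ (h.mapsTo y hy)).comp y hφ).clm_comp
      hφ.fderiv_infty)).clm_comp hφ.fderiv_infty)
  symm y hy u v := by rw [h.eq y hy, h.eq y hy, hg.symm _ (h.mapsTo y hy)]
  nondeg y hy u hu := by
    refine h.injective y hy ?_
    rw [map_zero]
    refine hg.nondeg _ (h.mapsTo y hy) _ fun v => ?_
    obtain ⟨v, rfl⟩ := h.surjective hy v
    rw [← h.eq y hy, hu]

/-- The inhomogeneous term is produced by the derivatives falling on $d\varphi$ in the pulled-back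
metric. -/
theorem christoffel (h : IsPullbackOn φ V U g g') (hg : IsMetricOn g U) (hy : y ∈ V) (u v : E) :
    fderiv ℝ φ y (christoffel g' y u v) =
      KaluzaKlein.christoffel g (φ y) (fderiv ℝ φ y u) (fderiv ℝ φ y v)
        + fderiv ℝ (fderiv ℝ φ) y u v := by
  have hg' := h.isMetricOn hg
  have hφ := h.contDiffAt y hy
  have hφd := hφ.differentiableAt_infty
  have hφ2 := hφ.fderiv_infty.differentiableAt_infty
  have hgd := (hg.contDiffAt _ (h.mapsTo y hy)).differentiableAt_infty
  have hc : DifferentiableAt ℝ (fun z => g (φ z)) y := hgd.comp y hφd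
  have d : ∀ v, DifferentiableAt ℝ (fun z => fderiv ℝ φ z v) y := fun v =>
    hφ2.clm_apply (differentiableAt_const v)
  have key : ∀ u v w, fderiv ℝ g' y u v w =
      fderiv ℝ g (φ y) (fderiv ℝ φ y u) (fderiv ℝ φ y v) (fderiv ℝ φ y w)
        + g (φ y) (fderiv ℝ (fderiv ℝ φ) y u v) (fderiv ℝ φ y w)
        + g (φ y) (fderiv ℝ φ y v) (fderiv ℝ (fderiv ℝ φ) y u w) := by
    intro u v w
    have h1 : (fun z => g' z v w) =ᶠ[nhds y]
        fun z => g (φ z) (fderiv ℝ φ z v) (fderiv ℝ φ z w) := by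
      filter_upwards [h.isOpen.mem_nhds hy] with z hz using h.eq z hz v w
    rw [← fderiv_apply₂_const (hg'.contDiffAt y hy).differentiableAt_infty, h1.fderiv_eq,
      fderiv_clm_apply₂ hc (d v) (d w), fderiv_comp_apply hgd hφd, fderiv_apply_const hφ2,
      fderiv_apply_const hφ2]
  refine eq_of_flat_eq (hg.nondeg _ (h.mapsTo y hy)) fun w => ?_
  obtain ⟨w, rfl⟩ := h.surjective hy w
  rw [← h.eq y hy, hg'.inner_christoffel hy, key, key, key, map_add, add_apply,
    hg.inner_christoffel (h.mapsTo y hy), hφ.second_symm v u, hφ.second_symm w u,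
    hφ.second_symm w v, hg.symm _ (h.mapsTo y hy) (fderiv ℝ φ y u),
    hg.symm _ (h.mapsTo y hy) (fderiv ℝ φ y v)]
  ring

/-- The inhomogeneous terms of the connection disappear after skew-symmetrization: $D^3\varphi$ and
$D^2\varphi$ are symmetric in the two skew arguments, and the remaining products with $D^2\varphi$
cancel. -/
theorem curvature (h : IsPullbackOn φ V U g g') (hg : IsMetricOn g U) (hy : y ∈ V) (u v w : E) :
    fderiv ℝ φ y (curvature g' y u v w) =
      KaluzaKlein.curvature g (φ y) (fderiv ℝ φ y u) (fderiv ℝ φ y v) (fderiv ℝ φ y w) := by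
  have hg' := h.isMetricOn hg
  have hφ := h.contDiffAt y hy
  have hφd := hφ.differentiableAt_infty
  have hφ2 := hφ.fderiv_infty.differentiableAt_infty
  have hφ3 := hφ.fderiv_infty.fderiv_infty.differentiableAt_infty
  have hΓ := (hg.contDiffAt_christoffel (h.mapsTo y hy)).differentiableAt_infty
  have hΓ' := (hg'.contDiffAt_christoffel hy).differentiableAt_infty
  have hc : DifferentiableAt ℝ (fun z => KaluzaKlein.christoffel g (φ z)) y := hΓ.comp y hφd
  have d : ∀ v, DifferentiableAt ℝ (fun z => fderiv ℝ φ z v) y := fun v =>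
    hφ2.clm_apply (differentiableAt_const v)
  have key : ∀ t u v, fderiv ℝ φ y (fderiv ℝ (KaluzaKlein.christoffel g') y t u v) =
      fderiv ℝ (KaluzaKlein.christoffel g) (φ y) (fderiv ℝ φ y t) (fderiv ℝ φ y u)
          (fderiv ℝ φ y v)
        + KaluzaKlein.christoffel g (φ y) (fderiv ℝ (fderiv ℝ φ) y t u) (fderiv ℝ φ y v)
        + KaluzaKlein.christoffel g (φ y) (fderiv ℝ φ y u) (fderiv ℝ (fderiv ℝ φ) y t v)
        + fderiv ℝ (fderiv ℝ (fderiv ℝ φ)) y t u v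
        - fderiv ℝ (fderiv ℝ φ) y t (KaluzaKlein.christoffel g' y u v) := by
    intro t u v
    have h1 : (fun z => fderiv ℝ φ z (KaluzaKlein.christoffel g' z u v)) =ᶠ[nhds y]
        fun z => KaluzaKlein.christoffel g (φ z) (fderiv ℝ φ z u) (fderiv ℝ φ z v)
          + fderiv ℝ (fderiv ℝ φ) z u v := by
      filter_upwards [h.isOpen.mem_nhds hy] with z hz using h.christoffel hg hz u v
    have h3 := congrArg (fun f : E →L[ℝ] E => f t) h1.fderiv_eq
    have d1 : DifferentiableAt ℝ (fun z => KaluzaKlein.christoffel g' z u v) y :=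
      (hΓ'.clm_apply (differentiableAt_const u)).clm_apply (differentiableAt_const v)
    have d2 : DifferentiableAt ℝ (fun z => fderiv ℝ (fderiv ℝ φ) z u v) y :=
      (hφ3.clm_apply (differentiableAt_const u)).clm_apply (differentiableAt_const v)
    rw [fderiv_fun_add ((hc.clm_apply (d u)).clm_apply (d v)) d2, add_apply,
      fderiv_clm_apply_apply hφ2 d1, fderiv_clm_apply₂ hc (d u) (d v), fderiv_comp_apply hΓ hφd,
      fderiv_apply_const hφ2, fderiv_apply_const hφ2, fderiv_apply₂_const hΓ',
      fderiv_apply₂_const hφ3] at h3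
    rw [← h3]
    abel
  rw [curvature_apply, curvature_apply, map_sub, map_add, map_sub, key, key, h.christoffel hg hy,
    h.christoffel hg hy, h.christoffel hg hy, h.christoffel hg hy]
  simp only [map_add]
  rw [hφ.second_symm v u, hφ.fderiv_infty.second_symm u v]
  abel

theorem ricci (h : IsPullbackOn φ V U g g') (hg : IsMetricOn g U) (hy : y ∈ V) (v w : E) :
    ricci g' y v w = KaluzaKlein.ricci g (φ y) (fderiv ℝ φ y v) (fderiv ℝ φ y w) := by
  rw [ricci_apply, ricci_apply]
  exact traceL_eq_of_intertwine (h.injective y hy) fun u => h.curvature hg hy u v w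

theorem scalarCurvature (h : IsPullbackOn φ V U g g') (hg : IsMetricOn g U) (hy : y ∈ V) :
    scalarCurvature g' y = KaluzaKlein.scalarCurvature g (φ y) := by
  refine traceL_eq_of_intertwine (h.injective y hy) fun u => ?_
  refine eq_of_flat_eq (hg.nondeg _ (h.mapsTo y hy)) fun w => ?_
  obtain ⟨w, rfl⟩ := h.surjective hy w
  rw [← h.eq y hy, endo_left ((h.isMetricOn hg).nondeg y hy),
    endo_left (hg.nondeg _ (h.mapsTo y hy)), h.ricci hg hy]

/-- Naturality of the Einstein tensor. -/
theorem einstein (h : IsPullbackOn φ V U g g') (hg : IsMetricOn g U) (hy : y ∈ V) (v w : E) :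
    einstein g' y v w = KaluzaKlein.einstein g (φ y) (fderiv ℝ φ y v) (fderiv ℝ φ y w) := by
  simp only [KaluzaKlein.einstein, sub_apply, smul_apply, h.ricci hg hy, h.scalarCurvature hg hy,
    h.eq y hy]

/-- Naturality of the covariant derivative of vector fields. -/
theorem covDerivVec (h : IsPullbackOn φ V U g g') (hg : IsMetricOn g U) (hy : y ∈ V)
    {X X' : E → E} (hX : DifferentiableAt ℝ X (φ y)) (hX' : DifferentiableAt ℝ X' y)
    (hXX' : ∀ᶠ z in nhds y, fderiv ℝ φ z (X' z) = X (φ z)) (u : E) :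
    fderiv ℝ φ y (covDerivVec g' X' y u) = KaluzaKlein.covDerivVec g X (φ y) (fderiv ℝ φ y u) := by
  have hφ := h.contDiffAt y hy
  have h3 := congrArg (fun f : E →L[ℝ] E => f u) (Filter.EventuallyEq.fderiv_eq hXX')
  rw [fderiv_comp_apply hX hφ.differentiableAt_infty,
    fderiv_clm_apply_apply hφ.fderiv_infty.differentiableAt_infty hX'] at h3
  change fderiv ℝ φ y (fderiv ℝ X' y u + KaluzaKlein.christoffel g' y u (X' y)) =
    fderiv ℝ X (φ y) (fderiv ℝ φ y u) + KaluzaKlein.christoffel g (φ y) (fderiv ℝ φ y u) (X (φ y))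
  rw [map_add, h.christoffel hg hy, ← h3, hXX'.self_of_nhds]
  abel

end IsPullbackOn

end Naturality

/-! ### Fields read in preferred charts, and the change of chart. -/

section Charts

variable {E : Type*} [NormedAddCommGroup E] [NormedSpace ℝ E]
  {M : Type*} [TopologicalSpace M] [ChartedSpace E M]

variable (E) in
/-- The coordinate domain of the preferred chart at `x`. -/
def chartDomain (x : M) : Set E := (extChartAt 𝓘(ℝ, E) x).target

theorem isOpen_chartDomain (x : M) : IsOpen (chartDomain E x) := isOpen_extChartAt_target x

theorem coord_mem_chartDomain {x z : M} (hz : z ∈ (chartAt E x).source) :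
    coord (E := E) x z ∈ chartDomain E x :=
  (extChartAt 𝓘(ℝ, E) x).map_source (by rwa [extChartAt_source])

theorem coord_self_mem_chartDomain (x : M) : coord (E := E) x x ∈ chartDomain E x :=
  coord_mem_chartDomain (mem_chart_source E x)

theorem param_mem_source {x : M} {y : E} (hy : y ∈ chartDomain E x) :
    param x y ∈ (chartAt E x).source := by
  rw [← extChartAt_source 𝓘(ℝ, E)]
  exact (extChartAt 𝓘(ℝ, E) x).map_target hy

theorem param_coord {x z : M} (hz : z ∈ (chartAt E x).source) :
    param (E := E) x (coord x z) = z :=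
  (extChartAt 𝓘(ℝ, E) x).left_inv (by rwa [extChartAt_source])

theorem coord_param {x : M} {y : E} (hy : y ∈ chartDomain E x) : coord x (param x y) = y :=
  (extChartAt 𝓘(ℝ, E) x).right_inv hy

theorem param_coord_self (x : M) : param (E := E) x (coord x x) = x :=
  param_coord (mem_chart_source E x)

theorem continuousAt_param {x : M} {y : E} (hy : y ∈ chartDomain E x) :
    ContinuousAt (param (E := E) x) y :=
  (continuousOn_extChartAt_symm x).continuousAt ((isOpen_chartDomain x).mem_nhds hy)

theorem eventually_param_mem {x : M} {y : E} (hy : y ∈ chartDomain E x) {D : Set M}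
    (hD : IsOpen D) (h : param x y ∈ D) :
    ∀ᶠ z in nhds y, z ∈ chartDomain E x ∧ param x z ∈ D :=
  Filter.Eventually.and ((isOpen_chartDomain x).mem_nhds hy)
    ((continuousAt_param hy).eventually_mem (hD.mem_nhds h))

theorem localBilin_apply (T : BilinField E M) (x : M) (y u v : E) :
    localBilin T x y u v =
      (T (param x y) : E →L[ℝ] E →L[ℝ] ℝ) (dparam x y u) (dparam x y v) := rfl

theorem localForm_apply (α : FormField E M) (x : M) (y v : E) :
    localForm α x y v = (α (param x y) : E →L[ℝ] ℝ) (dparam x y v) := rfl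

variable [IsManifold 𝓘(ℝ, E) ∞ M]

theorem contDiffAt_transition {x z : M} {y : E} (hy : y ∈ chartDomain E x)
    (hz : param x y ∈ (chartAt E z).source) :
    ContDiffAt ℝ ∞ (coord (E := E) z ∘ param x) y := by
  rw [← contMDiffAt_iff_contDiffAt]
  have h1 : ContMDiffAt 𝓘(ℝ, E) 𝓘(ℝ, E) ∞ (param (E := E) x) y :=
    (contMDiffOn_extChartAt_symm x).contMDiffAt ((isOpen_chartDomain x).mem_nhds hy)
  have h2 : ContMDiffAt 𝓘(ℝ, E) 𝓘(ℝ, E) ∞ (coord (E := E) z) (param x y) :=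
    contMDiffOn_extChartAt.contMDiffAt ((chartAt E z).open_source.mem_nhds hz)
  exact h2.comp y h1

theorem mdifferentiableAt_param {x : M} {y : E} (hy : y ∈ chartDomain E x) :
    MDifferentiableAt 𝓘(ℝ, E) 𝓘(ℝ, E) (param (E := E) x) y :=
  ((contMDiffOn_extChartAt_symm (n := ∞) x).contMDiffAt
    ((isOpen_chartDomain x).mem_nhds hy)).mdifferentiableAt (by simp)

/-- A vector tangent at `param x y` is read in the preferred chart of that point, so the
differential of the parametrization is the derivative of a transition map. This turns naturality
under transitions into coordinate expressions at every point of one chart. -/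
theorem dparam_eq_fderiv {x : M} {y : E} (hy : y ∈ chartDomain E x) :
    dparam x y = fderiv ℝ (coord (param x y) ∘ param x) y := by
  rw [dparam, (mdifferentiableAt_param hy).mfderiv, writtenInExtChartAt, ← fderivWithin_univ]
  simp only [mfld_simps]
  rfl

theorem fderiv_transition {x z : M} {y : E} (hy : y ∈ chartDomain E x) :
    fderiv ℝ (coord z ∘ param x) y = tangentCoordChange 𝓘(ℝ, E) x z (param x y) := by
  have h : extChartAt 𝓘(ℝ, E) x (param x y) = y := coord_param hy
  rw [tangentCoordChange_def, h]
  simp only [mfld_simps, fderivWithin_univ]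
  rfl

theorem dparam_eq {x : M} {y : E} (hy : y ∈ chartDomain E x) :
    dparam x y = tangentCoordChange 𝓘(ℝ, E) x (param x y) (param x y) := by
  rw [dparam_eq_fderiv hy, fderiv_transition hy]

theorem dparam_coord {x z : M} (hz : z ∈ (chartAt E x).source) :
    dparam x (coord x z) = tangentCoordChange 𝓘(ℝ, E) x z z := by
  rw [dparam_eq (coord_mem_chartDomain hz), param_coord hz]

theorem dparam_self (x : M) : dparam x (coord x x) = ContinuousLinearMap.id ℝ E := by
  rw [dparam_coord (mem_chart_source E x)]
  ext v
  exact tangentCoordChange_self (by simp)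

/-- The cocycle relation of the coordinate changes. -/
theorem dparam_transition {x z : M} {y : E} (hy : y ∈ chartDomain E x)
    (hz : param x y ∈ (chartAt E z).source) (v : E) :
    dparam z (coord z (param x y)) (fderiv ℝ (coord z ∘ param x) y v) = dparam x y v := by
  rw [dparam_coord hz, fderiv_transition hy, dparam_eq hy]
  exact tangentCoordChange_comp (by simpa using ⟨param_mem_source hy, hz⟩)

theorem dparam_left_inv {x : M} {y : E} (hy : y ∈ chartDomain E x) (v : E) :
    tangentCoordChange 𝓘(ℝ, E) (param x y) x (param x y) (dparam x y v) = v := by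
  rw [dparam_eq hy, tangentCoordChange_comp (by simpa using param_mem_source hy)]
  exact tangentCoordChange_self (by simpa using param_mem_source hy)

theorem dparam_right_inv {x : M} {y : E} (hy : y ∈ chartDomain E x) (v : E) :
    dparam x y (tangentCoordChange 𝓘(ℝ, E) (param x y) x (param x y) v) = v := by
  rw [dparam_eq hy, tangentCoordChange_comp (by simpa using param_mem_source hy)]
  exact tangentCoordChange_self (by simp)

theorem dparam_injective {x : M} {y : E} (hy : y ∈ chartDomain E x) :
    Function.Injective (dparam x y) :=
  Function.LeftInverse.injective (dparam_left_inv hy)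

theorem fderiv_transition_injective {x z : M} {y : E} (hy : y ∈ chartDomain E x)
    (hz : param x y ∈ (chartAt E z).source) :
    Function.Injective (fderiv ℝ (coord (E := E) z ∘ param x) y) := by
  intro u v h
  apply dparam_injective hy
  rw [← dparam_transition hy hz, h, dparam_transition hy hz]

/-- `ContinuousLinearMap.inverse`, used in `localVec`, is zero on a non-invertible map; on the chart
domain it is a genuine inverse. -/
theorem inverse_dparam {x : M} {y : E} (hy : y ∈ chartDomain E x) :
    (dparam x y).inverse = tangentCoordChange 𝓘(ℝ, E) (param x y) x (param x y) := by
  let e : E ≃L[ℝ] E := ContinuousLinearEquiv.equivOfInverse (dparam x y)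
    (tangentCoordChange 𝓘(ℝ, E) (param x y) x (param x y)) (dparam_left_inv hy)
    (dparam_right_inv hy)
  exact ContinuousLinearMap.inverse_equiv e

theorem dparam_localVec {x : M} {y : E} (hy : y ∈ chartDomain E x) (V : VecField E M) :
    dparam x y (localVec V x y) = V (param x y) := by
  rw [localVec, inverse_dparam hy]
  exact dparam_right_inv hy _

theorem localBilin_localVec {x : M} {y : E} (hy : y ∈ chartDomain E x) (T : BilinField E M)
    (V W : VecField E M) : localBilin T x y (localVec V x y) (localVec W x y) =
      T (param x y) (V (param x y)) (W (param x y)) := by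
  rw [localBilin_apply, dparam_localVec hy, dparam_localVec hy]

theorem localVec_self (V : VecField E M) (x : M) : localVec V x (coord x x) = V x := by
  have h := dparam_localVec (coord_self_mem_chartDomain x) V
  rw [dparam_self, ContinuousLinearMap.id_apply] at h
  rw [h, param_coord_self]

theorem localBilin_self (T : BilinField E M) (x : M) : localBilin T x (coord x x) = T x := by
  ext u v
  rw [localBilin_apply, dparam_self, param_coord_self]
  rfl

/-- Change of chart for bilinear forms. -/
theorem localBilin_transition {x z : M} {y : E} (hy : y ∈ chartDomain E x)
    (hz : param x y ∈ (chartAt E z).source) (T : BilinField E M) (u v : E) :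
    localBilin T x y u v = localBilin T z (coord z (param x y))
      (fderiv ℝ (coord z ∘ param x) y u) (fderiv ℝ (coord z ∘ param x) y v) := by
  rw [localBilin_apply, localBilin_apply, dparam_transition hy hz, dparam_transition hy hz,
    param_coord hz]

theorem localVec_transition {x z : M} {y : E} (hy : y ∈ chartDomain E x)
    (hz : param x y ∈ (chartAt E z).source) (V : VecField E M) :
    fderiv ℝ (coord z ∘ param x) y (localVec V x y) = localVec V z (coord z (param x y)) := by
  apply dparam_injective (coord_mem_chartDomain hz)
  rw [dparam_transition hy hz, dparam_localVec hy, dparam_localVec (coord_mem_chartDomain hz),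
    param_coord hz]

theorem localForm_transition {x z : M} {y : E} (hy : y ∈ chartDomain E x)
    (hz : param x y ∈ (chartAt E z).source) (α : FormField E M) (v : E) :
    localForm α x y v =
      localForm α z (coord z (param x y)) (fderiv ℝ (coord z ∘ param x) y v) := by
  rw [localForm_apply, localForm_apply, dparam_transition hy hz, param_coord hz]

/-- Smoothness of a section is smoothness of its component in the trivialization at `x`, and this
component is `localVec` composed with the chart. -/
theorem contDiffAt_localVec {V : VecField E M} {D : Set M} (hD : IsOpen D)
    (hV : SmoothVecOn V D) {x : M} {y : E} (hy : y ∈ chartDomain E x) (h : param x y ∈ D) :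
    ContDiffAt ℝ ∞ (localVec V x) y := by
  have h1 := (hV (param x y) h).contMDiffAt (hD.mem_nhds h)
  rw [(trivializationAt E (TangentSpace 𝓘(ℝ, E)) x).contMDiffAt_section_iff
    (by simpa using param_mem_source hy)] at h1
  have h0 : ContMDiffAt 𝓘(ℝ, E) 𝓘(ℝ, E) ∞ (param (E := E) x) y :=
    (contMDiffOn_extChartAt_symm x).contMDiffAt ((isOpen_chartDomain x).mem_nhds hy)
  have h2 := (h1.comp y h0).contDiffAt
  refine h2.congr_of_eventuallyEq ?_
  filter_upwards [(isOpen_chartDomain x).mem_nhds hy] with z hz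
  rw [localVec, inverse_dparam hz]
  rfl

theorem contDiffAt_localBilin [FiniteDimensional ℝ E] {T : BilinField E M}
    (hT : ContMDiff 𝓘(ℝ, E) (𝓘(ℝ, E).prod 𝓘(ℝ, E →L[ℝ] E →L[ℝ] ℝ)) ∞
      (fun x => Bundle.TotalSpace.mk' (E →L[ℝ] E →L[ℝ] ℝ) x (T x)))
    {x : M} {y : E} (hy : y ∈ chartDomain E x) : ContDiffAt ℝ ∞ (localBilin T x) y := by
  have h1 := hT (param x y)
  rw [(trivializationAt (E →L[ℝ] E →L[ℝ] ℝ) (fun x : M =>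
    TangentSpace 𝓘(ℝ, E) x →L[ℝ] TangentSpace 𝓘(ℝ, E) x →L[ℝ] ℝ) x).contMDiffAt_section_iff
    (by simpa using param_mem_source hy)] at h1
  have h0 : ContMDiffAt 𝓘(ℝ, E) 𝓘(ℝ, E) ∞ (param (E := E) x) y :=
    (contMDiffOn_extChartAt_symm x).contMDiffAt ((isOpen_chartDomain x).mem_nhds hy)
  have h2 := (h1.comp y h0).contDiffAt
  refine h2.congr_of_eventuallyEq ?_
  filter_upwards [(isOpen_chartDomain x).mem_nhds hy] with z hz
  ext u v
  have hb : param x z ∈ (trivializationAt E (TangentSpace 𝓘(ℝ, E)) x).baseSet := by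
    simpa using param_mem_source hz
  have h3 := inCoordinates_apply_eq₂ (𝕜 := ℝ) (F₁ := E) (F₂ := E) (F₃ := ℝ)
    (E₁ := (TangentSpace 𝓘(ℝ, E) : M → Type _)) (E₂ := (TangentSpace 𝓘(ℝ, E) : M → Type _))
    (E₃ := fun _ => ℝ) (ϕ := T (param x z)) (v := u) (w := v) hb hb (Set.mem_univ _)
  rw [Function.comp_apply, hom_trivializationAt_apply]
  refine Eq.trans ?_ h3.symm
  -- The component of `T` in the bundle of bilinear forms is obtained by inserting inverse tangent
  -- trivializations, and these are `dparam`.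
  have hs : ∀ v : E, (trivializationAt E (TangentSpace 𝓘(ℝ, E)) x).symm (param x z) v =
      dparam x z v := fun v => by
    rw [dparam_eq hz]
    refine (Bundle.Trivialization.symmL_apply (R := ℝ)
      (trivializationAt E (TangentSpace 𝓘(ℝ, E)) x) hb v).symm.trans ?_
    exact congrArg (fun f : E →L[ℝ] E => f v)
      (TangentBundle.symmL_trivializationAt_eq_core (I := 𝓘(ℝ, E)) (param_mem_source hz))
  rw [hs, hs, localBilin_apply]
  simp only [Bundle.Trivial.fiberBundle_trivializationAt', Bundle.Trivial.linearMapAt_trivialization]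
  rfl

end Charts

/-! ### Metric, Killing equation and exterior derivatives in a fixed chart. -/

section LocalMetric

variable {E : Type*} [NormedAddCommGroup E] [NormedSpace ℝ E]
  {M : Type*} [TopologicalSpace M] [ChartedSpace E M]

variable [IsManifold 𝓘(ℝ, E) ∞ M]

/-- Naturality of the exterior derivative: the expression of `dα` in any preferred chart. -/
theorem localBilin_extDerivOne {α : FormField E M}
    (hα : ∀ x : M, DifferentiableAt ℝ (localForm α x) (coord x x)) {x : M} {y : E}
    (hy : y ∈ chartDomain E x) (u v : E) :
    localBilin (extDerivOne α) x y u v =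
      fderiv ℝ (localForm α x) y u v - fderiv ℝ (localForm α x) y v u := by
  have hz : param x y ∈ (chartAt E (param x y)).source := mem_chart_source E _
  have h := fderiv_pullback_form (φ := coord (param x y) ∘ param x)
    (contDiffAt_transition hy hz) (hα (param x y)) (α' := localForm α x) (by
      filter_upwards [eventually_param_mem hy (chartAt E (param x y)).open_source hz] with w hw v
        using localForm_transition hw.1 hw.2 α v) u v
  rw [h, ← dparam_eq_fderiv hy]
  rfl

namespace SemiRiemannianMetric

variable (g : SemiRiemannianMetric E M)

/-- Taken at `z = param x y`, this compares a fixed chart with the preferred chart of a nearby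
point, where the intrinsic objects are defined. -/
theorem isPullbackOn (x z : M) :
    IsPullbackOn (coord z ∘ param x)
      {y | y ∈ chartDomain E x ∧ param x y ∈ (chartAt E z).source} (chartDomain E z)
      (localBilin g.val z) (localBilin g.val x) where
  isOpen := by
    rw [isOpen_iff_mem_nhds]
    exact fun y hy => eventually_param_mem hy.1 (chartAt E z).open_source hy.2
  mapsTo y hy := coord_mem_chartDomain hy.2
  contDiffAt y hy := contDiffAt_transition hy.1 hy.2
  injective y hy := fderiv_transition_injective hy.1 hy.2
  eq y hy u v := localBilin_transition hy.1 hy.2 g.val u v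

theorem localForm_flat {x : M} {y : E} (hy : y ∈ chartDomain E x) (Y : VecField E M) :
    localForm (g.flat Y) x y = localBilin g.val x y (localVec Y x y) := by
  ext v
  rw [localForm_apply, localBilin_apply, dparam_localVec hy]
  rfl

variable [FiniteDimensional ℝ E]

theorem isMetricOn (x : M) : IsMetricOn (localBilin g.val x) (chartDomain E x) where
  isOpen := isOpen_chartDomain x
  contDiffAt y hy := contDiffAt_localBilin g.smooth hy
  symm y _ u v := g.symm (param x y) (dparam x y u) (dparam x y v)
  nondeg y hy u hu := by
    have h : ∀ v : E, (g.val (param x y) : E →L[ℝ] E →L[ℝ] ℝ) (dparam x y u) v = 0 := fun v => by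
      rw [← dparam_right_inv hy v, ← localBilin_apply, hu]
    have h0 : dparam x y u = 0 := g.nondegenerate (param x y) (dparam x y u) h
    exact dparam_injective hy (h0.trans (map_zero _).symm)

/-- The expression of the Einstein tensor in any preferred chart. -/
theorem localBilin_einsteinField {x : M} {y : E} (hy : y ∈ chartDomain E x) :
    localBilin g.einsteinField x y = einstein (localBilin g.val x) y := by
  ext u v
  rw [(g.isPullbackOn x (param x y)).einstein (g.isMetricOn _) ⟨hy, mem_chart_source E _⟩,
    ← dparam_eq_fderiv hy]
  rfl

/-- `IsKilling` tests each point in its own preferred chart; naturality of $\nabla$ moves the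
condition to one chart on an open set, where it can be differentiated. -/
theorem isKillingOn {Y : VecField E M} (hY : SmoothVecOn Y Set.univ) (hK : g.IsKilling Y) (x : M) :
    IsKillingOn (localBilin g.val x) (localVec Y x) (chartDomain E x) where
  contDiffAt y hy := contDiffAt_localVec isOpen_univ hY hy (Set.mem_univ _)
  inner_add y hy u v := by
    have hz : param x y ∈ (chartAt E (param x y)).source := mem_chart_source E _
    have hs : ∀ x : M, ∀ y ∈ chartDomain E x, DifferentiableAt ℝ (localVec Y x) y := fun x y hy =>
      (contDiffAt_localVec isOpen_univ hY hy (Set.mem_univ _)).differentiableAt_infty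
    have key := (g.isPullbackOn x (param x y)).covDerivVec (g.isMetricOn _) ⟨hy, hz⟩
      (hs _ _ (coord_self_mem_chartDomain _)) (hs x y hy) (by
        filter_upwards [eventually_param_mem hy (chartAt E (param x y)).open_source hz] with w hw
        exact localVec_transition hw.1 hw.2 Y)
    rw [← dparam_eq_fderiv hy] at key
    rw [localBilin_apply, localBilin_apply, key, key]
    exact hK (param x y) (dparam x y u) (dparam x y v)

theorem contDiffAt_localForm_flat {Y : VecField E M} (hY : SmoothVecOn Y Set.univ) {x : M} {y : E}
    (hy : y ∈ chartDomain E x) : ContDiffAt ℝ ∞ (localForm (g.flat Y) x) y := by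
  refine (((g.isMetricOn x).contDiffAt y hy).clm_apply
    (contDiffAt_localVec isOpen_univ hY hy (Set.mem_univ _))).congr_of_eventuallyEq ?_
  filter_upwards [(isOpen_chartDomain x).mem_nhds hy] with z hz using g.localForm_flat hz Y

theorem localBilin_extDerivOne_flat {Y : VecField E M} (hY : SmoothVecOn Y Set.univ) {x : M}
    {y : E} (hy : y ∈ chartDomain E x) (u v : E) :
    localBilin (extDerivOne (g.flat Y)) x y u v =
      fderiv ℝ (localForm (g.flat Y) x) y u v - fderiv ℝ (localForm (g.flat Y) x) y v u :=
  localBilin_extDerivOne (fun x =>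
    (g.contDiffAt_localForm_flat hY (coord_self_mem_chartDomain x)).differentiableAt_infty) hy u v

theorem contDiffAt_localBilin_extDerivOne_flat {Y : VecField E M} (hY : SmoothVecOn Y Set.univ)
    {x : M} {y : E} (hy : y ∈ chartDomain E x) :
    ContDiffAt ℝ ∞ (localBilin (extDerivOne (g.flat Y)) x) y := by
  have h := (g.contDiffAt_localForm_flat hY hy).fderiv_infty
  refine (h.sub ((ContinuousLinearMap.flipₗᵢ ℝ E E ℝ).contDiff.contDiffAt.comp y
    h)).congr_of_eventuallyEq ?_
  filter_upwards [(isOpen_chartDomain x).mem_nhds hy] with z hz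
  ext u v
  exact g.localBilin_extDerivOne_flat hY hz u v

/-- `d (Y♭) = 2 ∇Y` for a Killing field `Y`. -/
theorem localBilin_extDerivOne_flat_of_isKilling {Y : VecField E M} (hY : SmoothVecOn Y Set.univ)
    (hK : g.IsKilling Y) {x : M} {y : E} (hy : y ∈ chartDomain E x) (u v : E) :
    localBilin (extDerivOne (g.flat Y)) x y u v =
      2 * localBilin g.val x y (covDerivVec (localBilin g.val x) (localVec Y x) y u) v := by
  have hg := g.isMetricOn x
  have hα := (g.contDiffAt_localForm_flat hY hy).differentiableAt_infty
  have hYd := (contDiffAt_localVec isOpen_univ hY hy (Set.mem_univ _)).differentiableAt_infty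
  -- In $dY^\flat(u,v)$ the $\Gamma$-terms cancel because the connection is torsion-free, and
  -- skewness of $\nabla Y$ produces the factor 2.
  have key : ∀ u v, fderiv ℝ (localForm (g.flat Y) x) y u v =
      localBilin g.val x y (covDerivVec (localBilin g.val x) (localVec Y x) y u) v
        + localBilin g.val x y (localVec Y x y) (christoffel (localBilin g.val x) y u v) := by
    intro u v
    have h : (fun z => localForm (g.flat Y) x z v) =ᶠ[nhds y]
        fun z => localBilin g.val x z (localVec Y x z) v := by
      filter_upwards [(isOpen_chartDomain x).mem_nhds hy] with z hz
      rw [g.localForm_flat hz Y]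
    rw [← fderiv_apply_const hα, h.fderiv_eq, hg.fderiv_inner_const_right hy hYd]
    rfl
  have h := (g.isKillingOn hY hK x).inner_add y hy u v
  rw [g.localBilin_extDerivOne_flat hY hy, key, key, hg.christoffel_symm hy u v]
  linarith

/-- The identity $d^2=0$: the six second derivatives of $Y^\flat$ cancel in pairs. It uses the
expression of $dY^\flat$ on a whole neighbourhood in one chart. -/
theorem extDerivTwo_extDerivOne_flat {Y : VecField E M} (hY : SmoothVecOn Y Set.univ) (x : M)
    (u v w : TangentSpace 𝓘(ℝ, E) x) : extDerivTwo (extDerivOne (g.flat Y)) x u v w = 0 := by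
  have hy := coord_self_mem_chartDomain (E := E) x
  have hα := g.contDiffAt_localForm_flat hY hy
  have hα2 := hα.fderiv_infty.differentiableAt_infty
  have d : ∀ v w, DifferentiableAt ℝ (fun z => fderiv ℝ (localForm (g.flat Y) x) z v w)
      (coord x x) := fun v w =>
    (hα2.clm_apply (differentiableAt_const v)).clm_apply (differentiableAt_const w)
  have key : ∀ u v w : E, fderiv ℝ (localBilin (extDerivOne (g.flat Y)) x) (coord x x) u v w =
      fderiv ℝ (fderiv ℝ (localForm (g.flat Y) x)) (coord x x) u v w
        - fderiv ℝ (fderiv ℝ (localForm (g.flat Y) x)) (coord x x) u w v := by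
    intro u v w
    have h : (fun z => localBilin (extDerivOne (g.flat Y)) x z v w) =ᶠ[nhds (coord x x)]
        fun z => fderiv ℝ (localForm (g.flat Y) x) z v w
          - fderiv ℝ (localForm (g.flat Y) x) z w v := by
      filter_upwards [(isOpen_chartDomain x).mem_nhds hy] with z hz
        using g.localBilin_extDerivOne_flat hY hz v w
    rw [← fderiv_apply₂_const
      (g.contDiffAt_localBilin_extDerivOne_flat hY hy).differentiableAt_infty, h.fderiv_eq,
      fderiv_fun_sub (d v w) (d w v), sub_apply, fderiv_apply₂_const hα2, fderiv_apply₂_const hα2]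
  have fin : ∀ u v w : E,
      fderiv ℝ (localBilin (extDerivOne (g.flat Y)) x) (coord x x) u v w
      - fderiv ℝ (localBilin (extDerivOne (g.flat Y)) x) (coord x x) v u w
      + fderiv ℝ (localBilin (extDerivOne (g.flat Y)) x) (coord x x) w u v = 0 := by
    intro u v w
    rw [key, key, key, hα.second_symm v u, hα.second_symm w u, hα.second_symm w v]
    ring
  exact fin u v w

end SemiRiemannianMetric

end LocalMetric

/-! ### Divergences of products, of decomposable tensors and of contractions with Killing fields. -/

section Divergence

variable {E : Type*} [NormedAddCommGroup E] [NormedSpace ℝ E]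

theorem covDerivVec_congr (g : E → E →L[ℝ] E →L[ℝ] ℝ) {V W : E → E} {y : E}
    (h : V =ᶠ[nhds y] W) : covDerivVec g V y = covDerivVec g W y := by
  rw [covDerivVec, covDerivVec, h.fderiv_eq, h.self_of_nhds]

theorem covDerivVec_smul (g : E → E →L[ℝ] E →L[ℝ] ℝ) {f : E → ℝ} {V : E → E} {y : E}
    (hf : DifferentiableAt ℝ f y) (hV : DifferentiableAt ℝ V y) (u : E) :
    covDerivVec g (fun z => f z • V z) y u = fderiv ℝ f y u • V y + f y • covDerivVec g V y u := by
  rw [covDerivVec_apply, covDerivVec_apply, fderiv_fun_smul hf hV, map_smul]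
  simp only [add_apply, smul_apply, ContinuousLinearMap.smulRight_apply, smul_add]
  abel

theorem covDerivVec_add (g : E → E →L[ℝ] E →L[ℝ] ℝ) {V W : E → E} {y : E}
    (hV : DifferentiableAt ℝ V y) (hW : DifferentiableAt ℝ W y) (u : E) :
    covDerivVec g (fun z => V z + W z) y u = covDerivVec g V y u + covDerivVec g W y u := by
  rw [covDerivVec_apply, covDerivVec_apply, covDerivVec_apply, fderiv_fun_add hV hW, map_add,
    add_apply]
  abel

/-- The field of bilinear forms `a♭ ⊗ b♭`. -/
noncomputable def flatTensor (g : E → E →L[ℝ] E →L[ℝ] ℝ) (a b : E → E) (y : E) :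
    E →L[ℝ] E →L[ℝ] ℝ :=
  (g y (a y)).smulRight (g y (b y))

theorem flatTensor_apply (g : E → E →L[ℝ] E →L[ℝ] ℝ) (a b : E → E) (y u v : E) :
    flatTensor g a b y u v = g y (a y) u * g y (b y) v := rfl

variable {g : E → E →L[ℝ] E →L[ℝ] ℝ} {U : Set E} {y : E}

theorem IsMetricOn.mono (hg : IsMetricOn g U) {V : Set E} (hV : IsOpen V) (h : V ⊆ U) : IsMetricOn g V where
  isOpen := hV
  contDiffAt y hy := hg.contDiffAt y (h hy)
  symm y hy := hg.symm y (h hy)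
  nondeg y hy := hg.nondeg y (h hy)

theorem IsKillingOn.mono {Y : E → E} (hY : IsKillingOn g Y U) {V : Set E} (h : V ⊆ U) : IsKillingOn g Y V where
  contDiffAt y hy := hY.contDiffAt y (h hy)
  inner_add y hy := hY.inner_add y (h hy)

theorem IsMetricOn.differentiableAt_flatTensor (hg : IsMetricOn g U) (hy : y ∈ U) {a b : E → E}
    (ha : DifferentiableAt ℝ a y) (hb : DifferentiableAt ℝ b y) :
    DifferentiableAt ℝ (flatTensor g a b) y := by
  have hgd := (hg.contDiffAt y hy).differentiableAt_infty
  have h : flatTensor g a b = fun z =>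
      ContinuousLinearMap.smulRightL ℝ E (E →L[ℝ] ℝ) (g z (a z)) (g z (b z)) := rfl
  rw [h]
  exact ((differentiableAt_const _).clm_apply (hgd.clm_apply ha)).clm_apply (hgd.clm_apply hb)

variable [FiniteDimensional ℝ E]

theorem divForm_congr (g : E → E →L[ℝ] E →L[ℝ] ℝ) {T T' : E → E →L[ℝ] E →L[ℝ] ℝ} {y : E}
    (h : T =ᶠ[nhds y] T') : divForm g T y = divForm g T' y := by
  rw [divForm, divForm, covDerivBilin, covDerivBilin, h.fderiv_eq, h.self_of_nhds]

theorem traceL_smulRight (α : E →L[ℝ] ℝ) (u : E) : traceL E (α.smulRight u) = α u := by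
  rw [traceL_apply]
  exact LinearMap.trace_smulRight (R := ℝ) α.toLinearMap u

theorem trace_covDerivVec_smul (g : E → E →L[ℝ] E →L[ℝ] ℝ) {f : E → ℝ} {V : E → E} {y : E}
    (hf : DifferentiableAt ℝ f y) (hV : DifferentiableAt ℝ V y) :
    traceL E (covDerivVec g (fun z => f z • V z) y) =
      fderiv ℝ f y (V y) + f y * traceL E (covDerivVec g V y) := by
  have h : covDerivVec g (fun z => f z • V z) y =
      (fderiv ℝ f y).smulRight (V y) + f y • covDerivVec g V y := by
    ext1 u
    exact covDerivVec_smul g hf hV u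
  rw [h, map_add, map_smul, traceL_smulRight, smul_eq_mul]

theorem trace_covDerivVec_add (g : E → E →L[ℝ] E →L[ℝ] ℝ) {V W : E → E} {y : E}
    (hV : DifferentiableAt ℝ V y) (hW : DifferentiableAt ℝ W y) :
    traceL E (covDerivVec g (fun z => V z + W z) y) =
      traceL E (covDerivVec g V y) + traceL E (covDerivVec g W y) := by
  rw [← map_add]
  congr 1
  ext1 u
  exact covDerivVec_add g hV hW u

namespace IsMetricOn

theorem fderiv_inner (hg : IsMetricOn g U) (hy : y ∈ U) {a b : E → E}
    (ha : DifferentiableAt ℝ a y) (hb : DifferentiableAt ℝ b y) (u : E) :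
    fderiv ℝ (fun z => g z (a z) (b z)) y u =
      g y (covDerivVec g a y u) (b y) + g y (a y) (covDerivVec g b y u) := by
  rw [fderiv_clm_apply₂ (hg.contDiffAt y hy).differentiableAt_infty ha hb, hg.fderiv_metric hy,
    covDerivVec_apply, covDerivVec_apply]
  simp only [map_add, add_apply]
  ring

theorem inner_covDerivVec_self (hg : IsMetricOn g U) {a : E → E} {c : ℝ}
    (h : ∀ z ∈ U, g z (a z) (a z) = c) (hy : y ∈ U) (ha : DifferentiableAt ℝ a y) (u : E) :
    g y (covDerivVec g a y u) (a y) = 0 := by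
  have h1 : (fun z => g z (a z) (a z)) =ᶠ[nhds y] fun _ => c := by
    filter_upwards [hg.mem_nhds hy] with z hz using h z hz
  have h2 := congrArg (fun f : E →L[ℝ] ℝ => f u) h1.fderiv_eq
  rw [hg.fderiv_inner hy ha ha, hg.symm y hy (a y)] at h2
  simp only [fderiv_fun_const, Pi.zero_apply, zero_apply] at h2
  linarith

/-- `∇·(a♭ ⊗ b♭) = (∇·a) b + ∇_a b`. -/
theorem divForm_flatTensor (hg : IsMetricOn g U) (hy : y ∈ U) {a b : E → E}
    (ha : DifferentiableAt ℝ a y) (hb : DifferentiableAt ℝ b y) (w : E) :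
    divForm g (flatTensor g a b) y w =
      traceL E (covDerivVec g a y) * g y (b y) w + g y (covDerivVec g b y (a y)) w := by
  obtain ⟨n, e, c, he, htr⟩ := exists_weighted_basis (hg.nondeg y hy) (hg.symm y hy)
  have hgd := (hg.contDiffAt y hy).differentiableAt_infty
  have hd : ∀ {f : E → E} (v : E), DifferentiableAt ℝ f y →
      DifferentiableAt ℝ (fun z => g z (f z) v) y := fun v hf =>
    (hgd.clm_apply hf).clm_apply (differentiableAt_const v)
  have key : ∀ u v, covDerivBilin g (flatTensor g a b) y u v w =
      g y (covDerivVec g a y u) v * g y (b y) w + g y (a y) v * g y (covDerivVec g b y u) w := by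
    intro u v
    rw [covDerivBilin_apply, ← fderiv_apply₂_const (hg.differentiableAt_flatTensor hy ha hb)]
    simp only [flatTensor_apply]
    rw [fderiv_fun_mul (hd v ha) (hd w hb)]
    simp only [add_apply, smul_apply, smul_eq_mul, hg.fderiv_inner_const_right hy ha,
      hg.fderiv_inner_const_right hy hb, covDerivVec_apply]
    ring
  rw [hg.divForm_eq_sum hy htr, htr]
  -- Expanding $a$ in the weighted basis turns $\nabla_ab$ into the contraction that occurs on the
  -- left.
  conv_rhs => rw [he (a y)]
  simp only [key, mul_add, Finset.sum_add_distrib, map_sum, sum_apply, Finset.sum_mul, map_smul,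
    smul_apply, smul_eq_mul, mul_assoc]

end IsMetricOn

namespace IsKillingOn

variable {Y : E → E}

/-- The divergence of `ᵉT Y` for a symmetric divergence-free tensor `T` and a Killing field. -/
theorem trace_covDerivVec_of_divForm_eq_zero (hY : IsKillingOn g Y U) (hg : IsMetricOn g U)
    (hy : y ∈ U) {T : E → E →L[ℝ] E →L[ℝ] ℝ} (hT : DifferentiableAt ℝ T y)
    (hs : ∀ u v, T y u v = T y v u) (hdiv : divForm g T y (Y y) = 0) {V : E → E}
    (hV : DifferentiableAt ℝ V y) (h : ∀ z ∈ U, ∀ u, T z u (Y z) = g z (V z) u) :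
    traceL E (covDerivVec g V y) = 0 := by
  obtain ⟨n, b, c, -, htr⟩ := exists_weighted_basis (hg.nondeg y hy) (hg.symm y hy)
  have h0 := hY.sum_symm_covDerivVec hg hy htr hs
  rw [hg.divForm_eq_sum hy htr] at hdiv
  rw [htr]
  -- The Leibniz rule for $V={}^eT(Y)$. Its trace is $(\nabla\cdot T)(Y)$ plus the contraction of
  -- $T$ with $\nabla Y$, symmetric against skew; both vanish.
  have key : ∀ u v, g y (covDerivVec g V y u) v =
      covDerivBilin g T y u v (Y y) + T y v (covDerivVec g Y y u) := by
    intro u v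
    have h1 : (fun z => T z v (Y z)) =ᶠ[nhds y] fun z => g z (V z) v := by
      filter_upwards [hg.mem_nhds hy] with z hz using h z hz v
    have h2 := congrArg (fun f : E →L[ℝ] ℝ => f u) h1.fderiv_eq
    rw [hg.fderiv_inner_const_right hy hV,
      fderiv_clm_apply₂ hT (differentiableAt_const v) (hY.differentiableAt hy), ← h y hy] at h2
    simp only [fderiv_fun_const, Pi.zero_apply, zero_apply, map_zero, add_zero] at h2
    rw [covDerivBilin_apply, covDerivVec_apply, covDerivVec_apply, map_add (T y v)]
    linarith
  simp only [key, mul_add, Finset.sum_add_distrib]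
  linarith

end IsKillingOn

end Divergence

/-! ### The apparent field commutes with the Killing field. -/

section LocalFluid

variable {E : Type*} [NormedAddCommGroup E] [NormedSpace ℝ E]
  {F : Type*} [NormedAddCommGroup F] [NormedSpace ℝ F]

/-- The Lie bracket `[Y, a]` of vector fields. -/
noncomputable def lieBracketAt (Y a : E → E) (y : E) : E :=
  fderiv ℝ a y (Y y) - fderiv ℝ Y y (a y)

/-- The Lie derivative of an invariant bilinear form evaluated on two fields. -/
theorem fderiv_of_lie_eq_zero {T : E → E →L[ℝ] E →L[ℝ] ℝ} {Y a b : E → E} {y : E}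
    (hT : DifferentiableAt ℝ T y) (ha : DifferentiableAt ℝ a y) (hb : DifferentiableAt ℝ b y)
    (hlie : ∀ v w, fderiv ℝ T y (Y y) v w = -T y (fderiv ℝ Y y v) w - T y v (fderiv ℝ Y y w)) :
    fderiv ℝ (fun z => T z (a z) (b z)) y (Y y) =
      T y (lieBracketAt Y a y) (b y) + T y (a y) (lieBracketAt Y b y) := by
  rw [fderiv_clm_apply₂ hT ha hb, hlie, lieBracketAt, lieBracketAt]
  simp only [map_sub, sub_apply]
  ring

theorem lieBracketAt_self (Y : E → E) (y : E) : lieBracketAt Y Y y = 0 := sub_self _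

variable [FiniteDimensional ℝ E] {g : E → E →L[ℝ] E →L[ℝ] ℝ} {Y : E → E} {U : Set E} {y : E}

namespace IsKillingOn

/-- If `a♭ = λ ∘ dp` where `Y` is tangent to the fibers of `p`, then `[Y, a]♭ = Y(λ) ∘ dp`. -/
theorem inner_lieBracketAt (hY : IsKillingOn g Y U) (hg : IsMetricOn g U) (hy : y ∈ U)
    {p : E → F} (hp : ContDiffAt ℝ ∞ p y) (hpY : ∀ z ∈ U, fderiv ℝ p z (Y z) = 0)
    {a : E → E} (ha : DifferentiableAt ℝ a y) {l : E → F →L[ℝ] ℝ} (hl : DifferentiableAt ℝ l y)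
    (h : ∀ᶠ z in nhds y, ∀ v, g z (a z) v = l z (fderiv ℝ p z v)) (v : E) :
    g y (lieBracketAt Y a y) v = fderiv ℝ l y (Y y) (fderiv ℝ p y v) := by
  have hYd := hY.differentiableAt hy
  have hp2 := hp.fderiv_infty.differentiableAt_infty
  have h1 : (fun z => g z (a z) v) =ᶠ[nhds y] fun z => l z (fderiv ℝ p z v) := by
    filter_upwards [h] with z hz using hz v
  have h2 := congrArg (fun f : E →L[ℝ] ℝ => f (Y y)) h1.fderiv_eq
  rw [fderiv_of_lie_eq_zero (b := fun _ => v) (hg.contDiffAt y hy).differentiableAt_infty ha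
    (differentiableAt_const v) (hY.lie_metric hg hy),
    fderiv_clm_apply_apply hl (hp2.clm_apply (differentiableAt_const v)),
    fderiv_apply_const hp2] at h2
  -- Differentiating $dp(Y)=0$ trades $D^2p(Y,v)$ for $-dp(DY\,v)$, which is exactly the bracket of
  -- $Y$ with the constant field $v$.
  have h3 : (fun z => fderiv ℝ p z (Y z)) =ᶠ[nhds y] fun _ => 0 := by
    filter_upwards [hg.mem_nhds hy] with z hz using hpY z hz
  have h4 := congrArg (fun f : E →L[ℝ] F => f v) h3.fderiv_eq
  rw [fderiv_clm_apply_apply hp2 hYd, hp.second_symm] at h4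
  simp only [lieBracketAt, fderiv_fun_const, Pi.zero_apply, zero_apply, zero_sub, map_neg,
    h.self_of_nhds] at h2 h4 ⊢
  rw [eq_neg_of_add_eq_zero_left h4, map_neg] at h2
  linarith

/-- An invariant eigenvector field of the horizontal part of the Einstein tensor, with simple
eigenvalue and constant length, commutes with the Killing field. -/
theorem lieBracketAt_eigenvector_eq_zero [FiniteDimensional ℝ F] (hY : IsKillingOn g Y U)
    (hg : IsMetricOn g U) (hy : y ∈ U) {p : E → F} (hp : ∀ z ∈ U, ContDiffAt ℝ ∞ p z)
    (hpY : ∀ z ∈ U, fderiv ℝ p z (Y z) = 0) (hsurj : Function.Surjective (fderiv ℝ p y))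
    {X : E → E} (hX : DifferentiableAt ℝ X y) {μ : E → ℝ} (hμ : DifferentiableAt ℝ μ y)
    (hXX : ∀ z ∈ U, g z (X z) (X z) = -1)
    (hhor : ∀ z ∈ U, ∀ v, fderiv ℝ p z v = 0 → g z (X z) v = 0)
    (heig : ∀ z ∈ U, ∀ u, (∀ v, fderiv ℝ p z v = 0 → g z u v = 0) →
      einstein g z u (X z) = -μ z * g z u (X z))
    (hsimple : ∀ w, (∀ v, fderiv ℝ p y v = 0 → g y w v = 0) →
      (∀ u, (∀ v, fderiv ℝ p y v = 0 → g y u v = 0) →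
        einstein g y u w = -μ y * g y u w) → ∃ c : ℝ, w = c • X y) :
    lieBracketAt Y X y = 0 := by
  have hgd := (hg.contDiffAt y hy).differentiableAt_infty
  have hGd := (hg.contDiffAt_einstein hy).differentiableAt_infty
  have hp2 := (hp y hy).fderiv_infty.differentiableAt_infty
  -- A right inverse of $dp$ at the single point `y`, used as a constant map nearby.
  obtain ⟨s₀, hs₀⟩ := (fderiv ℝ p y).toLinearMap.exists_rightInverse_of_surjective
    (LinearMap.range_eq_top.2 hsurj)
  let s : F →L[ℝ] E := LinearMap.toContinuousLinearMap s₀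
  have hs : ∀ w, fderiv ℝ p y (s w) = w := fun w => congrArg (fun f : F →ₗ[ℝ] F => f w) hs₀
  set Z := lieBracketAt Y X y with hZ
  -- Horizontality of $X$ lets its dual form factor through $dp$ with a differentiable coefficient,
  -- $l=X^\flat\circ s\circ(dp\circ s)^{-1}$; here $dp\circ s$ is the identity at `y`, hence
  -- invertible nearby. By `inner_lieBracketAt`, $Z^\flat$ factors through $dp$ too.
  have hZhor : ∀ v, fderiv ℝ p y v = 0 → g y Z v = 0 := by
    let q : E → F →L[ℝ] F := fun z => fderiv ℝ p z ∘L s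
    have hqy : q y = (ContinuousLinearEquiv.refl ℝ F : F →L[ℝ] F) := by
      ext w
      exact hs w
    have hqd : DifferentiableAt ℝ q y := hp2.clm_comp (differentiableAt_const s)
    have hqi : DifferentiableAt ℝ (fun z => (q z).inverse) y := by
      have h : ContDiffAt ℝ ∞ (ContinuousLinearMap.inverse (R := ℝ) (M := F) (M₂ := F)) (q y) := by
        rw [hqy]
        exact contDiffAt_map_inverse _
      exact h.differentiableAt_infty.comp y hqd
    have hinv : ∀ᶠ z in nhds y, ∀ w, q z ((q z).inverse w) = w := by
      have h := ContinuousLinearEquiv.nhds (ContinuousLinearEquiv.refl ℝ F)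
      rw [← hqy] at h
      filter_upwards [hqd.continuousAt h] with z hz w
      obtain ⟨e, he⟩ := hz
      rw [← he, ContinuousLinearMap.inverse_equiv]
      exact e.apply_symm_apply w
    let l : E → F →L[ℝ] ℝ := fun z => (g z (X z) ∘L s) ∘L (q z).inverse
    have hl : DifferentiableAt ℝ l y :=
      ((hgd.clm_apply hX).clm_comp (differentiableAt_const s)).clm_comp hqi
    intro v hv
    rw [hY.inner_lieBracketAt hg hy (hp y hy) hpY hX hl ?_ v, hv, map_zero]
    filter_upwards [hinv, hg.mem_nhds hy] with z hz hzU v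
    have h0 := hhor z hzU (v - s ((q z).inverse (fderiv ℝ p z v))) (by
      rw [map_sub, sub_eq_zero]
      exact (hz _).symm)
    rw [map_sub, sub_eq_zero] at h0
    exact h0
  -- Extend $u$ to the horizontal field $a$ with $a^\flat=l\circ dp$, $l$ constant, so that
  -- $[Y,a]=0$ at `y`. Differentiating $G(a,X)=-\mu\,g(a,X)$ along $Y$ then puts all brackets on
  -- $X$.
  have hext : ∀ u, (∀ v, fderiv ℝ p y v = 0 → g y u v = 0) →
      einstein g y u Z = -fderiv ℝ μ y (Y y) * g y u (X y) - μ y * g y u Z := by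
    intro u hu
    let l : F →L[ℝ] ℝ := g y u ∘L s
    let a : E → E := fun z => sharp (g z) (l ∘L fderiv ℝ p z)
    have ha : DifferentiableAt ℝ a y := (hg.contDiffAt_sharp hy).differentiableAt_infty.clm_apply
      ((differentiableAt_const l).clm_comp hp2)
    have hag : ∀ z ∈ U, ∀ v, g z (a z) v = l (fderiv ℝ p z v) := fun z hz v => by
      rw [flat_sharp (hg.nondeg z hz)]
      rfl
    have hay : a y = u := by
      refine eq_of_flat_eq (hg.nondeg y hy) fun w => ?_
      rw [hag y hy]
      have h0 := hu (w - s (fderiv ℝ p y w)) (by rw [map_sub, hs, sub_self])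
      rw [map_sub, sub_eq_zero] at h0
      exact h0.symm
    have hbr : lieBracketAt Y a y = 0 := by
      refine hg.nondeg y hy _ fun v => ?_
      rw [hY.inner_lieBracketAt hg hy (hp y hy) hpY ha (differentiableAt_const l)
        (by filter_upwards [hg.mem_nhds hy] with z hz using hag z hz)]
      simp
    have h1 : (fun z => einstein g z (a z) (X z)) =ᶠ[nhds y]
        fun z => -μ z * g z (a z) (X z) := by
      filter_upwards [hg.mem_nhds hy] with z hz
      exact heig z hz _ fun v hv => by rw [hag z hz, hv, map_zero]
    have h2 := congrArg (fun f : E →L[ℝ] ℝ => f (Y y)) h1.fderiv_eq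
    rw [fderiv_of_lie_eq_zero hGd ha hX (hY.lie_einstein hg hy),
      fderiv_fun_mul hμ.fun_neg ((hgd.clm_apply ha).clm_apply hX), add_apply, smul_apply,
      smul_apply, fderiv_of_lie_eq_zero hgd ha hX (hY.lie_metric hg hy), hbr, hay,
      fderiv_fun_neg] at h2
    simp only [map_zero, zero_apply, zero_add, neg_apply, smul_eq_mul] at h2
    rw [h2]
    ring
  have hZX : g y Z (X y) = 0 := by
    have h1 : (fun z => g z (X z) (X z)) =ᶠ[nhds y] fun _ => -1 := by
      filter_upwards [hg.mem_nhds hy] with z hz using hXX z hz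
    have h2 := congrArg (fun f : E →L[ℝ] ℝ => f (Y y)) h1.fderiv_eq
    rw [fderiv_of_lie_eq_zero hgd hX hX (hY.lie_metric hg hy), hg.symm y hy (X y)] at h2
    simp only [fderiv_fun_const, Pi.zero_apply, zero_apply] at h2
    linarith
  -- Test `hext` on $u=X$: since $Z$ is horizontal, $G(Z,X)=-\mu\,g(Z,X)=0$, and only $Y(\mu)$
  -- survives.
  have hμY : fderiv ℝ μ y (Y y) = 0 := by
    have h1 := hext (X y) (hhor y hy)
    rw [hg.einstein_symm hy, heig y hy Z hZhor, hg.symm y hy (X y) Z, hZX, hXX y hy] at h1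
    linarith
  -- With $Y(\mu)=0$, $Z$ is an eigenvector for $-\mu$; simplicity makes it a multiple of $X$, and
  -- orthogonality to $X$ makes it zero.
  obtain ⟨c, hc⟩ := hsimple Z hZhor fun u hu => by
    rw [hext u hu, hμY]
    ring
  rw [hc, map_smul, smul_apply, hXX y hy, smul_eq_mul] at hZX
  rw [hc, show c = 0 by linarith, zero_smul]

end IsKillingOn

end LocalFluid

/-! ### Conservation laws, equations of motion and the source equation in coordinates. -/

section PerfectFluid

variable {E : Type*} [NormedAddCommGroup E] [NormedSpace ℝ E] [FiniteDimensional ℝ E]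

/-- The expression in coordinates of a perfect fluid with apparent field `X`, pressure `P` and
electromagnetic potential `Y`. -/
structure IsPerfectFluidOn (g : E → E →L[ℝ] E →L[ℝ] ℝ) (Y X : E → E)
    (P : E → E →L[ℝ] E →L[ℝ] ℝ) (U : Set E) : Prop where
  metric : IsMetricOn g U
  killing : IsKillingOn g Y U
  contDiffAt : ∀ y ∈ U, ContDiffAt ℝ ∞ X y
  inner_potential : ∀ y ∈ U, g y (Y y) (Y y) = -1
  inner_field : ∀ y ∈ U, g y (X y) (X y) = -1
  inner_field_potential : ∀ y ∈ U, g y (X y) (Y y) = 0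
  energy_ne_zero : ∀ y ∈ U, einstein g y (X y) (X y) ≠ 0
  pressure : ∀ y ∈ U, ∀ u v, P y u v = einstein g y u v - einstein g y
    (-(g y (X y) u • X y) - g y (Y y) u • Y y) (-(g y (X y) v • X y) - g y (Y y) v • Y y)
  perfect : ∀ y ∈ U, ∀ u, P y u (Y y) = 0

namespace IsPerfectFluidOn

variable {g : E → E →L[ℝ] E →L[ℝ] ℝ} {Y X : E → E} {P : E → E →L[ℝ] E →L[ℝ] ℝ} {U : Set E} {y : E}

theorem differentiableAt (h : IsPerfectFluidOn g Y X P U) (hy : y ∈ U) : DifferentiableAt ℝ X y :=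
  (h.contDiffAt y hy).differentiableAt_infty

theorem differentiableAt_einstein (h : IsPerfectFluidOn g Y X P U) (hy : y ∈ U) {a b : E → E}
    (ha : DifferentiableAt ℝ a y) (hb : DifferentiableAt ℝ b y) :
    DifferentiableAt ℝ (fun z => einstein g z (a z) (b z)) y :=
  ((h.metric.contDiffAt_einstein hy).differentiableAt_infty.clm_apply ha).clm_apply hb

theorem differentiableAt_energy (h : IsPerfectFluidOn g Y X P U) (hy : y ∈ U) :
    DifferentiableAt ℝ (fun z => einstein g z (X z) (X z)) y :=
  h.differentiableAt_einstein hy (h.differentiableAt hy) (h.differentiableAt hy)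

theorem differentiableAt_charge (h : IsPerfectFluidOn g Y X P U) (hy : y ∈ U) :
    DifferentiableAt ℝ (fun z => einstein g z (X z) (Y z)) y :=
  h.differentiableAt_einstein hy (h.differentiableAt hy) (h.killing.differentiableAt hy)

theorem differentiableAt_potential (h : IsPerfectFluidOn g Y X P U) (hy : y ∈ U) :
    DifferentiableAt ℝ (fun z => einstein g z (Y z) (Y z)) y :=
  h.differentiableAt_einstein hy (h.killing.differentiableAt hy) (h.killing.differentiableAt hy)

/-- As $pr_TY=Y$, perfectness says $G(u,Y)=G(pr_Tu,Y)$. The minus signs in the expansion of $pr_Tu$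
come from $X$ and $Y$ both having square $-1$. -/
theorem einstein_apply_potential (h : IsPerfectFluidOn g Y X P U) (hy : y ∈ U) (u : E) :
    einstein g y u (Y y) = -einstein g y (X y) (Y y) * g y (X y) u
      - einstein g y (Y y) (Y y) * g y (Y y) u := by
  have h1 := h.perfect y hy u
  rw [h.pressure y hy, h.inner_field_potential y hy, h.inner_potential y hy] at h1
  simp only [map_sub, map_neg, map_smul, sub_apply, neg_apply, smul_apply, smul_eq_mul] at h1
  linarith

theorem fderiv_energy_potential (h : IsPerfectFluidOn g Y X P U) (hy : y ∈ U)
    (hbr : lieBracketAt Y X y = 0) :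
    fderiv ℝ (fun z => einstein g z (X z) (X z)) y (Y y) = 0 := by
  rw [fderiv_of_lie_eq_zero (h.metric.contDiffAt_einstein hy).differentiableAt_infty
    (h.differentiableAt hy) (h.differentiableAt hy) (h.killing.lie_einstein h.metric hy), hbr]
  simp

theorem fderiv_charge_potential (h : IsPerfectFluidOn g Y X P U) (hy : y ∈ U)
    (hbr : lieBracketAt Y X y = 0) :
    fderiv ℝ (fun z => einstein g z (X z) (Y z)) y (Y y) = 0 := by
  rw [fderiv_of_lie_eq_zero (h.metric.contDiffAt_einstein hy).differentiableAt_infty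
    (h.differentiableAt hy) (h.killing.differentiableAt hy)
    (h.killing.lie_einstein h.metric hy), hbr, lieBracketAt_self]
  simp

theorem trace_smul_potential (h : IsPerfectFluidOn g Y X P U) (hy : y ∈ U) {f : E → ℝ}
    (hf : DifferentiableAt ℝ f y) (hfY : fderiv ℝ f y (Y y) = 0) :
    traceL E (covDerivVec g (fun z => f z • Y z) y) = 0 := by
  rw [trace_covDerivVec_smul g hf (h.killing.differentiableAt hy), hfY,
    h.killing.trace_covDerivVec h.metric hy]
  simp

theorem fderiv_einstein_potential (h : IsPerfectFluidOn g Y X P U) (hy : y ∈ U) :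
    fderiv ℝ (fun z => einstein g z (Y z) (Y z)) y (Y y) = 0 := by
  rw [fderiv_of_lie_eq_zero (h.metric.contDiffAt_einstein hy).differentiableAt_infty
    (h.killing.differentiableAt hy) (h.killing.differentiableAt hy)
    (h.killing.lie_einstein h.metric hy), lieBracketAt_self]
  simp

/-- Conservation of charge for the apparent field. -/
theorem trace_charge_smul_field (h : IsPerfectFluidOn g Y X P U) (hy : y ∈ U) :
    traceL E (covDerivVec g (fun z => einstein g z (X z) (Y z) • X z) y) = 0 := by
  have hXd := h.differentiableAt hy
  have hYd := h.killing.differentiableAt hy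
  have he := h.differentiableAt_charge hy
  have hk := h.differentiableAt_potential hy
  -- The chosen `V` is ${}^eG(Y)$; once its divergence is known to vanish, its $Y$-component is
  -- discarded because $Y$ annihilates $G(Y,Y)$ and has divergence zero.
  have h1 := h.killing.trace_covDerivVec_of_divForm_eq_zero h.metric hy
    (T := einstein g) (V := fun z => (-1 : ℝ) • (einstein g z (X z) (Y z) • X z
      + einstein g z (Y z) (Y z) • Y z))
    (h.metric.contDiffAt_einstein hy).differentiableAt_infty (h.metric.einstein_symm hy)
    (h.metric.divForm_einstein hy _)
    (((he.fun_smul hXd).fun_add (hk.fun_smul hYd)).fun_const_smul _) (fun z hz u => by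
      rw [h.einstein_apply_potential hz]
      simp only [map_smul, map_add, smul_apply, add_apply, smul_eq_mul]
      ring)
  rw [trace_covDerivVec_smul g (differentiableAt_const _)
    ((he.fun_smul hXd).fun_add (hk.fun_smul hYd)),
    trace_covDerivVec_add g (he.fun_smul hXd) (hk.fun_smul hYd),
    h.trace_smul_potential hy hk (h.fderiv_einstein_potential hy)] at h1
  simpa using h1

/-- Torsion-freeness: $\nabla_YX-\nabla_XY=[Y,X]$. -/
theorem covDerivVec_potential_field (h : IsPerfectFluidOn g Y X P U) (hy : y ∈ U)
    (hbr : lieBracketAt Y X y = 0) :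
    covDerivVec g X y (Y y) = covDerivVec g Y y (X y) := by
  rw [covDerivVec_apply, covDerivVec_apply, h.metric.christoffel_symm hy,
    sub_eq_zero.1 (show fderiv ℝ X y (Y y) - fderiv ℝ Y y (X y) = 0 from hbr)]

theorem inner_covDerivVec_field_potential (h : IsPerfectFluidOn g Y X P U) (hy : y ∈ U) :
    g y (covDerivVec g Y y (X y)) (X y) = 0 := by
  linarith [h.killing.inner_add y hy (X y) (X y)]

/-- The divergence of the pressure. -/
theorem divForm_pressure (h : IsPerfectFluidOn g Y X P U) (hy : y ∈ U)
    (hbr : lieBracketAt Y X y = 0) (w : E) :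
    divForm g P y w =
      -(traceL E (covDerivVec g (fun z => einstein g z (X z) (X z) • X z) y) * g y (X y) w
        + einstein g y (X y) (X y) * g y (covDerivVec g X y (X y)) w
        + 2 * einstein g y (X y) (Y y) * g y (covDerivVec g Y y (X y)) w) := by
  have hg := h.metric
  have hXd := h.differentiableAt hy
  have hYd := h.killing.differentiableAt hy
  have hm := h.differentiableAt_energy hy
  have he := h.differentiableAt_charge hy
  have hk := h.differentiableAt_potential hy
  have hG := (hg.contDiffAt_einstein hy).differentiableAt_infty
  -- The scalar coefficients sit in the first factor, so that $\nabla\cdot(fa\otimes b)=(\nabla\cdot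
  -- fa)\,b+f\nabla_ab$. The fields $eX$, $eY$ and $G(Y,Y)Y$ have divergence zero, the mixed terms
  -- give $e\nabla_XY$ twice, and $\nabla_YY=0$.
  let T₁ := flatTensor g (fun z => einstein g z (X z) (X z) • X z) X
  let T₂ := flatTensor g (fun z => einstein g z (X z) (Y z) • X z) Y
  let T₃ := flatTensor g (fun z => einstein g z (X z) (Y z) • Y z) X
  let T₄ := flatTensor g (fun z => einstein g z (Y z) (Y z) • Y z) Y
  have d1 : DifferentiableAt ℝ T₁ y := hg.differentiableAt_flatTensor hy (hm.fun_smul hXd) hXd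
  have d2 : DifferentiableAt ℝ T₂ y := hg.differentiableAt_flatTensor hy (he.fun_smul hXd) hYd
  have d3 : DifferentiableAt ℝ T₃ y := hg.differentiableAt_flatTensor hy (he.fun_smul hYd) hXd
  have d4 : DifferentiableAt ℝ T₄ y := hg.differentiableAt_flatTensor hy (hk.fun_smul hYd) hYd
  have d12 := d1.fun_add d2
  have d123 := d12.fun_add d3
  have d := d123.fun_add d4
  have hP : P =ᶠ[nhds y] fun z => einstein g z + (-1 : ℝ) • (T₁ z + T₂ z + T₃ z + T₄ z) := by
    filter_upwards [hg.mem_nhds hy] with z hz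
    ext u v
    rw [h.pressure z hz]
    simp only [T₁, T₂, T₃, T₄, flatTensor_apply, map_sub, map_neg, map_smul, sub_apply, neg_apply,
      smul_apply, add_apply, smul_eq_mul, hg.einstein_symm hz (Y z) (X z)]
    ring
  rw [divForm_congr g hP, hg.divForm_add hy hG (d.fun_const_smul _),
    hg.divForm_smul hy (differentiableAt_const _) d, hg.divForm_add hy d123 d4,
    hg.divForm_add hy d12 d3, hg.divForm_add hy d1 d2, hg.divForm_einstein hy,
    hg.divForm_flatTensor hy (hm.fun_smul hXd) hXd, hg.divForm_flatTensor hy (he.fun_smul hXd) hYd,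
    hg.divForm_flatTensor hy (he.fun_smul hYd) hXd, hg.divForm_flatTensor hy (hk.fun_smul hYd) hYd,
    h.trace_charge_smul_field hy, h.trace_smul_potential hy he (h.fderiv_charge_potential hy hbr),
    h.trace_smul_potential hy hk (h.fderiv_einstein_potential hy)]
  simp only [fderiv_fun_const, Pi.zero_apply, map_zero, zero_apply, map_smul, smul_apply,
    smul_eq_mul, h.covDerivVec_potential_field hy hbr,
    h.killing.covDerivVec_self hg h.inner_potential hy]
  ring

/-- Conservation of energy for the apparent field. -/
theorem trace_energy_smul_field (h : IsPerfectFluidOn g Y X P U) (hy : y ∈ U)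
    (hbr : lieBracketAt Y X y = 0) :
    traceL E (covDerivVec g (fun z => einstein g z (X z) (X z) • X z) y) =
      divForm g P y (X y) := by
  rw [h.divForm_pressure hy hbr, h.inner_field y hy,
    h.metric.inner_covDerivVec_self h.inner_field hy (h.differentiableAt hy),
    h.inner_covDerivVec_field_potential hy]
  ring

/-- The motion of the apparent fluid. -/
theorem energy_smul_covDerivVec_field (h : IsPerfectFluidOn g Y X P U) (hy : y ∈ U)
    (hbr : lieBracketAt Y X y = 0) :
    einstein g y (X y) (X y) • covDerivVec g X y (X y) =
      einstein g y (X y) (Y y) • ((-2 : ℝ) • covDerivVec g Y y (X y))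
        - sharp (g y) (divForm g P y) - divForm g P y (X y) • X y := by
  refine eq_of_flat_eq (h.metric.nondeg y hy) fun w => ?_
  have h1 := h.divForm_pressure hy hbr w
  rw [h.trace_energy_smul_field hy hbr] at h1
  simp only [map_sub, map_smul, sub_apply, smul_apply, smul_eq_mul,
    flat_sharp (h.metric.nondeg y hy), h1]
  ring

theorem differentiableAt_ratio (h : IsPerfectFluidOn g Y X P U) (hy : y ∈ U) :
    DifferentiableAt ℝ (fun z => einstein g z (X z) (Y z) / einstein g z (X z) (X z)) y := by
  simp only [div_eq_mul_inv]
  exact (h.differentiableAt_charge hy).fun_mul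
    ((h.differentiableAt_energy hy).fun_inv (h.energy_ne_zero y hy))

theorem fderiv_ratio_potential (h : IsPerfectFluidOn g Y X P U) (hy : y ∈ U)
    (hbr : lieBracketAt Y X y = 0) :
    fderiv ℝ (fun z => einstein g z (X z) (Y z) / einstein g z (X z) (X z)) y (Y y) = 0 := by
  -- Differentiating $e=(e/\mu)\mu$ along $Y$ takes the place of the quotient rule.
  have h1 : (fun z => einstein g z (X z) (Y z)) =ᶠ[nhds y]
      fun z => (einstein g z (X z) (Y z) / einstein g z (X z) (X z)) *
        einstein g z (X z) (X z) := by
    filter_upwards [h.metric.mem_nhds hy] with z hz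
    rw [div_mul_cancel₀ _ (h.energy_ne_zero z hz)]
  have h2 := h.fderiv_charge_potential hy hbr
  rw [h1.fderiv_eq, fderiv_fun_mul (h.differentiableAt_ratio hy) (h.differentiableAt_energy hy),
    add_apply, smul_apply, smul_apply, h.fderiv_energy_potential hy hbr, smul_zero, zero_add,
    smul_eq_mul] at h2
  exact (mul_eq_zero.1 h2).resolve_left (h.energy_ne_zero y hy)

/-- The evolution of the charge to energy ratio. -/
theorem energy_mul_fderiv_ratio (h : IsPerfectFluidOn g Y X P U) (hy : y ∈ U)
    (hbr : lieBracketAt Y X y = 0) :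
    einstein g y (X y) (X y) *
      fderiv ℝ (fun z => einstein g z (X z) (Y z) / einstein g z (X z) (X z)) y (X y) =
      -(einstein g y (X y) (Y y) / einstein g y (X y) (X y)) * divForm g P y (X y) := by
  have hm := h.differentiableAt_energy hy
  have hXd := h.differentiableAt hy
  -- Writing $eX=(e/\mu)(\mu X)$ makes the product rule for the divergence link the two conservation
  -- laws.
  have h1 : (fun z => einstein g z (X z) (Y z) • X z) =ᶠ[nhds y]
      fun z => (einstein g z (X z) (Y z) / einstein g z (X z) (X z)) •
        (einstein g z (X z) (X z) • X z) := by
    filter_upwards [h.metric.mem_nhds hy] with z hz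
    rw [smul_smul, div_mul_cancel₀ _ (h.energy_ne_zero z hz)]
  have h2 := h.trace_charge_smul_field hy
  rw [covDerivVec_congr g h1, trace_covDerivVec_smul g (h.differentiableAt_ratio hy)
    (hm.fun_smul hXd), h.trace_energy_smul_field hy hbr, map_smul, smul_eq_mul] at h2
  linarith

/-- The difference $f(e/\mu)Y$ has divergence zero, since $Y$ annihilates $f$ and $e/\mu$ and has
divergence zero. Thus the fluid and the apparent fluid obey the same conservation laws. -/
theorem trace_smul_fluid (h : IsPerfectFluidOn g Y X P U) (hy : y ∈ U) {f : E → ℝ}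
    (hbr : lieBracketAt Y X y = 0) (hf : DifferentiableAt ℝ f y) (hfY : fderiv ℝ f y (Y y) = 0) :
    traceL E (covDerivVec g (fun z => f z • (X z +
      (einstein g z (X z) (Y z) / einstein g z (X z) (X z)) • Y z)) y) =
      traceL E (covDerivVec g (fun z => f z • X z) y) := by
  have hφ := h.differentiableAt_ratio hy
  simp only [smul_add, smul_smul]
  rw [trace_covDerivVec_add g (hf.fun_smul (h.differentiableAt hy))
    ((hf.fun_mul hφ).fun_smul (h.killing.differentiableAt hy)),
    h.trace_smul_potential hy (hf.fun_mul hφ), add_zero]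
  rw [fderiv_fun_mul hf hφ]
  simp [hfY, h.fderiv_ratio_potential hy hbr]

/-- The motion of the fluid. -/
theorem energy_smul_covDerivVec_fluid (h : IsPerfectFluidOn g Y X P U) (hy : y ∈ U)
    (hbr : lieBracketAt Y X y = 0) :
    einstein g y (X y) (X y) • covDerivVec g (fun z => X z +
        (einstein g z (X z) (Y z) / einstein g z (X z) (X z)) • Y z) y
        (X y + (einstein g y (X y) (Y y) / einstein g y (X y) (X y)) • Y y) =
      -sharp (g y) (divForm g P y) - divForm g P y (X y) • (X y +
        (einstein g y (X y) (Y y) / einstein g y (X y) (X y)) • Y y) := by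
  have hφ := h.differentiableAt_ratio hy
  have hXd := h.differentiableAt hy
  have hYd := h.killing.differentiableAt hy
  have hm := h.energy_ne_zero y hy
  have h1 := h.energy_mul_fderiv_ratio hy hbr
  have h2 : einstein g y (X y) (X y) *
      (einstein g y (X y) (Y y) / einstein g y (X y) (X y)) = einstein g y (X y) (Y y) :=
    mul_div_cancel₀ _ hm
  rw [covDerivVec_add g hXd (hφ.fun_smul hYd), covDerivVec_smul g hφ hYd]
  -- The two cross terms give $2e\nabla_XY$, cancelling the force on the apparent fluid; the
  -- derivative of $e/\mu$ along $X$ supplies the $Y$-component on the right.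
  simp only [map_add, map_smul, h.covDerivVec_potential_field hy hbr,
    h.fderiv_ratio_potential hy hbr, h.killing.covDerivVec_self h.metric h.inner_potential hy,
    smul_zero, add_zero, smul_add, smul_smul, h.energy_smul_covDerivVec_field hy hbr, h1, h2]
  module

/-- The divergence of the electromagnetic field. -/
theorem sharp_divForm_two_covDeriv (h : IsPerfectFluidOn g Y X P U) (hy : y ∈ U)
    {F : E → E →L[ℝ] E →L[ℝ] ℝ} (hF : DifferentiableAt ℝ F y)
    (hFY : ∀ z ∈ U, ∀ u v, F z u v = 2 * g z (covDerivVec g Y z u) v) :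
    sharp (g y) (divForm g F y) =
      einstein g y (X y) (Y y) • X y + (1 / 2 * normG (g y) (F y)) • Y y := by
  have hg := h.metric
  have hanti : ∀ u v, F y u v = -F y v u := fun u v => by
    rw [hFY y hy, hFY y hy]
    linarith [h.killing.inner_add y hy u v]
  have hnorm := normG_eq_of_antisymm (hg.nondeg y hy) (hFY y hy) hanti
  have hric := h.killing.ricci_self hg h.inner_potential hy
  refine eq_of_flat_eq (hg.nondeg y hy) fun w => ?_
  have h1 := h.einstein_apply_potential hy w
  have h2 : einstein g y w (Y y) = 2 * ricci g y (Y y) w - scalarCurvature g y * g y (Y y) w := by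
    rw [hg.einstein_symm hy]
    rfl
  -- Since $g(Y,Y)=-1$, $S$ enters with a plus sign; it cancels in the coefficient $G(Y,Y)-S$ of
  -- $Y$, leaving $2\,\mathrm{Ric}(Y,Y)$.
  have h3 : einstein g y (Y y) (Y y) = 2 * ricci g y (Y y) (Y y) + scalarCurvature g y := by
    change 2 * ricci g y (Y y) (Y y) - scalarCurvature g y * g y (Y y) (Y y) = _
    rw [h.inner_potential y hy]
    ring
  rw [flat_sharp (hg.nondeg y hy), h.killing.divForm_two_covDeriv hg hy hF hFY, hnorm]
  simp only [map_add, map_smul, add_apply, smul_apply, smul_eq_mul]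
  rw [h2, h3, hric] at h1
  linarith

end IsPerfectFluidOn

end PerfectFluid

/-- By rank–nullity the pair $(A,B)$ is already onto the product, as its kernel has dimension at
most one. -/
theorem surjective_of_finrank_ker_inf_ker_le {E F F' : Type*} [AddCommGroup E] [Module ℝ E]
    [AddCommGroup F] [Module ℝ F] [AddCommGroup F'] [Module ℝ F'] [FiniteDimensional ℝ E]
    [FiniteDimensional ℝ F] [FiniteDimensional ℝ F'] (A : E →ₗ[ℝ] F) (B : E →ₗ[ℝ] F')
    (h : Module.finrank ℝ (LinearMap.ker A ⊓ LinearMap.ker B : Submodule ℝ E) ≤ 1)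
    (hE : Module.finrank ℝ E = Module.finrank ℝ F + Module.finrank ℝ F' + 1) :
    Function.Surjective A := by
  rw [← LinearMap.ker_prod] at h
  have h1 := LinearMap.finrank_range_add_finrank_ker (A.prod B)
  have h2 : LinearMap.range (A.prod B) = ⊤ := by
    apply Submodule.eq_top_of_finrank_eq
    have h3 := Submodule.finrank_le (LinearMap.range (A.prod B))
    rw [Module.finrank_prod] at h3 ⊢
    omega
  intro w
  obtain ⟨u, hu⟩ := LinearMap.range_eq_top.1 h2 (w, 0)
  exact ⟨u, congrArg Prod.fst hu⟩

/-! ### Maps between manifolds and functions read in charts. -/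

section ChartMaps

variable {E : Type*} [NormedAddCommGroup E] [NormedSpace ℝ E]
  {M : Type*} [TopologicalSpace M] [ChartedSpace E M] [IsManifold 𝓘(ℝ, E) ∞ M]
  {F : Type*} [NormedAddCommGroup F] [NormedSpace ℝ F]
  {N : Type*} [TopologicalSpace N] [ChartedSpace F N] [IsManifold 𝓘(ℝ, F) ∞ N]

theorem contMDiffAt_param {x : M} {y : E} (hy : y ∈ chartDomain E x) :
    ContMDiffAt 𝓘(ℝ, E) 𝓘(ℝ, E) ∞ (param (E := E) x) y :=
  (contMDiffOn_extChartAt_symm x).contMDiffAt ((isOpen_chartDomain x).mem_nhds hy)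

theorem contMDiffAt_coord {x z : M} (hz : z ∈ (chartAt E x).source) :
    ContMDiffAt 𝓘(ℝ, E) 𝓘(ℝ, E) ∞ (coord (E := E) x) z :=
  contMDiffOn_extChartAt.contMDiffAt ((chartAt E x).open_source.mem_nhds hz)

theorem contDiffAt_coord_comp_param {f : M → N} (hf : ContMDiff 𝓘(ℝ, E) 𝓘(ℝ, F) ∞ f) {x : M}
    {b : N} {y : E} (hy : y ∈ chartDomain E x) (hz : f (param x y) ∈ (chartAt F b).source) :
    ContDiffAt ℝ ∞ (fun z => coord (E := F) b (f (param x z))) y := by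
  rw [← contMDiffAt_iff_contDiffAt]
  exact ((contMDiffAt_coord hz).comp (param x y) (hf (param x y))).comp y (contMDiffAt_param hy)

theorem fderiv_coord_comp_param {f : M → N} (hf : ContMDiff 𝓘(ℝ, E) 𝓘(ℝ, F) ∞ f) {x : M}
    {b : N} {y : E} (hy : y ∈ chartDomain E x) (hz : f (param x y) ∈ (chartAt F b).source) (v : E) :
    fderiv ℝ (fun z => coord (E := F) b (f (param x z))) y v =
      mfderiv 𝓘(ℝ, F) 𝓘(ℝ, F) (coord (E := F) b) (f (param x y))
        (mfderiv 𝓘(ℝ, E) 𝓘(ℝ, F) f (param x y) (dparam x y v)) := by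
  have h1 : MDifferentiableAt 𝓘(ℝ, F) 𝓘(ℝ, F) (coord (E := F) b) (f (param x y)) :=
    (contMDiffAt_coord hz).mdifferentiableAt (by simp)
  have h2 : MDifferentiableAt 𝓘(ℝ, E) 𝓘(ℝ, F) f (param x y) :=
    (hf (param x y)).mdifferentiableAt (by simp)
  have h3 := mdifferentiableAt_param (x := x) hy
  rw [← mfderiv_eq_fderiv]
  have h4 := mfderiv_comp y (h1.comp (param x y) h2) h3
  rw [mfderiv_comp (param x y) h1 h2] at h4
  exact congrArg (fun A : E →L[ℝ] F => A v) h4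

theorem mfderiv_coord_bijective {b z : N} (hz : z ∈ (chartAt F b).source) :
    Function.Bijective (mfderiv 𝓘(ℝ, F) 𝓘(ℝ, F) (coord (E := F) b) z) := by
  obtain ⟨e, he⟩ := isInvertible_mfderiv_extChartAt (I := 𝓘(ℝ, F)) (x := b) (y := z)
    (by rwa [extChartAt_source])
  change Function.Bijective (mfderiv 𝓘(ℝ, F) 𝓘(ℝ, F) (extChartAt 𝓘(ℝ, F) b) z)
  rw [← he]
  exact e.bijective

theorem fderiv_coord_comp_param_eq_zero_iff {f : M → N} (hf : ContMDiff 𝓘(ℝ, E) 𝓘(ℝ, F) ∞ f)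
    {x : M} {b : N} {y : E} (hy : y ∈ chartDomain E x)
    (hz : f (param x y) ∈ (chartAt F b).source) (v : E) :
    fderiv ℝ (fun z => coord (E := F) b (f (param x z))) y v = 0 ↔
      mfderiv 𝓘(ℝ, E) 𝓘(ℝ, F) f (param x y) (dparam x y v) = 0 := by
  rw [fderiv_coord_comp_param hf hy hz]
  exact map_eq_zero_iff _ (mfderiv_coord_bijective hz).1

theorem contMDiffAt_of_contDiffAt_param {f : M → ℝ} {x : M}
    (h : ContDiffAt ℝ ∞ (fun y => f (param (E := E) x y)) (coord x x)) :
    ContMDiffAt 𝓘(ℝ, E) 𝓘(ℝ, ℝ) ∞ f x := by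
  have h1 := (contMDiffAt_iff_contDiffAt.2 h).comp x (contMDiffAt_coord (mem_chart_source E x))
  refine h1.congr_of_eventuallyEq ?_
  filter_upwards [(chartAt E x).open_source.mem_nhds (mem_chart_source E x)] with z hz
  rw [Function.comp_apply, param_coord hz]

theorem dirDeriv_eq_fderiv {f : M → ℝ} {x : M} (V : VecField E M)
    (h : DifferentiableAt ℝ (fun y => f (param (E := E) x y)) (coord x x)) :
    dirDeriv V f x = fderiv ℝ (fun y => f (param (E := E) x y)) (coord x x) (V x) := by
  have h1 : f =ᶠ[nhds x] (fun y => f (param (E := E) x y)) ∘ coord (E := E) x := by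
    filter_upwards [(chartAt E x).open_source.mem_nhds (mem_chart_source E x)] with z hz
    rw [Function.comp_apply, param_coord hz]
  have h2 : MDifferentiableAt 𝓘(ℝ, E) 𝓘(ℝ, ℝ) f x :=
    (h.mdifferentiableAt.comp x ((contMDiffAt_coord (mem_chart_source E x)).mdifferentiableAt
      (by simp))).congr_of_eventuallyEq h1
  change (mfderiv 𝓘(ℝ, E) 𝓘(ℝ, ℝ) f x : E →L[ℝ] ℝ) (V x) = _
  rw [h2.mfderiv, ← fderivWithin_univ]
  simp only [mfld_simps]
  rfl

end ChartMaps

/-! ### Orthogonal projections, in particular onto a plane spanned by two orthogonal vectors of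
square $-1$. -/

namespace SemiRiemannianMetric

variable {E : Type*} [NormedAddCommGroup E] [NormedSpace ℝ E]
  {M : Type*} [TopologicalSpace M] [ChartedSpace E M] [IsManifold 𝓘(ℝ, E) ∞ M]
  (g : SemiRiemannianMetric E M) {x : M} {V : Submodule ℝ (TangentSpace 𝓘(ℝ, E) x)}

theorem orthProj_add (h : IsCompl V (g.perp x V)) {a b : TangentSpace 𝓘(ℝ, E) x} (ha : a ∈ V)
    (hb : b ∈ g.perp x V) : (g.orthProj x V (a + b) : TangentSpace 𝓘(ℝ, E) x) = a := by
  rw [orthProj, dif_pos h, map_add, Submodule.projectionOnto_apply_of_mem_left h ha,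
    Submodule.projectionOnto_apply_of_mem_right h hb, add_zero]

theorem inner_orthProj (h : IsCompl V (g.perp x V)) (w : TangentSpace 𝓘(ℝ, E) x)
    {u : TangentSpace 𝓘(ℝ, E) x} (hu : u ∈ V) :
    g.val x (g.orthProj x V w : TangentSpace 𝓘(ℝ, E) x) u = g.val x w u := by
  obtain ⟨a, ha, b, hb, rfl⟩ := Submodule.mem_sup.1
    (show w ∈ V ⊔ g.perp x V by rw [h.sup_eq_top]; trivial)
  rw [g.orthProj_add h ha hb, map_add]
  have h0 : g.val x b u = 0 := hb u hu
  simp [h0]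

theorem inner_endoField [FiniteDimensional ℝ E] (T : BilinField E M) (u v : TangentSpace 𝓘(ℝ, E) x) :
    g.val x (g.endoField T x v) u = T x u v :=
  endo_left (E := E) (B := g.val x) (g.nondegenerate x) (T x) u v

theorem sub_mem_perp_span_pair {a b : TangentSpace 𝓘(ℝ, E) x} (haa : g.val x a a = -1)
    (hbb : g.val x b b = -1) (hab : g.val x a b = 0) (u : TangentSpace 𝓘(ℝ, E) x) :
    u - (-(g.val x a u • a) - g.val x b u • b) ∈ g.perp x (Submodule.span ℝ {a, b}) := by
  have hba : g.val x b a = 0 := by rw [g.symm, hab]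
  intro v hv
  obtain ⟨s, t, rfl⟩ := Submodule.mem_span_pair.1 hv
  simp [haa, hbb, hab, hba, g.symm x u]
  ring

theorem isCompl_span_pair {a b : TangentSpace 𝓘(ℝ, E) x} (haa : g.val x a a = -1)
    (hbb : g.val x b b = -1) (hab : g.val x a b = 0) :
    IsCompl (Submodule.span ℝ {a, b}) (g.perp x (Submodule.span ℝ {a, b})) := by
  have hba : g.val x b a = 0 := by rw [g.symm, hab]
  constructor
  · rw [Submodule.disjoint_def]
    intro u hu hu'
    obtain ⟨s, t, rfl⟩ := Submodule.mem_span_pair.1 hu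
    have h1 : g.val x (s • a + t • b) a = 0 := hu' a (Submodule.subset_span (by simp))
    have h2 : g.val x (s • a + t • b) b = 0 := hu' b (Submodule.subset_span (by simp))
    simp [haa, hbb, hab, hba] at h1 h2
    simp [h1, h2]
  · rw [codisjoint_iff, eq_top_iff]
    intro u _
    refine Submodule.mem_sup.2 ⟨-(g.val x a u • a) - g.val x b u • b, ?_,
      u - (-(g.val x a u • a) - g.val x b u • b), g.sub_mem_perp_span_pair haa hbb hab u, by abel⟩
    exact Submodule.mem_span_pair.2 ⟨-g.val x a u, -g.val x b u, by module⟩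

theorem orthProj_span_pair {a b : TangentSpace 𝓘(ℝ, E) x} (haa : g.val x a a = -1)
    (hbb : g.val x b b = -1) (hab : g.val x a b = 0) (u : TangentSpace 𝓘(ℝ, E) x) :
    (g.orthProj x (Submodule.span ℝ {a, b}) u : TangentSpace 𝓘(ℝ, E) x) =
      -(g.val x a u • a) - g.val x b u • b := by
  conv_lhs => rw [show u = (-(g.val x a u • a) - g.val x b u • b)
    + (u - (-(g.val x a u • a) - g.val x b u • b)) by abel]
  exact g.orthProj_add (g.isCompl_span_pair haa hbb hab)
    (Submodule.mem_span_pair.2 ⟨-g.val x a u, -g.val x b u, by module⟩)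
    (g.sub_mem_perp_span_pair haa hbb hab u)

end SemiRiemannianMetric

/-! ### Pointwise geometry of the horizontal spaces and of the apparent field. -/

namespace Spacetime

variable {m : ℕ}
  {M : Type*} [TopologicalSpace M] [ChartedSpace (R (5 + m)) M] [IsManifold (𝓡 (5 + m)) ∞ M]
  {B : Type*} [TopologicalSpace B] [ChartedSpace (R 4) B] [IsManifold (𝓡 4) ∞ B]
  {W : Type*} [TopologicalSpace W] [ChartedSpace (R m) W] [IsManifold (𝓡 m) ∞ W]
  (S : Spacetime m M B W)

/-- A dimension count: the signature condition on the circles bounds the dimension of $\ker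
d\pi\cap\ker df$ by one, and $5+m=4+m+1$. -/
theorem mfderiv_proj_surjective (x : M) :
    Function.Surjective (mfderiv (𝓡 (5 + m)) (𝓡 4) S.proj x) := by
  obtain ⟨N, P, hNP, hN, hP, -⟩ := S.signature_circle x
  let A : R (5 + m) →L[ℝ] R 4 := mfderiv (𝓡 (5 + m)) (𝓡 4) S.proj x
  let C : R (5 + m) →L[ℝ] R m := mfderiv (𝓡 (5 + m)) (𝓡 m) S.toW x
  have h : Function.Surjective A.toLinearMap := by
    refine surjective_of_finrank_ker_inf_ker_le A.toLinearMap C.toLinearMap ?_ ?_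
    · let N' : Submodule ℝ (R (5 + m)) := N
      let P' : Submodule ℝ (R (5 + m)) := P
      have h1 : LinearMap.ker A.toLinearMap ⊓ LinearMap.ker C.toLinearMap = N' ⊔ P' := hNP.symm
      have h2 := Submodule.finrank_add_le_finrank_add_finrank N' P'
      have hN' : Module.finrank ℝ N' = 1 := hN
      have hP' : Module.finrank ℝ P' = 0 := hP
      rw [h1]
      omega
    · simp only [finrank_euclideanSpace, Fintype.card_fin]
      omega
  exact h

variable {S} {x : M} {μ : ℝ}

/-- Otherwise `orthProj` takes its default value zero, so ${}^eG_H=0$ would have no eigenvector for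
the nonzero eigenvalue $-\mu$. No signature argument is needed. -/
theorem isCompl_horizontal (h : S.IsEnergyDensityAt x μ) :
    IsCompl (S.horizontal x) (S.metric.perp x (S.horizontal x)) := by
  by_contra hc
  obtain ⟨hμ, hrank, -⟩ := h
  have h0 : S.endoH x = 0 := by
    rw [endoH, SemiRiemannianMetric.orthProj, dif_neg hc, LinearMap.zero_comp]
  have h1 : (S.endoH x).eigenspace (-μ) = ⊥ := by
    rw [eq_bot_iff]
    intro u hu
    rw [Module.End.mem_eigenspace_iff, h0, LinearMap.zero_apply] at hu
    exact (smul_eq_zero.1 hu.symm).resolve_left (by linarith)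
  rw [h1, finrank_bot] at hrank
  exact zero_ne_one hrank

/-- Removes the projection from the eigenvalue equation: a horizontal vector is determined by its
products with horizontal vectors, because $H_x$ meets its orthogonal trivially. -/
theorem endoH_eq_smul_iff (hc : IsCompl (S.horizontal x) (S.metric.perp x (S.horizontal x)))
    (v : S.horizontal x) (c : ℝ) :
    S.endoH x v = c • v ↔ ∀ u ∈ S.horizontal x, S.G x u v = c * S.metric.val x u v := by
  have key : ∀ u ∈ S.horizontal x, S.metric.val x (S.endoH x v) u = S.G x u v := by
    intro u hu
    rw [← S.metric.inner_endoField S.G u v]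
    exact S.metric.inner_orthProj hc _ hu
  constructor
  · intro h u hu
    rw [← key u hu, h, S.metric.symm x u]
    simp
  · intro h
    have h1 : ((S.endoH x v - c • v : S.horizontal x) : TangentSpace (𝓡 (5 + m)) x) ∈
        S.metric.perp x (S.horizontal x) := by
      intro u hu
      have h2 := h u hu
      rw [← key u hu, S.metric.symm x u] at h2
      simp [h2]
    have h3 := (Submodule.disjoint_def.1 hc.disjoint) _ (S.endoH x v - c • v).2 h1
    exact sub_eq_zero.1 (Subtype.ext h3)

theorem potential_mem_perp {Y : VecField (R (5 + m)) M} (hY : S.IsPotential Y) (x : M)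
    {u : TangentSpace (𝓡 (5 + m)) x} (hu : u ∈ S.horizontal x) : S.metric.val x u (Y x) = 0 :=
  hu (Y x) (hY.tangent x).1

section

variable {D : Set M} {μ : M → ℝ} {X₀ Y : VecField (R (5 + m)) M}

theorem IsApparentField.mem_horizontal (hX₀ : S.IsApparentField D μ X₀) {x : M} (hx : x ∈ D) :
    X₀ x ∈ S.horizontal x := by
  obtain ⟨u, -, hu⟩ := hX₀.eigenvector x hx
  rw [← hu]
  exact u.2

theorem IsApparentField.apply_eq (hX₀ : S.IsApparentField D μ X₀) (hμ : S.IsEnergyDensity D μ)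
    {x : M} (hx : x ∈ D) {u : TangentSpace (𝓡 (5 + m)) x} (hu : u ∈ S.horizontal x) :
    S.G x u (X₀ x) = -μ x * S.metric.val x u (X₀ x) := by
  obtain ⟨v, hv, hvX⟩ := hX₀.eigenvector x hx
  rw [← hvX]
  exact (endoH_eq_smul_iff (isCompl_horizontal (hμ x hx)) v (-μ x)).1
    (Module.End.mem_eigenspace_iff.1 hv) u hu

/-- This makes $\mu$ a smooth expression in $g$ and $X_0$, although it is given only pointwise as an
eigenvalue. -/
theorem IsApparentField.energy_eq (hX₀ : S.IsApparentField D μ X₀) (hμ : S.IsEnergyDensity D μ)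
    {x : M} (hx : x ∈ D) : S.G x (X₀ x) (X₀ x) = μ x := by
  rw [hX₀.apply_eq hμ hx (hX₀.mem_horizontal hx), hX₀.unit x hx]
  ring

theorem IsApparentField.eq_smul (hX₀ : S.IsApparentField D μ X₀) (hμ : S.IsEnergyDensity D μ)
    {x : M} (hx : x ∈ D) {w : TangentSpace (𝓡 (5 + m)) x} (hw : w ∈ S.horizontal x)
    (h : ∀ u ∈ S.horizontal x, S.G x u w = -μ x * S.metric.val x u w) :
    ∃ c : ℝ, w = c • X₀ x := by
  obtain ⟨v, hv, hvX⟩ := hX₀.eigenvector x hx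
  have hw' : (⟨w, hw⟩ : S.horizontal x) ∈ (S.endoH x).eigenspace (-μ x) :=
    Module.End.mem_eigenspace_iff.2
      ((endoH_eq_smul_iff (isCompl_horizontal (hμ x hx)) ⟨w, hw⟩ (-μ x)).2 h)
  have hv0 : (⟨v, hv⟩ : (S.endoH x).eigenspace (-μ x)) ≠ 0 := by
    intro h0
    have h1 : v = 0 := congrArg Subtype.val h0
    have h2 := hX₀.unit x hx
    rw [← hvX, h1] at h2
    simp at h2
  obtain ⟨c, hc⟩ := (finrank_eq_one_iff_of_nonzero' _ hv0).1 (hμ x hx).2.1 ⟨⟨w, hw⟩, hw'⟩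
  refine ⟨c, ?_⟩
  rw [← hvX]
  exact (congrArg (fun z : (S.endoH x).eigenspace (-μ x) =>
    ((z : S.horizontal x) : TangentSpace (𝓡 (5 + m)) x)) hc).symm

theorem IsApparentField.inner_potential (hX₀ : S.IsApparentField D μ X₀) (hY : S.IsPotential Y)
    {x : M} (hx : x ∈ D) : S.metric.val x (X₀ x) (Y x) = 0 :=
  potential_mem_perp hY x (hX₀.mem_horizontal hx)

theorem IsApparentField.pressure_apply (hX₀ : S.IsApparentField D μ X₀) (hY : S.IsPotential Y)
    {x : M} (hx : x ∈ D) (u v : TangentSpace (𝓡 (5 + m)) x) :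
    S.pressure Y X₀ x u v = S.G x u v - S.G x
      (-(S.metric.val x (X₀ x) u • X₀ x) - S.metric.val x (Y x) u • Y x)
      (-(S.metric.val x (X₀ x) v • X₀ x) - S.metric.val x (Y x) v • Y x) := by
  have h := S.metric.orthProj_span_pair (hX₀.unit x hx) (hY.unit x) (hX₀.inner_potential hY hx)
  rw [← h u, ← h v]
  rfl

theorem IsPerfect.pressure_apply_potential (hP : S.IsPerfect D Y X₀) {x : M} (hx : x ∈ D)
    (u : TangentSpace (𝓡 (5 + m)) x) : S.pressure Y X₀ x u (Y x) = 0 := by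
  rw [← S.metric.inner_endoField, hP x hx]
  simp

end

end Spacetime

/-! ### Intrinsic derivatives expressed through local representatives. -/

section LocalFields

variable {E : Type*} [NormedAddCommGroup E] [NormedSpace ℝ E]
  {M : Type*} [TopologicalSpace M] [ChartedSpace E M]

theorem localVec_smul (f : M → ℝ) (V : VecField E M) (x : M) (y : E) :
    localVec (fun z => f z • V z) x y = f (param x y) • localVec V x y :=
  map_smul (dparam x y).inverse _ _

theorem localVec_add (V V' : VecField E M) (x : M) (y : E) :
    localVec (fun z => V z + V' z) x y = localVec V x y + localVec V' x y :=
  map_add (dparam x y).inverse _ _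

namespace SemiRiemannianMetric

variable [IsManifold 𝓘(ℝ, E) ∞ M] (g : SemiRiemannianMetric E M)

theorem nablaAlong_eq {V : VecField E M} {x : M} {V' : E → E}
    (h : localVec V x =ᶠ[nhds (coord x x)] V') (V₀ : VecField E M) :
    g.nablaAlong V₀ V x =
      covDerivVec (localBilin g.val x) V' (coord x x) (localVec V₀ x (coord x x)) := by
  rw [← covDerivVec_congr _ h, localVec_self]
  rfl

variable [FiniteDimensional ℝ E]

theorem div_eq_trace {V : VecField E M} {x : M} {V' : E → E}
    (h : localVec V x =ᶠ[nhds (coord x x)] V') :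
    g.div V x = traceL E (covDerivVec (localBilin g.val x) V' (coord x x)) := by
  rw [← covDerivVec_congr _ h]
  rfl

theorem divBilin_eq (T : BilinField E M) (x : M) :
    g.divBilin T x = sharp (localBilin g.val x (coord x x))
      (divForm (localBilin g.val x) (localBilin T x) (coord x x)) := by
  rw [localBilin_self]
  rfl

theorem inner_divBilin (T : BilinField E M) (V : VecField E M) (x : M) :
    g.val x (V x) (g.divBilin T x) =
      divForm (localBilin g.val x) (localBilin T x) (coord x x) (localVec V x (coord x x)) := by
  have h := flat_sharp ((g.isMetricOn x).nondeg _ (coord_self_mem_chartDomain x))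
    (divForm (localBilin g.val x) (localBilin T x) (coord x x))
  rw [g.symm, divBilin_eq, localVec_self]
  rw [localBilin_self] at h ⊢
  exact congrArg (fun α : E →L[ℝ] ℝ => α (V x)) h

end SemiRiemannianMetric

end LocalFields

/-! ### The fluid in a preferred chart. -/

namespace Spacetime

variable {m : ℕ}
  {M : Type*} [TopologicalSpace M] [ChartedSpace (R (5 + m)) M] [IsManifold (𝓡 (5 + m)) ∞ M]
  {B : Type*} [TopologicalSpace B] [ChartedSpace (R 4) B] [IsManifold (𝓡 4) ∞ B]
  {W : Type*} [TopologicalSpace W] [ChartedSpace (R m) W] [IsManifold (𝓡 m) ∞ W]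
  {S : Spacetime m M B W} {D : Set M} {μ : M → ℝ} {X₀ Y : VecField (R (5 + m)) M}

theorem einstein_localVec (V V' : VecField (R (5 + m)) M) {x : M} {y : R (5 + m)}
    (hy : y ∈ chartDomain (R (5 + m)) x) :
    einstein (localBilin S.metric.val x) y (localVec V x y) (localVec V' x y) =
      S.G (param x y) (V (param x y)) (V' (param x y)) := by
  rw [← S.metric.localBilin_einsteinField hy, localBilin_localVec hy]
  rfl

theorem IsApparentField.einstein_localVec_self (hX₀ : S.IsApparentField D μ X₀)
    (hμ : S.IsEnergyDensity D μ) {x : M} {y : R (5 + m)} (hy : y ∈ chartDomain (R (5 + m)) x)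
    (h : param x y ∈ D) :
    einstein (localBilin S.metric.val x) y (localVec X₀ x y) (localVec X₀ x y) =
      μ (param x y) := by
  rw [einstein_localVec X₀ X₀ hy, hX₀.energy_eq hμ h]

/-- The expression of a perfect fluid in a preferred chart. -/
theorem IsApparentField.isPerfectFluidOn (hX₀ : S.IsApparentField D μ X₀) (hY : S.IsPotential Y)
    (hK : S.metric.IsKilling Y) (hD : IsOpen D) (hμ : S.IsEnergyDensity D μ)
    (hP : S.IsPerfect D Y X₀) (x : M) :
    IsPerfectFluidOn (localBilin S.metric.val x) (localVec Y x) (localVec X₀ x)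
      (localBilin (S.pressure Y X₀) x)
      {y | y ∈ chartDomain (R (5 + m)) x ∧ param x y ∈ D} where
  metric := (S.metric.isMetricOn x).mono
    (isOpen_iff_mem_nhds.2 fun _ hy => eventually_param_mem hy.1 hD hy.2) fun _ hy => hy.1
  killing := (S.metric.isKillingOn hY.smooth hK x).mono fun _ hy => hy.1
  contDiffAt y hy := contDiffAt_localVec hD hX₀.smooth hy.1 hy.2
  inner_potential y hy := by rw [localBilin_localVec hy.1, hY.unit]
  inner_field y hy := by rw [localBilin_localVec hy.1, hX₀.unit _ hy.2]
  inner_field_potential y hy := by rw [localBilin_localVec hy.1, hX₀.inner_potential hY hy.2]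
  energy_ne_zero y hy := by
    rw [hX₀.einstein_localVec_self hμ hy.1 hy.2]
    exact (hμ _ hy.2).1.ne'
  pressure y hy u v := by
    have key : ∀ u, dparam x y (-(localBilin S.metric.val x y (localVec X₀ x y) u • localVec X₀ x y)
        - localBilin S.metric.val x y (localVec Y x y) u • localVec Y x y) =
        -(S.metric.val (param x y) (X₀ (param x y)) (dparam x y u) • X₀ (param x y))
        - S.metric.val (param x y) (Y (param x y)) (dparam x y u) • Y (param x y) := by
      intro u
      rw [map_sub, map_neg, map_smul, map_smul, dparam_localVec hy.1, dparam_localVec hy.1,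
        localBilin_apply, localBilin_apply, dparam_localVec hy.1, dparam_localVec hy.1]
      rfl
    rw [← S.metric.localBilin_einsteinField hy.1, localBilin_apply, localBilin_apply,
      localBilin_apply, key, key]
    exact hX₀.pressure_apply hY hy.2 (dparam x y u) (dparam x y v)
  perfect y hy u := by
    rw [localBilin_apply, dparam_localVec hy.1]
    exact hP.pressure_apply_potential hy.2 (dparam x y u)

theorem IsApparentField.lieBracketAt_eq_zero (hX₀ : S.IsApparentField D μ X₀)
    (hY : S.IsPotential Y) (hK : S.metric.IsKilling Y) (hD : IsOpen D)
    (hμ : S.IsEnergyDensity D μ) {x : M} (hx : x ∈ D) :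
    lieBracketAt (localVec Y x) (localVec X₀ x) (coord x x) = 0 := by
  -- Shrinking the domain so that $\pi$ lands in one chart of $B$ turns $\pi$ into a map `p` between
  -- vector spaces, with $\ker dp$ the vertical space.
  let D' : Set M := D ∩ S.proj ⁻¹' (chartAt (R 4) (S.proj x)).source
  have hD' : IsOpen D' :=
    hD.inter ((chartAt (R 4) (S.proj x)).open_source.preimage S.proj_smooth.continuous)
  have hxD' : param (E := R (5 + m)) x (coord x x) ∈ D' := by
    rw [param_coord_self]
    exact ⟨hx, mem_chart_source (R 4) (S.proj x)⟩
  let U : Set (R (5 + m)) := {y | y ∈ chartDomain (R (5 + m)) x ∧ param x y ∈ D'}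
  have hU : IsOpen U := isOpen_iff_mem_nhds.2 fun _ hy => eventually_param_mem hy.1 hD' hy.2
  have hx0 := coord_self_mem_chartDomain (E := R (5 + m)) x
  have hxU : coord x x ∈ U := ⟨hx0, hxD'⟩
  have hsurj : ∀ u : R (5 + m), ∃ a : R (5 + m),
      dparam (E := R (5 + m)) x (coord (E := R (5 + m)) x x) a = u := fun u =>
    ⟨_, dparam_right_inv hx0 u⟩
  let p : R (5 + m) → R 4 := fun y => coord (E := R 4) (S.proj x) (S.proj (param x y))
  have hker : ∀ y ∈ U, ∀ v, fderiv ℝ p y v = 0 ↔ (dparam x y v : R (5 + m)) ∈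
      (S.vertical (param x y) : Submodule ℝ (R (5 + m))) := fun y hy v =>
    fderiv_coord_comp_param_eq_zero_iff S.proj_smooth hy.1 hy.2.2 v
  have hhor : ∀ y ∈ U, ∀ u, (∀ v, fderiv ℝ p y v = 0 → localBilin S.metric.val x y u v = 0) ↔
      (dparam x y u : R (5 + m)) ∈ (S.horizontal (param x y) : Submodule ℝ (R (5 + m))) := by
    intro y hy u
    constructor
    · intro h v hv
      have h1 := dparam_right_inv (x := x) hy.1 v
      rw [← h1]
      refine h _ ((hker y hy _).2 ?_)
      rw [h1]
      exact hv
    · intro h v hv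
      exact h _ ((hker y hy v).1 hv)
  have hg := (S.metric.isMetricOn x).mono hU fun _ hy => hy.1
  have hXs : ∀ y ∈ U, ContDiffAt ℝ ∞ (localVec X₀ x) y := fun y hy =>
    contDiffAt_localVec hD hX₀.smooth hy.1 hy.2.1
  have hGs : ∀ y ∈ U, ∀ u v, einstein (localBilin S.metric.val x) y u v =
      (S.G (param x y) : R (5 + m) →L[ℝ] R (5 + m) →L[ℝ] ℝ) (dparam x y u) (dparam x y v) :=
    fun y hy u v => by
      rw [← S.metric.localBilin_einsteinField hy.1]
      rfl
  refine IsKillingOn.lieBracketAt_eigenvector_eq_zero (p := p) (U := U)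
    (μ := fun y => einstein (localBilin S.metric.val x) y (localVec X₀ x y) (localVec X₀ x y))
    ((S.metric.isKillingOn hY.smooth hK x).mono fun _ hy => hy.1) hg hxU
    (fun y hy => contDiffAt_coord_comp_param S.proj_smooth hy.1 hy.2.2) ?_ ?_
    (hXs _ hxU).differentiableAt_infty ?_ ?_ ?_ ?_ ?_
  · intro y hy
    rw [hker y hy, dparam_localVec hy.1]
    exact (hY.tangent _).1
  · intro w
    obtain ⟨w', hw'⟩ := (mfderiv_coord_bijective hxU.2.2).2 w
    obtain ⟨u, hu⟩ := S.mfderiv_proj_surjective (param (E := R (5 + m)) x (coord x x)) w'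
    obtain ⟨a, ha⟩ := hsurj u
    refine ⟨a, (fderiv_coord_comp_param S.proj_smooth hxU.1 hxU.2.2 a).trans ?_⟩
    rw [ha]
    exact (congrArg _ hu).trans hw'
  · exact ((hg.contDiffAt_einstein hxU).differentiableAt_infty.clm_apply
      (hXs _ hxU).differentiableAt_infty).clm_apply (hXs _ hxU).differentiableAt_infty
  · intro y hy
    rw [localBilin_localVec hy.1, hX₀.unit _ hy.2.1]
  · intro y hy
    rw [hhor y hy, dparam_localVec hy.1]
    exact hX₀.mem_horizontal hy.2.1
  · intro y hy u hu
    rw [hX₀.einstein_localVec_self hμ hy.1 hy.2.1, hGs y hy, localBilin_apply,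
      dparam_localVec hy.1]
    exact hX₀.apply_eq hμ hy.2.1 ((hhor y hy u).1 hu)
  · intro w hw h
    rw [hX₀.einstein_localVec_self hμ hx0 hxD'.1] at h
    obtain ⟨c, hc⟩ := hX₀.eq_smul hμ hxD'.1 ((hhor _ hxU w).1 hw) (by
      intro u hu
      obtain ⟨a, ha⟩ := hsurj u
      have h2 := h a ((hhor _ hxU a).2 (by rw [ha]; exact hu))
      rw [hGs _ hxU, localBilin_apply, ha] at h2
      exact h2)
    refine ⟨c, dparam_injective hx0 ?_⟩
    rw [map_smul, dparam_localVec hx0]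
    exact hc

end Spacetime

end KaluzaKlein

/-! ### Transfer of the coordinate identities to the manifold. -/

theorem mainTheorem4 {m : ℕ}
    {M : Type*} [TopologicalSpace M] [ChartedSpace (KaluzaKlein.R (5 + m)) M]
    [IsManifold (𝓡 (5 + m)) ∞ M]
    {B : Type*} [TopologicalSpace B] [ChartedSpace (KaluzaKlein.R 4) B] [IsManifold (𝓡 4) ∞ B]
    {W : Type*} [TopologicalSpace W] [ChartedSpace (KaluzaKlein.R m) W] [IsManifold (𝓡 m) ∞ W]
    [CompactSpace W]
    (S : KaluzaKlein.Spacetime m M B W)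
    (Y : KaluzaKlein.VecField (KaluzaKlein.R (5 + m)) M) (hY : S.IsPotential Y)
    (hK : S.metric.IsKilling Y)
    (D : Set M) (hD : S.IsFluidDomain D)
    (μ : M → ℝ) (hμ : S.IsEnergyDensity D μ)
    (X₀ : KaluzaKlein.VecField (KaluzaKlein.R (5 + m)) M) (hX₀ : S.IsApparentField D μ X₀)
    (hP : S.IsPerfect D Y X₀) :
    let g := S.metric
    let e := S.charge Y X₀
    let X := S.fluidField Y X₀ μ
    let P := S.pressure Y X₀
    let F := S.emField Y
    ContMDiffOn (𝓡 (5 + m)) 𝓘(ℝ, ℝ) ∞ μ D ∧ ContMDiffOn (𝓡 (5 + m)) 𝓘(ℝ, ℝ) ∞ e D ∧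
    ∀ x ∈ D,
      -- energy conservation
      (g.div (fun z => μ z • X z) x = g.val x (X₀ x) (g.divBilin P x) ∧
        g.div (fun z => μ z • X₀ z) x = g.val x (X₀ x) (g.divBilin P x)) ∧
      -- electric charge conservation
      (g.div (fun z => e z • X z) x = 0 ∧ g.div (fun z => e z • X₀ z) x = 0) ∧
      -- evolution of the charge to energy ratio
      (μ x ^ 2 * KaluzaKlein.dirDeriv X (fun z => e z / μ z) x
          = -(e x * g.val x (X₀ x) (g.divBilin P x)) ∧
        μ x ^ 2 * KaluzaKlein.dirDeriv X₀ (fun z => e z / μ z) x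
          = -(e x * g.val x (X₀ x) (g.divBilin P x))) ∧
      -- motion of the fluid
      μ x • g.nablaAlong X X x
        = -g.divBilin P x - g.val x (X₀ x) (g.divBilin P x) • X x ∧
      -- motion of the apparent fluid
      μ x • g.nablaAlong X₀ X₀ x
        = e x • g.endoField F x (X₀ x) - g.divBilin P x
          - g.val x (X₀ x) (g.divBilin P x) • X₀ x ∧
      -- Maxwell equations
      (∀ u v w, KaluzaKlein.extDerivTwo F x u v w = 0) ∧
      g.divBilin F x = e x • X₀ x + (1 / 2 * g.norm F x) • Y x ∧
      -- horizontal part of the second Maxwell equation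
      (g.orthProj x (S.horizontal x) (g.divBilin F x) : TangentSpace (𝓡 (5 + m)) x)
        = e x • X₀ x := by
  intro g e X P F
  have hU : ∀ x, KaluzaKlein.IsPerfectFluidOn (KaluzaKlein.localBilin g.val x)
      (KaluzaKlein.localVec Y x) (KaluzaKlein.localVec X₀ x) (KaluzaKlein.localBilin P x)
      {y | y ∈ KaluzaKlein.chartDomain (KaluzaKlein.R (5 + m)) x ∧ KaluzaKlein.param x y ∈ D} :=
    fun x => hX₀.isPerfectFluidOn hY hK hD.1 hμ hP x
  have hmem : ∀ x ∈ D, KaluzaKlein.coord x x ∈ {y | y ∈ KaluzaKlein.chartDomain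
      (KaluzaKlein.R (5 + m)) x ∧ KaluzaKlein.param x y ∈ D} := fun x hx =>
    ⟨KaluzaKlein.coord_self_mem_chartDomain x, by rwa [KaluzaKlein.param_coord_self]⟩
  have heμ : ∀ x ∈ D, (fun y => μ (KaluzaKlein.param x y)) =ᶠ[nhds (KaluzaKlein.coord x x)]
      fun y => KaluzaKlein.einstein (KaluzaKlein.localBilin g.val x) y
        (KaluzaKlein.localVec X₀ x y) (KaluzaKlein.localVec X₀ x y) := fun x hx => by
    filter_upwards [(hU x).metric.mem_nhds (hmem x hx)] with y hy
    rw [hX₀.einstein_localVec_self hμ hy.1 hy.2]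
  have hee : ∀ x ∈ D, (fun y => e (KaluzaKlein.param x y)) =ᶠ[nhds (KaluzaKlein.coord x x)]
      fun y => KaluzaKlein.einstein (KaluzaKlein.localBilin g.val x) y
        (KaluzaKlein.localVec X₀ x y) (KaluzaKlein.localVec Y x y) := fun x hx => by
    filter_upwards [(hU x).metric.mem_nhds (hmem x hx)] with y hy
    rw [KaluzaKlein.Spacetime.einstein_localVec X₀ Y hy.1]
    rfl
  refine ⟨fun x hx => ?_, fun x hx => ?_, fun x hx => ?_⟩
  · refine (KaluzaKlein.contMDiffAt_of_contDiffAt_param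
      (ContDiffAt.congr_of_eventuallyEq ?_ (heμ x hx))).contMDiffWithinAt
    have h := (hU x).contDiffAt _ (hmem x hx)
    exact (((hU x).metric.contDiffAt_einstein (hmem x hx)).clm_apply h).clm_apply h
  · refine (KaluzaKlein.contMDiffAt_of_contDiffAt_param
      (ContDiffAt.congr_of_eventuallyEq ?_ (hee x hx))).contMDiffWithinAt
    exact (((hU x).metric.contDiffAt_einstein (hmem x hx)).clm_apply
      ((hU x).contDiffAt _ (hmem x hx))).clm_apply ((hU x).killing.contDiffAt _ (hmem x hx))
  · have hf := hU x
    have hy := hmem x hx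
    have hbr := hX₀.lieBracketAt_eq_zero hY hK hD.1 hμ hx
    have hy0 := KaluzaKlein.coord_self_mem_chartDomain (E := KaluzaKlein.R (5 + m)) x
    set y := KaluzaKlein.coord (E := KaluzaKlein.R (5 + m)) x x with hydef
    have hXl : KaluzaKlein.localVec X₀ x y = X₀ x := KaluzaKlein.localVec_self X₀ x
    have hYl : KaluzaKlein.localVec Y x y = Y x := KaluzaKlein.localVec_self Y x
    have hgl : KaluzaKlein.localBilin g.val x y = g.val x := KaluzaKlein.localBilin_self g.val x
    have hμx : KaluzaKlein.einstein (KaluzaKlein.localBilin g.val x) y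
        (KaluzaKlein.localVec X₀ x y) (KaluzaKlein.localVec X₀ x y) = μ x :=
      (heμ x hx).self_of_nhds.symm.trans (congrArg μ (KaluzaKlein.param_coord_self x))
    have hex : KaluzaKlein.einstein (KaluzaKlein.localBilin g.val x) y
        (KaluzaKlein.localVec X₀ x y) (KaluzaKlein.localVec Y x y) = e x :=
      (hee x hx).self_of_nhds.symm.trans (congrArg e (KaluzaKlein.param_coord_self x))
    have hμ0 : μ x ≠ 0 := (hμ x hx).1.ne'
    have hratio : (fun z => e (KaluzaKlein.param x z) / μ (KaluzaKlein.param x z)) =ᶠ[nhds y]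
        fun z => KaluzaKlein.einstein (KaluzaKlein.localBilin g.val x) z
          (KaluzaKlein.localVec X₀ x z) (KaluzaKlein.localVec Y x z) /
            KaluzaKlein.einstein (KaluzaKlein.localBilin g.val x) z
              (KaluzaKlein.localVec X₀ x z) (KaluzaKlein.localVec X₀ x z) := by
      filter_upwards [heμ x hx, hee x hx] with z h1 h2
      rw [h1, h2]
    have hX : KaluzaKlein.localVec X x =ᶠ[nhds y] fun z => KaluzaKlein.localVec X₀ x z +
        (KaluzaKlein.einstein (KaluzaKlein.localBilin g.val x) z (KaluzaKlein.localVec X₀ x z)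
          (KaluzaKlein.localVec Y x z) / KaluzaKlein.einstein (KaluzaKlein.localBilin g.val x) z
            (KaluzaKlein.localVec X₀ x z) (KaluzaKlein.localVec X₀ x z)) •
          KaluzaKlein.localVec Y x z := by
      filter_upwards [hratio] with z hz
      rw [← hz]
      exact (KaluzaKlein.localVec_add X₀ (fun w => (e w / μ w) • Y w) x z).trans
        (congrArg _ (KaluzaKlein.localVec_smul (fun w => e w / μ w) Y x z))
    have hdiv : ∀ (f : M → ℝ) (f' : KaluzaKlein.R (5 + m) → ℝ)
        (V : KaluzaKlein.VecField (KaluzaKlein.R (5 + m)) M)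
        (V' : KaluzaKlein.R (5 + m) → KaluzaKlein.R (5 + m)),
        (fun z => f (KaluzaKlein.param x z)) =ᶠ[nhds y] f' →
        KaluzaKlein.localVec V x =ᶠ[nhds y] V' →
        g.div (fun z => f z • V z) x = KaluzaKlein.traceL (KaluzaKlein.R (5 + m))
          (KaluzaKlein.covDerivVec (KaluzaKlein.localBilin g.val x) (fun z => f' z • V' z) y) := by
      intro f f' V V' h1 h2
      refine g.div_eq_trace ?_
      filter_upwards [h1, h2] with z h1 h2
      rw [KaluzaKlein.localVec_smul, h1, h2]
    have hXrefl : KaluzaKlein.localVec X₀ x =ᶠ[nhds y] KaluzaKlein.localVec X₀ x :=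
      Filter.EventuallyEq.rfl
    have hinner : KaluzaKlein.divForm (KaluzaKlein.localBilin g.val x)
        (KaluzaKlein.localBilin P x) y (KaluzaKlein.localVec X₀ x y) =
        g.val x (X₀ x) (g.divBilin P x) := by
      rw [g.inner_divBilin P X₀ x]
    have hFK : ∀ z ∈ KaluzaKlein.chartDomain (KaluzaKlein.R (5 + m)) x,
        ∀ u v : KaluzaKlein.R (5 + m), KaluzaKlein.localBilin F x z u v =
          2 * KaluzaKlein.localBilin g.val x z (KaluzaKlein.covDerivVec
            (KaluzaKlein.localBilin g.val x) (KaluzaKlein.localVec Y x) z u) v :=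
      fun z hz u v => g.localBilin_extDerivOne_flat_of_isKilling hY.smooth hK hz u v
    have hFx : g.divBilin F x = e x • X₀ x + (1 / 2 * g.norm F x) • Y x := by
      have h := hf.sharp_divForm_two_covDeriv hy
        (g.contDiffAt_localBilin_extDerivOne_flat hY.smooth hy0).differentiableAt_infty
        fun z hz u v => hFK z hz.1 u v
      rw [hex, hXl, hYl] at h
      have hn : KaluzaKlein.normG (KaluzaKlein.localBilin g.val x y)
          (KaluzaKlein.localBilin F x y) = g.norm F x := by
        rw [hgl, KaluzaKlein.localBilin_self F x]
        rfl
      rw [← hn]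
      exact (g.divBilin_eq F x).trans h
    let A : KaluzaKlein.R (5 + m) →L[ℝ] KaluzaKlein.R (5 + m) :=
      KaluzaKlein.covDerivVec (KaluzaKlein.localBilin g.val x) (KaluzaKlein.localVec Y x) y
    -- The sign comes from $T$ having its endomorphism argument second:
    -- $g(u,{}^eF(X_0))=F(u,X_0)=2g(\nabla_uY,X_0)=-2g(u,\nabla_{X_0}Y)$.
    have hFX : g.endoField F x (X₀ x) = (-2 : ℝ) • A (X₀ x) := by
      refine sub_eq_zero.1 (g.nondegenerate x _ fun u => ?_)
      have h1 : F x u (X₀ x) = 2 * g.val x (A u) (X₀ x) := by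
        rw [← hgl, ← KaluzaKlein.localBilin_self F x]
        exact hFK y hy0 u (X₀ x)
      have h2 : g.val x (A u) (X₀ x) + g.val x (A (X₀ x)) u = 0 := by
        rw [← hgl]
        exact hf.killing.inner_add y hy u (X₀ x)
      have h3 := g.inner_endoField F u (X₀ x)
      have h4 : ∀ a b : TangentSpace (𝓡 (5 + m)) x,
          g.val x (a - (-2 : ℝ) • b) u = g.val x a u + 2 * g.val x b u := fun a b => by
        simp
      refine (h4 _ (A (X₀ x))).trans ?_
      linarith
    have henergy := (hdiv μ _ X₀ _ (heμ x hx) hXrefl).trans (hf.trace_energy_smul_field hy hbr)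
    have hcharge := (hdiv e _ X₀ _ (hee x hx) hXrefl).trans (hf.trace_charge_smul_field hy)
    -- Here `r` is the differential of $e/\mu$ at `x`; its vanishing on $Y$ makes the derivatives
    -- along $X$ and $X_0$ agree.
    obtain ⟨r, hd, hd0, hdir⟩ : ∃ r : KaluzaKlein.R (5 + m) →L[ℝ] ℝ,
        μ x * r (X₀ x) = -(e x / μ x) * g.val x (X₀ x) (g.divBilin P x) ∧ r (Y x) = 0 ∧
        ∀ V : KaluzaKlein.VecField (KaluzaKlein.R (5 + m)) M,
          KaluzaKlein.dirDeriv V (fun z => e z / μ z) x = r (V x) := by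
      have hd := hf.energy_mul_fderiv_ratio hy hbr
      have hd0 := hf.fderiv_ratio_potential hy hbr
      rw [hinner, hμx, hex, hXl] at hd
      rw [hYl] at hd0
      refine ⟨_, hd, hd0, fun V => ?_⟩
      rw [← hratio.fderiv_eq]
      exact KaluzaKlein.dirDeriv_eq_fderiv V
        ((hf.differentiableAt_ratio hy).congr_of_eventuallyEq hratio)
    have hr0 : μ x ^ 2 * KaluzaKlein.dirDeriv X₀ (fun z => e z / μ z) x
          = -(e x * g.val x (X₀ x) (g.divBilin P x)) := by
      rw [hdir, pow_two, mul_assoc, hd]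
      field_simp
    have hrX : KaluzaKlein.dirDeriv X (fun z => e z / μ z) x =
        KaluzaKlein.dirDeriv X₀ (fun z => e z / μ z) x := by
      rw [hdir, hdir]
      have h : ∀ a b : KaluzaKlein.R (5 + m), ∀ c : ℝ, r b = 0 → r (a + c • b) = r a :=
        fun a b c hb => by rw [map_add, map_smul, hb, smul_zero, add_zero]
      exact h (X₀ x) (Y x) (e x / μ x) hd0
    refine ⟨⟨?_, ?_⟩, ⟨?_, ?_⟩, ⟨?_, ?_⟩, ?_, ?_, ?_, ?_, ?_⟩
    · rw [hdiv μ _ X _ (heμ x hx) hX, hf.trace_smul_fluid hy hbr (hf.differentiableAt_energy hy)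
        (hf.fderiv_energy_potential hy hbr), hf.trace_energy_smul_field hy hbr, hinner]
    · rw [henergy, hinner]
    · rw [hdiv e _ X _ (hee x hx) hX, hf.trace_smul_fluid hy hbr (hf.differentiableAt_charge hy)
        (hf.fderiv_charge_potential hy hbr), hf.trace_charge_smul_field hy]
    · exact hcharge
    · rw [hrX, hr0]
    · exact hr0
    · have h := hf.energy_smul_covDerivVec_fluid hy hbr
      rw [hinner, hμx, hex, hXl, hYl, ← g.divBilin_eq] at h
      rw [g.nablaAlong_eq hX, KaluzaKlein.localVec_self]
      exact h
    · have h := hf.energy_smul_covDerivVec_field hy hbr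
      rw [hinner, hμx, hex, hXl, ← g.divBilin_eq] at h
      rw [g.nablaAlong_eq hXrefl, KaluzaKlein.localVec_self, hFX]
      exact h
    · exact g.extDerivTwo_extDerivOne_flat hY.smooth x
    · exact hFx
    · rw [hFx]
      -- The first summand is horizontal and the second, a multiple of $Y$, is orthogonal to the
      -- horizontal space.
      refine g.orthProj_add (KaluzaKlein.Spacetime.isCompl_horizontal (hμ x hx))
        (Submodule.smul_mem _ _ (hX₀.mem_horizontal hx)) (Submodule.smul_mem _ _ fun v hv => ?_)
      rw [g.symm]
      exact KaluzaKlein.Spacetime.potential_mem_perp hY x hv
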